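/- Let $n\ge 1$. For an immersed hypersurface $x:M^n\to\mathbb R^{n+1}$ with unit normal $\nu$ let $g_{ij}=\langle\partial_i x,\partial_j x\rangle$ be the induced metric, $\Delta$ its Laplace–Beltrami operator, $h_{ij}=-\langle\nu,\partial_i\partial_j x\rangle$, $H=g^{ij}h_{ij}$ and $|A|^2=g^{ik}g^{jl}h_{ij}h_{kl}$. The rescaled mean curvature flow is the equation $\partial_t x=-H\nu+x$; its normal part is $\langle\partial_t x,\nu\rangle=-H+\langle x,\nu\rangle$. (1) Let $M$ be a smooth $n$-manifold, $I\subset\mathbb R$ an open set of times, and let $x^s(p,t)$ ($s$ in an open set $J\ni 0$, $p\in M$, $t\in I$) be a smooth family of maps such that every $x^s(\cdot,t)$ is an immersion, with unit normals $\nu^s(p,t)$ depending smoothly on all variables. Suppose that $x=x^0$ solves the rescaled mean curvature flow and that every $x^s$ satisfies the normal part of the rescaled flow (for instance, every $x^s$ solves the rescaled flow). Put $u=\frac{d}{ds}x^s|_{s=0}$, $\nu=\nu^0$ and $w=\langle u,\nu\rangle$. Then on $M\times I$ $$\partial_t w=\Delta w+|A|^2w+w,$$ where $\Delta$ and $|A|^2$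 are those of $x(\cdot,t)$. (2) The sphere $S^n$ of radius $\sqrt n$ centred at the origin, with its outer normal, is a stationary solution of the rescaled flow, and for a variation of it as in (1) the equation reads $\partial_t w=\Delta_{S^n}w+2w$. (3) Let $x_{S^n}$ denote the inclusion of this sphere and, for $x(\cdot,t):S^n\to\mathbb R^{n+1}$ with unit normal $\nu(\cdot,t)$, let $u=x-x_{S^n}$ and $w=\langle u,\nu\rangle$. Denote by $j=(u,\nabla u,\nabla^2u,w,\nabla w,\nabla^2 w)$ the values at a point of $u$, $w$ and their first and second covariant derivatives on $S^n$. There are $\varepsilon>0$, $C$ and a smooth function $Q=Q(p,j)$, defined for $p\in S^n$ and $|j|<\varepsilon$, with $|Q(p,j)|\le C|j|^2$, all depending only on $n$, such that for every smooth family of immersions $x(\cdot,t)$, $t$ in an open set, with smooth unit normals, which solves the rescaled mean curvature flow, $$\partial_t w=\Delta_{S^n}w+2w+Q(p,j(p,t))$$ at all $(p,t)$ with $|j(p,t)|<\varepsilon$ at which $\nu$ is outward, i.e. $\langle\nu,x_{S^n}\rangle>0$. The same holds, with possibly different $\varepsilon$, $C$, $Q$, for families of radial graphs over $S^n$ (that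 is, $x(p,t)$ is a positive multiple of $p$) which satisfy the normal part of the rescaled flow. -/

import Mathlib

open Set Function
open scoped Manifold ContDiff

/-! ## Coordinate formulas for a parametrized hypersurface -/

section Coordinates

variable {n : ℕ} {V W : Type*} [NormedAddCommGroup V] [NormedSpace ℝ V]
  [NormedAddCommGroup W] [InnerProductSpace ℝ W]

/-- The partial derivative `∂ᵢ f` of a map defined on `ℝⁿ`. -/
noncomputable def pderiv (i : Fin n) (f : EuclideanSpace ℝ (Fin n) → V) :
    EuclideanSpace ℝ (Fin n) → V :=
  fun y => fderiv ℝ f y (EuclideanSpace.single i 1)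

/-- The induced metric `g i j = ⟨∂ᵢ F, ∂ⱼ F⟩`. -/
noncomputable def coordMetric (F : EuclideanSpace ℝ (Fin n) → W)
    (y : EuclideanSpace ℝ (Fin n)) : Matrix (Fin n) (Fin n) ℝ :=
  Matrix.of fun i j => inner ℝ (pderiv i F y) (pderiv j F y)

/-- The inverse `gⁱʲ` of the induced metric. -/
noncomputable def coordMetricInv (F : EuclideanSpace ℝ (Fin n) → W)
    (y : EuclideanSpace ℝ (Fin n)) : Matrix (Fin n) (Fin n) ℝ :=
  (coordMetric F y)⁻¹

/-- The Christoffel symbol `Γᵏᵢⱼ = ½ gᵏˡ (∂ᵢ gⱼₗ + ∂ⱼ gᵢₗ - ∂ₗ gᵢⱼ)` of the induced metric. -/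
noncomputable def coordChristoffel (F : EuclideanSpace ℝ (Fin n) → W) (k i j : Fin n)
    (y : EuclideanSpace ℝ (Fin n)) : ℝ :=
  (1 / 2 : ℝ) * ∑ l, coordMetricInv F y k l *
    (pderiv i (fun z => coordMetric F z j l) y + pderiv j (fun z => coordMetric F z i l) y
      - pderiv l (fun z => coordMetric F z i j) y)

/-- The second fundamental form `h i j = -⟨N, ∂ᵢ ∂ⱼ F⟩`, where `N` is the unit normal vector at
the point considered. -/
noncomputable def coordSecondFF (F : EuclideanSpace ℝ (Fin n) → W) (N : W)
    (y : EuclideanSpace ℝ (Fin n)) (i j : Fin n) : ℝ :=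
  - inner ℝ N (pderiv i (pderiv j F) y)

/-- The second covariant derivative `∇ᵢ ∇ⱼ φ = ∂ᵢ ∂ⱼ φ - Γᵏᵢⱼ ∂ₖ φ` of a (vector valued) function,
with respect to the metric induced by `F`. -/
noncomputable def coordCovHess (F : EuclideanSpace ℝ (Fin n) → W)
    (φ : EuclideanSpace ℝ (Fin n) → V) (y : EuclideanSpace ℝ (Fin n)) (i j : Fin n) : V :=
  pderiv i (pderiv j φ) y - ∑ k, coordChristoffel F k i j y • pderiv k φ y

end Coordinates

/-! ## Geometry of an immersed hypersurface `F : M → ℝⁿ⁺¹` -/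

section Geometry

variable {n : ℕ} {M : Type*} [TopologicalSpace M] [ChartedSpace (EuclideanSpace ℝ (Fin n)) M]
  {V : Type*} [NormedAddCommGroup V] [NormedSpace ℝ V]

/-- The expression of `φ` in the preferred chart around `p`. The geometric quantities below are
invariant under changes of coordinates; at `p` they are computed in that chart. -/
noncomputable def inCoords (φ : M → V) (p : M) : EuclideanSpace ℝ (Fin n) → V :=
  fun y => φ ((extChartAt (𝓡 n) p).symm y)

/-- The inverse induced metric `gⁱʲ` at `p`. -/
noncomputable def metricInvAt (F : M → EuclideanSpace ℝ (Fin (n + 1))) (p : M) :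
    Matrix (Fin n) (Fin n) ℝ :=
  coordMetricInv (inCoords F p) (extChartAt (𝓡 n) p p)

/-- The coordinate vector `∂ᵢ φ` at `p`. -/
noncomputable def partialAt (φ : M → V) (p : M) (i : Fin n) : V :=
  pderiv i (inCoords φ p) (extChartAt (𝓡 n) p p)

/-- The components `h i j` of the second fundamental form at `p`. -/
noncomputable def secondFFAt (F ν : M → EuclideanSpace ℝ (Fin (n + 1))) (p : M)
    (i j : Fin n) : ℝ :=
  coordSecondFF (inCoords F p) (ν p) (extChartAt (𝓡 n) p p) i j

/-- The components `∇ᵢ ∇ⱼ φ` of the second covariant derivative at `p`, for the metric induced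
by `F`. -/
noncomputable def covHessAt (F : M → EuclideanSpace ℝ (Fin (n + 1))) (φ : M → V) (p : M)
    (i j : Fin n) : V :=
  coordCovHess (inCoords F p) (inCoords φ p) (extChartAt (𝓡 n) p p) i j

/-- The mean curvature `H = gⁱʲ hᵢⱼ` with respect to the unit normal `ν`. -/
noncomputable def meanCurvature (F ν : M → EuclideanSpace ℝ (Fin (n + 1))) (p : M) : ℝ :=
  ∑ i, ∑ j, metricInvAt F p i j * secondFFAt F ν p i j

/-- The squared norm `|A|² = gⁱᵏ gʲˡ hᵢⱼ hₖₗ` of the second fundamental form. -/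
noncomputable def normSqSecondFF (F ν : M → EuclideanSpace ℝ (Fin (n + 1))) (p : M) : ℝ :=
  ∑ i, ∑ j, ∑ k, ∑ l, metricInvAt F p i k * metricInvAt F p j l *
    secondFFAt F ν p i j * secondFFAt F ν p k l

/-- The Laplace-Beltrami operator `Δ φ = gⁱʲ ∇ᵢ ∇ⱼ φ` of the metric induced by `F`. -/
noncomputable def laplaceBeltrami (F : M → EuclideanSpace ℝ (Fin (n + 1))) (φ : M → ℝ)
    (p : M) : ℝ :=
  ∑ i, ∑ j, metricInvAt F p i j * covHessAt F φ p i j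

/-- The first covariant derivative `∇φ` at `p`, as a linear map on the ambient space: it is
`dφ` after the orthogonal projection to the tangent space `dF (T_p M)`,
i.e. `a ↦ gⁱʲ ⟨∂ᵢ F, a⟩ ∂ⱼ φ`. -/
noncomputable def covDeriv (F : M → EuclideanSpace ℝ (Fin (n + 1))) (φ : M → V) (p : M) :
    EuclideanSpace ℝ (Fin (n + 1)) →L[ℝ] V :=
  ∑ i, ∑ j, metricInvAt F p i j •
    (innerSL ℝ (partialAt F p i)).smulRight (partialAt φ p j)

/-- The second covariant derivative `∇²φ` at `p`, as a bilinear map on the ambient space (after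
orthogonal projection of both arguments to the tangent space):
`(a, b) ↦ gⁱᵏ gʲˡ ⟨∂ₖ F, a⟩ ⟨∂ₗ F, b⟩ ∇ᵢ ∇ⱼ φ`. -/
noncomputable def covDeriv2 (F : M → EuclideanSpace ℝ (Fin (n + 1))) (φ : M → V) (p : M) :
    EuclideanSpace ℝ (Fin (n + 1)) →L[ℝ] EuclideanSpace ℝ (Fin (n + 1)) →L[ℝ] V :=
  ∑ i, ∑ j, ∑ k, ∑ l, (metricInvAt F p i k * metricInvAt F p j l) •
    (innerSL ℝ (partialAt F p k)).smulRight
      ((innerSL ℝ (partialAt F p l)).smulRight (covHessAt F φ p i j))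

/-- `F` is an immersion and `ν` is a unit normal field along it. -/
structure IsUnitNormal (F ν : M → EuclideanSpace ℝ (Fin (n + 1))) : Prop where
  immersion : ∀ p, Injective (mfderiv (𝓡 n) 𝓘(ℝ, EuclideanSpace ℝ (Fin (n + 1))) F p)
  unit : ∀ p, ‖ν p‖ = 1
  normal : ∀ (p : M) (v : TangentSpace (𝓡 n) p),
    inner ℝ (ν p) (mfderiv (𝓡 n) 𝓘(ℝ, EuclideanSpace ℝ (Fin (n + 1))) F p v :
      EuclideanSpace ℝ (Fin (n + 1))) = 0

/-! ## The rescaled mean curvature flow -/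

/-- The rescaled mean curvature flow `∂ₜ x = -H ν + x` on the time set `I`. -/
def IsRescaledMCF (I : Set ℝ) (x ν : ℝ → M → EuclideanSpace ℝ (Fin (n + 1))) : Prop :=
  ∀ t ∈ I, ∀ p : M,
    HasDerivAt (fun τ => x τ p) (-(meanCurvature (x t) (ν t) p • ν t p) + x t p) t

/-- The normal part `⟨∂ₜ x, ν⟩ = -H + ⟨x, ν⟩` of the rescaled mean curvature flow. -/
def IsNormalRescaledMCF (I : Set ℝ) (x ν : ℝ → M → EuclideanSpace ℝ (Fin (n + 1))) : Prop :=
  ∀ t ∈ I, ∀ p : M,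
    inner ℝ (deriv (fun τ => x τ p) t) (ν t p) =
      -meanCurvature (x t) (ν t) p + inner ℝ (x t p) (ν t p)

/-- A smooth variation `x s t p`, `s ∈ J`, `t ∈ I`, of a solution `x 0` of the rescaled mean
curvature flow, with unit normals `ν s t p`: all `x s` move with the normal velocity of the
rescaled flow. This holds in particular if all `x s` solve the rescaled flow. -/
structure IsRescaledMCFVariation (J I : Set ℝ)
    (x ν : ℝ → ℝ → M → EuclideanSpace ℝ (Fin (n + 1))) : Prop where
  smooth : ContMDiffOn (𝓘(ℝ, ℝ).prod (𝓘(ℝ, ℝ).prod (𝓡 n)))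
    𝓘(ℝ, EuclideanSpace ℝ (Fin (n + 1))) ∞
    (fun q : ℝ × ℝ × M => x q.1 q.2.1 q.2.2) (J ×ˢ I ×ˢ (univ : Set M))
  smooth_normal : ContMDiffOn (𝓘(ℝ, ℝ).prod (𝓘(ℝ, ℝ).prod (𝓡 n)))
    𝓘(ℝ, EuclideanSpace ℝ (Fin (n + 1))) ∞
    (fun q : ℝ × ℝ × M => ν q.1 q.2.1 q.2.2) (J ×ˢ I ×ˢ (univ : Set M))
  isUnitNormal : ∀ s ∈ J, ∀ t ∈ I, IsUnitNormal (x s t) (ν s t)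
  flow : IsRescaledMCF I (x 0) (ν 0)
  normal_flow : ∀ s ∈ J, IsNormalRescaledMCF I (x s) (ν s)

/-- The normal component `w = ⟨u, ν⟩` of the variation field `u = d/ds x|_{s = 0}`. -/
noncomputable def normalVariation (x ν : ℝ → ℝ → M → EuclideanSpace ℝ (Fin (n + 1)))
    (t : ℝ) (p : M) : ℝ :=
  inner ℝ (deriv (fun s => x s t p) 0) (ν 0 t p)

/-- A smooth family of immersed hypersurfaces with unit normals over the time set `I`. -/
structure IsSmoothHypersurfaceFamily (I : Set ℝ)
    (x ν : ℝ → M → EuclideanSpace ℝ (Fin (n + 1))) : Prop where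
  smooth : ContMDiffOn (𝓘(ℝ, ℝ).prod (𝓡 n)) 𝓘(ℝ, EuclideanSpace ℝ (Fin (n + 1))) ∞
    (fun q : ℝ × M => x q.1 q.2) (I ×ˢ (univ : Set M))
  smooth_normal : ContMDiffOn (𝓘(ℝ, ℝ).prod (𝓡 n)) 𝓘(ℝ, EuclideanSpace ℝ (Fin (n + 1))) ∞
    (fun q : ℝ × M => ν q.1 q.2) (I ×ˢ (univ : Set M))
  isUnitNormal : ∀ t ∈ I, IsUnitNormal (x t) (ν t)

end Geometry

/-! ## The sphere of radius `√n` -/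

/-- The unit sphere in `ℝⁿ⁺¹`, used to parametrize the sphere of radius `√n`. -/
abbrev USphere (n : ℕ) : Type :=
  Metric.sphere (0 : EuclideanSpace ℝ (Fin (n + 1))) 1

/-- The embedding of the sphere of radius `√n` centred at the origin. All covariant derivatives and
the Laplacian on that sphere are those of the metric induced by this embedding. -/
noncomputable def sphereEmb (n : ℕ) (p : USphere n) : EuclideanSpace ℝ (Fin (n + 1)) :=
  Real.sqrt n • (p : EuclideanSpace ℝ (Fin (n + 1)))

/-- Values of a function with values in `V` and of its first and second covariant derivatives. -/
abbrev Jet2 (n : ℕ) (V : Type*) [NormedAddCommGroup V] [NormedSpace ℝ V] : Type _ :=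
  V × (EuclideanSpace ℝ (Fin (n + 1)) →L[ℝ] V) ×
    (EuclideanSpace ℝ (Fin (n + 1)) →L[ℝ] EuclideanSpace ℝ (Fin (n + 1)) →L[ℝ] V)

/-- Values of `(u, ∇u, ∇²u)` and `(w, ∇w, ∇²w)` for `u` vector valued and `w` scalar. -/
abbrev PairJet (n : ℕ) : Type :=
  Jet2 n (EuclideanSpace ℝ (Fin (n + 1))) × Jet2 n ℝ

/-- `(φ, ∇φ, ∇²φ)` at a point of the sphere of radius `√n`. -/
noncomputable def sphereJet {n : ℕ} {V : Type*} [NormedAddCommGroup V] [NormedSpace ℝ V]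
    (φ : USphere n → V) (p : USphere n) : Jet2 n V :=
  (φ p, covDeriv (sphereEmb n) φ p, covDeriv2 (sphereEmb n) φ p)

/-- The displacement `u = x - x_{Sⁿ}`. -/
noncomputable def sphereDisplacement {n : ℕ}
    (x : ℝ → USphere n → EuclideanSpace ℝ (Fin (n + 1))) (t : ℝ) (p : USphere n) :
    EuclideanSpace ℝ (Fin (n + 1)) :=
  x t p - sphereEmb n p

/-- The normal component `w = ⟨x - x_{Sⁿ}, ν⟩` of the displacement. -/
noncomputable def normalDisplacement {n : ℕ}
    (x ν : ℝ → USphere n → EuclideanSpace ℝ (Fin (n + 1))) (t : ℝ) (p : USphere n) : ℝ :=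
  inner ℝ (sphereDisplacement x t p) (ν t p)

/-- The values at `(t, p)` of `u`, `w` and of their first and second covariant derivatives. -/
noncomputable def displacementJet {n : ℕ}
    (x ν : ℝ → USphere n → EuclideanSpace ℝ (Fin (n + 1))) (t : ℝ) (p : USphere n) : PairJet n :=
  (sphereJet (sphereDisplacement x t) p, sphereJet (normalDisplacement x ν t) p)

/-- `Q` is a quadratic term: a smooth function of the point of the sphere and of small values of
`(u, ∇u, ∇²u, w, ∇w, ∇²w)`, bounded by a constant times the square of the size of the latter. -/
def IsQuadraticTerm {n : ℕ} (ε : ℝ) (Q : USphere n × PairJet n → ℝ) : Prop :=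
  ContMDiffOn ((𝓡 n).prod 𝓘(ℝ, PairJet n)) 𝓘(ℝ, ℝ) ∞ Q
      ((univ : Set (USphere n)) ×ˢ Metric.ball (0 : PairJet n) ε) ∧
    ∃ C : ℝ, ∀ (p : USphere n) (j : PairJet n), ‖j‖ < ε → |Q (p, j)| ≤ C * ‖j‖ ^ 2

/-- The equation `∂ₜ w = Δ_{Sⁿ} w + 2 w + Q` for `w = ⟨x - x_{Sⁿ}, ν⟩`, wherever `x` is close to
the sphere and the normal `ν` is the outer one. -/
def SatisfiesSphereEquation {n : ℕ} (ε : ℝ) (Q : USphere n × PairJet n → ℝ) (I : Set ℝ)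
    (x ν : ℝ → USphere n → EuclideanSpace ℝ (Fin (n + 1))) : Prop :=
  ∀ t ∈ I, ∀ p : USphere n, ‖displacementJet x ν t p‖ < ε →
    0 < inner ℝ (ν t p) (p : EuclideanSpace ℝ (Fin (n + 1))) →
    HasDerivAt (fun τ => normalDisplacement x ν τ p)
      (laplaceBeltrami (sphereEmb n) (normalDisplacement x ν t) p
        + 2 * normalDisplacement x ν t p + Q (p, displacementJet x ν t p)) t

/-- `x` parametrizes radial graphs over the sphere: `x t p` is a positive multiple of `p`. -/
def IsRadialGraph {n : ℕ} (I : Set ℝ)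
    (x : ℝ → USphere n → EuclideanSpace ℝ (Fin (n + 1))) : Prop :=
  ∀ t ∈ I, ∀ p : USphere n, ∃ c : ℝ, 0 < c ∧ x t p = c • (p : EuclideanSpace ℝ (Fin (n + 1)))

/-!
The whole argument takes place at one point of one chart. There a family of hypersurfaces is a map
`x` of parameters and coordinates together with a unit normal `ν` (`HypersurfaceFrame`); derivatives
in the coordinate directions give the geometry of the slices, and derivatives in the remaining
directions give variations. The Christoffel symbols of the induced metric are
`Γᵏᵢⱼ = ⟨gᵏˡ ∂ₗx, ∂ᵢ∂ⱼx⟩`, so everything is expressed by inner products with the frame `∂ᵢx`, `ν`.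

*The linearized equation.* The first variation of the mean curvature in an arbitrary direction `d`,
tangential part included, is `D_d H = -⟨ν, Δ D_d x⟩ - 2 gⁱʲ ⟨∂ᵢ D_d x, ∂ⱼν⟩`
(`HypersurfaceFrame.dirDeriv_meanCurvature`). For `d = ∂ₖ`, and with `Δ⟨∂ₖx, ν⟩ = 0`, it says that
the tangential part of `Δν` is `∇H`, so that `Δν = ∇H - |A|² ν`. Differentiating the normal part of
the flow along the surface gives `∂ₜν`, namely
`⟨a, ∂ₜν⟩ = ⟨a, Δν⟩ + |A|² ⟨a, ν⟩ + gⁱʲ ⟨a, ∂ᵢx⟩ ⟨∂ₜx - x, ∂ⱼν⟩`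
(`HypersurfaceFrame.inner_dirDeriv_normal_of_normal_flow`). Along a solution of the full flow
`∂ₜx - x` is normal and the last term vanishes. Differentiating the normal part of the flow in the
variation parameter `s` and adding `⟨u, ∂ₜν⟩` produces `Δ⟨u, ν⟩ + |A|² ⟨u, ν⟩ + ⟨u, ν⟩`
(`HypersurfaceFrame.dirDeriv_normal_variation`). The mean curvature in the flow equation at nearby
points refers to other preferred charts, so that its invariance under changes of coordinates is
needed (`sum_metricInv_mul_secondFF_comp`).

*The sphere.* Its position vector is `√n` times its normal, whence `H = √n` and `|A|² = 1`.

*The nonlinear equation.* With `y = x_{Sⁿ}`, `u = x - y` and `w = ⟨u, ν⟩` the same identities give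
`∂ₜw = Δw + |A|² w + w + ⟨y + Δy, ν⟩ - 2 gⁱʲ ⟨∂ᵢu, ∂ⱼν⟩ + gⁱʲ ⟨u, ∂ᵢx⟩ ⟨∂ₜx - x, ∂ⱼν⟩`
(`HypersurfaceFrame.dirDeriv_normal_displacement`), with the Laplacian of the moving metric. The
last term is absent for solutions of the flow; for radial graphs `∂ₜx - x` is a multiple of `p`,
which the normal part of the flow determines. Every term is a function of `p` and of the jet of
`(u, w)`: the differential of `x` is `1 + ∇u`, its second covariant derivative on the sphere is
`∇²u - n^{-1/2} ⟨·,·⟩ p`, and the metric, its inverse and the normal follow by linear algebra in the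
ambient space (`jetMetric`, `jetNormal`, `jetHess`). Subtracting `Δ_{Sⁿ} w + 2 w` leaves `flowTerm`
and `radialTerm` (`IsDisplacementJet.dirDeriv_normalDisplacement_of_flow` and its radial
counterpart).

*The quadratic bound.* A smooth function of `(p, j)` is `f(p, 0) + O(|j|)`, uniformly on the compact
sphere. The terms containing `w`, `∇w`, `∇²w` or `u` are such a function, vanishing at `j = 0`,
times a component of `j`. The remaining terms are `⟨y + Δy, ν⟩` and `-2 gⁱʲ ⟨∂ᵢu, ∂ⱼν⟩`. They
contain `u` linearly, and their first order parts, both multiples of the divergence of `u`, cancel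
(`isBigO_jetBase_add_jetCross`).
-/


/-! ### Directional derivatives -/

section DirectionalDerivatives

variable {Z V W : Type*} [NormedAddCommGroup Z] [NormedSpace ℝ Z]
  [NormedAddCommGroup V] [NormedSpace ℝ V] [NormedAddCommGroup W] [InnerProductSpace ℝ W]

/-- The derivative `D_v f` in the fixed direction `v`, as a function of the base point. -/
noncomputable def dirDeriv (v : Z) (f : Z → V) : Z → V := fun z => fderiv ℝ f z v

variable {U : Set Z} {z : Z}

lemma ContDiffOn.differentiableAt_of_isOpen {f : Z → V} (hf : ContDiffOn ℝ ∞ f U)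
    (hU : IsOpen U) (hz : z ∈ U) : DifferentiableAt ℝ f z :=
  (hf.contDiffAt (hU.mem_nhds hz)).differentiableAt (by simp)

lemma ContDiffOn.dirDeriv {f : Z → V} (hf : ContDiffOn ℝ ∞ f U) (hU : IsOpen U) (v : Z) :
    ContDiffOn ℝ ∞ (dirDeriv v f) U :=
  (hf.fderiv_of_isOpen hU (m := ∞) (by simp)).clm_apply contDiffOn_const

lemma dirDeriv_comm {f : Z → V} (hf : ContDiffOn ℝ ∞ f U) (hU : IsOpen U) (hz : z ∈ U)
    (v w : Z) : dirDeriv v (dirDeriv w f) z = dirDeriv w (dirDeriv v f) z := by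
  have hs : IsSymmSndFDerivAt ℝ f z :=
    (hf.contDiffAt (hU.mem_nhds hz)).isSymmSndFDerivAt (by simpa using ENat.LEInfty.out)
  have hd : DifferentiableAt ℝ (fderiv ℝ f) z :=
    (hf.fderiv_of_isOpen hU (m := ∞) (by simp)).differentiableAt_of_isOpen hU hz
  have key : ∀ a b : Z, _root_.dirDeriv a (_root_.dirDeriv b f) z =
      fderiv ℝ (fderiv ℝ f) z a b := by
    intro a b
    change fderiv ℝ (fun y => fderiv ℝ f y b) z a = _
    rw [fderiv_clm_apply hd (differentiableAt_const b)]
    simp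
  rw [key, key]
  exact hs.eq v w

lemma dirDeriv_congr {f g : Z → V} (hU : IsOpen U) (hz : z ∈ U) (h : EqOn f g U) (v : Z) :
    dirDeriv v f z = dirDeriv v g z := by
  have : f =ᶠ[nhds z] g := Filter.eventuallyEq_of_mem (hU.mem_nhds hz) h
  simp only [dirDeriv, this.fderiv_eq]

lemma dirDeriv_inner {f g : Z → W} (hf : DifferentiableAt ℝ f z) (hg : DifferentiableAt ℝ g z)
    (v : Z) : dirDeriv v (fun y => inner ℝ (f y) (g y)) z =
      inner ℝ (dirDeriv v f z) (g z) + inner ℝ (f z) (dirDeriv v g z) := by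
  simp only [dirDeriv]
  rw [fderiv_inner_apply ℝ hf hg]
  ring

lemma dirDeriv_mul {f g : Z → ℝ} (hf : DifferentiableAt ℝ f z) (hg : DifferentiableAt ℝ g z)
    (v : Z) : dirDeriv v (fun y => f y * g y) z =
      dirDeriv v f z * g z + f z * dirDeriv v g z := by
  simp only [dirDeriv]
  rw [fderiv_fun_mul hf hg]
  simp; ring

lemma dirDeriv_add {f g : Z → V} (hf : DifferentiableAt ℝ f z) (hg : DifferentiableAt ℝ g z)
    (v : Z) : dirDeriv v (fun y => f y + g y) z = dirDeriv v f z + dirDeriv v g z := by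
  simp only [dirDeriv]
  rw [fderiv_fun_add hf hg]
  simp

lemma dirDeriv_sub {f g : Z → V} (hf : DifferentiableAt ℝ f z) (hg : DifferentiableAt ℝ g z)
    (v : Z) : dirDeriv v (fun y => f y - g y) z = dirDeriv v f z - dirDeriv v g z := by
  simp only [dirDeriv]
  rw [fderiv_fun_sub hf hg]
  simp

lemma dirDeriv_neg {f : Z → V} (v : Z) :
    dirDeriv v (fun y => - f y) z = - dirDeriv v f z := by
  simp only [dirDeriv]
  rw [fderiv_fun_neg]
  simp

lemma dirDeriv_const (c : V) (v : Z) : dirDeriv v (fun _ => c) z = 0 := by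
  simp [dirDeriv]

lemma dirDeriv_sum {ι : Type*} {s : Finset ι} {f : ι → Z → V}
    (hf : ∀ i ∈ s, DifferentiableAt ℝ (f i) z) (v : Z) :
    dirDeriv v (fun y => ∑ i ∈ s, f i y) z = ∑ i ∈ s, dirDeriv v (f i) z := by
  simp only [dirDeriv]
  rw [fderiv_fun_sum hf]
  simp

end DirectionalDerivatives

/-! ### Dual frames of a tangent space -/

section DualFrame

variable {n : ℕ} {W : Type*} [NormedAddCommGroup W] [InnerProductSpace ℝ W]

/-- The dual frame `Xⁱ = gⁱʲ Xⱼ` of a frame `X` of a subspace, where `g` is the Gram matrix. -/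
noncomputable def dualFrame (X : Fin n → W) (i : Fin n) : W :=
  ∑ j, (Matrix.gram ℝ X)⁻¹ i j • X j

variable {X : Fin n → W}

lemma isUnit_det_gram (hX : LinearIndependent ℝ X) : IsUnit (Matrix.gram ℝ X).det :=
  isUnit_iff_ne_zero.2 (Matrix.det_gram_ne_zero_iff_linearIndependent.2 hX)

lemma gram_inv_symm (X : Fin n → W) (i j : Fin n) :
    (Matrix.gram ℝ X)⁻¹ i j = (Matrix.gram ℝ X)⁻¹ j i := by
  have h : ((Matrix.gram ℝ X)⁻¹).transpose = (Matrix.gram ℝ X)⁻¹ := by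
    rw [Matrix.transpose_nonsing_inv]
    congr 1
    ext i j
    simp [Matrix.gram_apply, real_inner_comm]
  conv_lhs => rw [← h]
  rfl

lemma inner_dualFrame_left (X : Fin n → W) (a : W) (i : Fin n) :
    inner ℝ a (dualFrame X i) = ∑ j, (Matrix.gram ℝ X)⁻¹ i j * inner ℝ a (X j) := by
  simp [dualFrame, inner_sum, inner_smul_right]

lemma inner_dualFrame (hX : LinearIndependent ℝ X) (i k : Fin n) :
    inner ℝ (X k) (dualFrame X i) = if i = k then 1 else 0 := by
  have h := Matrix.nonsing_inv_mul _ (isUnit_det_gram hX)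
  have := congrFun (congrFun h i) k
  rw [Matrix.mul_apply, Matrix.one_apply] at this
  rw [inner_dualFrame_left, ← this]
  refine Finset.sum_congr rfl fun j _ => ?_
  rw [Matrix.gram_apply, real_inner_comm]

lemma eq_zero_of_orthogonal_frame {X : Fin n → EuclideanSpace ℝ (Fin (n + 1))}
    (hX : LinearIndependent ℝ X) {N : EuclideanSpace ℝ (Fin (n + 1))}
    (hN : inner ℝ N N = (1 : ℝ)) (hNX : ∀ i, inner ℝ N (X i) = (0 : ℝ))
    {r : EuclideanSpace ℝ (Fin (n + 1))} (h0 : inner ℝ r N = (0 : ℝ))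
    (h : ∀ i, inner ℝ r (X i) = (0 : ℝ)) : r = 0 := by
  have hspan : ∀ {a : EuclideanSpace ℝ (Fin (n + 1))}, (∀ i, inner ℝ a (X i) = (0 : ℝ)) →
      ∀ b ∈ Submodule.span ℝ (range X), inner ℝ a b = (0 : ℝ) := by
    intro a ha b hb
    induction hb using Submodule.span_induction with
    | mem b hb => obtain ⟨i, rfl⟩ := hb; exact ha i
    | zero => simp
    | add b c _ _ hb hc => simp [inner_add_right, hb, hc]
    | smul c b _ hb => simp [inner_smul_right, hb]
  have hli : LinearIndependent ℝ (Fin.cons N X : Fin (n + 1) → _) := by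
    rw [linearIndependent_finCons]
    refine ⟨hX, fun hmem => ?_⟩
    have := hspan hNX N hmem
    rw [hN] at this
    exact one_ne_zero this
  have htop := hli.span_eq_top_of_card_eq_finrank' (by simp)
  have hall : ∀ b ∈ Submodule.span ℝ (range (Fin.cons N X : Fin (n + 1) → _)),
      inner ℝ r b = (0 : ℝ) := by
    intro b hb
    induction hb using Submodule.span_induction with
    | mem b hb =>
      obtain ⟨i, rfl⟩ := hb
      refine Fin.cases ?_ (fun i => ?_) i
      · simpa using h0
      · simpa using h i
    | zero => simp
    | add b c _ _ hb hc => simp [inner_add_right, hb, hc]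
    | smul c b _ hb => simp [inner_smul_right, hb]
  rw [htop] at hall
  exact inner_self_eq_zero.1 (hall r trivial)

/-- The Gauss splitting of a vector into its normal and tangential parts. -/
lemma eq_normal_add_tangent {X : Fin n → EuclideanSpace ℝ (Fin (n + 1))}
    (hX : LinearIndependent ℝ X) {N : EuclideanSpace ℝ (Fin (n + 1))}
    (hN : inner ℝ N N = (1 : ℝ)) (hNX : ∀ i, inner ℝ N (X i) = (0 : ℝ))
    (a : EuclideanSpace ℝ (Fin (n + 1))) :
    a = (inner ℝ a N : ℝ) • N + ∑ i, (inner ℝ a (dualFrame X i) : ℝ) • X i := by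
  have hXN : ∀ i, inner ℝ (X i) N = (0 : ℝ) := fun i => by rw [real_inner_comm, hNX]
  rw [← sub_eq_zero]
  have hD : ∀ i, inner ℝ N (dualFrame X i) = (0 : ℝ) := by
    intro i; simp [inner_dualFrame_left, hNX]
  have key : ∀ k, inner ℝ (a - ((inner ℝ a N : ℝ) • N +
      ∑ i, (inner ℝ a (dualFrame X i) : ℝ) • X i)) (dualFrame X k) = (0 : ℝ) := by
    intro k
    simp [inner_sub_left, inner_add_left, inner_smul_left, sum_inner, hD, inner_dualFrame hX]
  refine eq_zero_of_orthogonal_frame hX hN hNX ?_ fun i => ?_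
  · rw [inner_sub_left, inner_add_left, inner_smul_left, sum_inner, hN]
    simp [inner_smul_left, hXN]
  · -- `Xᵢ = gᵢₖ Xᵏ`, so that orthogonality to the dual frame suffices
    have h2 : X i = ∑ k, Matrix.gram ℝ X i k • dualFrame X k := by
      simp only [dualFrame, Finset.smul_sum, smul_smul]
      rw [Finset.sum_comm]
      simp only [← Finset.sum_smul, ← Matrix.mul_apply,
        Matrix.mul_nonsing_inv _ (isUnit_det_gram hX), Matrix.one_apply]
      simp
    rw [h2, inner_sum]
    simp only [inner_smul_right, key, mul_zero, Finset.sum_const_zero]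

lemma inner_eq_normal_add_tangent {X : Fin n → EuclideanSpace ℝ (Fin (n + 1))}
    (hX : LinearIndependent ℝ X) {N : EuclideanSpace ℝ (Fin (n + 1))}
    (hN : inner ℝ N N = (1 : ℝ)) (hNX : ∀ i, inner ℝ N (X i) = (0 : ℝ))
    (a b : EuclideanSpace ℝ (Fin (n + 1))) :
    (inner ℝ a b : ℝ) = inner ℝ a N * inner ℝ b N +
      ∑ i, inner ℝ a (dualFrame X i) * inner ℝ b (X i) := by
  conv_lhs => rw [eq_normal_add_tangent hX hN hNX a]
  simp [inner_add_left, inner_smul_left, sum_inner, real_inner_comm]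

end DualFrame

/-! ### Hypersurfaces depending on parameters -/

section HypersurfaceFrame

variable {n : ℕ} {Z V : Type*} [NormedAddCommGroup Z] [NormedSpace ℝ Z]
  [NormedAddCommGroup V] [NormedSpace ℝ V]

/-- A hypersurface of `ℝⁿ⁺¹` in coordinates, possibly depending on parameters such as time: `z ∈ U`
comprises parameters and coordinates, `e i` is the direction of the `i`-th coordinate in `Z`, `x` is
the position and `ν` a unit normal. -/
structure HypersurfaceFrame (U : Set Z) (e : Fin n → Z)
    (x ν : Z → EuclideanSpace ℝ (Fin (n + 1))) : Prop where
  isOpen : IsOpen U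
  smooth : ContDiffOn ℝ ∞ x U
  smooth_normal : ContDiffOn ℝ ∞ ν U
  unit : ∀ z ∈ U, inner ℝ (ν z) (ν z) = (1 : ℝ)
  normal : ∀ z ∈ U, ∀ i, inner ℝ (ν z) (dirDeriv (e i) x z) = (0 : ℝ)
  linearIndependent : ∀ z ∈ U, LinearIndependent ℝ fun i => dirDeriv (e i) x z

/-- The inverse `gⁱʲ` of the metric induced on the coordinate slices. -/
noncomputable def frameMetricInv (e : Fin n → Z) (x : Z → EuclideanSpace ℝ (Fin (n + 1))) (z : Z) :
    Matrix (Fin n) (Fin n) ℝ :=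
  (Matrix.gram ℝ fun i => dirDeriv (e i) x z)⁻¹

/-- The dual tangent frame `gⁱʲ ∂ⱼ x`. -/
noncomputable def frameDual (e : Fin n → Z) (x : Z → EuclideanSpace ℝ (Fin (n + 1))) (z : Z)
    (i : Fin n) : EuclideanSpace ℝ (Fin (n + 1)) :=
  dualFrame (fun i => dirDeriv (e i) x z) i

/-- The second covariant derivative `∇ᵢ ∇ⱼ φ` on the coordinate slices; the Christoffel symbols
of the induced metric are `⟨gᵏˡ ∂ₗ x, ∂ᵢ ∂ⱼ x⟩`. -/
noncomputable def frameCovHess (e : Fin n → Z) (x : Z → EuclideanSpace ℝ (Fin (n + 1)))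
    (φ : Z → V) (z : Z) (i j : Fin n) : V :=
  dirDeriv (e i) (dirDeriv (e j) φ) z -
    ∑ k, (inner ℝ (frameDual e x z k) (dirDeriv (e i) (dirDeriv (e j) x) z) : ℝ) •
      dirDeriv (e k) φ z

/-- The Laplacian `gⁱʲ ∇ᵢ ∇ⱼ φ` on the coordinate slices. -/
noncomputable def frameLaplacian (e : Fin n → Z) (x : Z → EuclideanSpace ℝ (Fin (n + 1)))
    (φ : Z → V) (z : Z) : V :=
  ∑ i, ∑ j, frameMetricInv e x z i j • frameCovHess e x φ z i j

/-- The second fundamental form `hᵢⱼ = -⟨ν, ∂ᵢ ∂ⱼ x⟩` of the coordinate slices. -/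
noncomputable def frameSecondFF (e : Fin n → Z) (x ν : Z → EuclideanSpace ℝ (Fin (n + 1))) (z : Z)
    (i j : Fin n) : ℝ :=
  - inner ℝ (ν z) (dirDeriv (e i) (dirDeriv (e j) x) z)

/-- The mean curvature `gⁱʲ hᵢⱼ` of the coordinate slices. -/
noncomputable def frameMeanCurvature (e : Fin n → Z)
    (x ν : Z → EuclideanSpace ℝ (Fin (n + 1))) (z : Z) : ℝ :=
  ∑ i, ∑ j, frameMetricInv e x z i j * frameSecondFF e x ν z i j

/-- The squared norm `gⁱᵏ gʲˡ hᵢⱼ hₖₗ` of the second fundamental form of the coordinate slices. -/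
noncomputable def frameNormSq (e : Fin n → Z)
    (x ν : Z → EuclideanSpace ℝ (Fin (n + 1))) (z : Z) : ℝ :=
  ∑ i, ∑ j, ∑ k, ∑ l, frameMetricInv e x z i k * frameMetricInv e x z j l *
    frameSecondFF e x ν z i j * frameSecondFF e x ν z k l

lemma frameMetricInv_symm (e : Fin n → Z) (x : Z → EuclideanSpace ℝ (Fin (n + 1))) (z : Z)
    (i j : Fin n) : frameMetricInv e x z i j = frameMetricInv e x z j i :=
  gram_inv_symm _ i j

lemma inner_frameDual (e : Fin n → Z) (x : Z → EuclideanSpace ℝ (Fin (n + 1))) (z : Z)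
    (a : EuclideanSpace ℝ (Fin (n + 1))) (i : Fin n) :
    inner ℝ a (frameDual e x z i) =
      ∑ j, frameMetricInv e x z i j * inner ℝ a (dirDeriv (e j) x z) :=
  inner_dualFrame_left _ a i

namespace HypersurfaceFrame

variable {U : Set Z} {e : Fin n → Z} {x ν : Z → EuclideanSpace ℝ (Fin (n + 1))} {z : Z}

lemma inner_eq (h : HypersurfaceFrame U e x ν) (hz : z ∈ U)
    (a b : EuclideanSpace ℝ (Fin (n + 1))) :
    (inner ℝ a b : ℝ) = inner ℝ a (ν z) * inner ℝ b (ν z) +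
      ∑ i, inner ℝ a (frameDual e x z i) * inner ℝ b (dirDeriv (e i) x z) :=
  inner_eq_normal_add_tangent (h.linearIndependent z hz) (h.unit z hz) (h.normal z hz) a b

lemma contDiffOn_metricInv (h : HypersurfaceFrame U e x ν) (i j : Fin n) :
    ContDiffOn ℝ ∞ (fun z => frameMetricInv e x z i j) U := by
  have hg : ∀ a b, ContDiffOn ℝ ∞ (fun z => Matrix.gram ℝ (fun i => dirDeriv (e i) x z) a b) U :=
    fun a b => (h.smooth.dirDeriv h.isOpen _).inner ℝ (h.smooth.dirDeriv h.isOpen _)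
  have hdet : ∀ A : Z → Matrix (Fin n) (Fin n) ℝ,
      (∀ a b, ContDiffOn ℝ ∞ (fun z => A z a b) U) → ContDiffOn ℝ ∞ (fun z => (A z).det) U := by
    intro A hA
    simp only [Matrix.det_apply']
    exact ContDiffOn.sum fun σ _ => contDiffOn_const.mul (contDiffOn_prod fun a _ => hA _ _)
  simp only [frameMetricInv, Matrix.inv_def, Matrix.smul_apply, smul_eq_mul, Ring.inverse_eq_inv']
  refine ContDiffOn.mul ((hdet _ hg).inv fun z hz =>
    (isUnit_det_gram (h.linearIndependent z hz)).ne_zero) ?_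
  simp only [Matrix.adjugate_apply]
  refine hdet _ fun a b => ?_
  by_cases hab : a = j
  · subst hab; simpa [Matrix.updateRow_apply] using contDiffOn_const
  · simpa [Matrix.updateRow_apply, hab] using hg a b

lemma contDiffOn_secondFF (h : HypersurfaceFrame U e x ν) (i j : Fin n) :
    ContDiffOn ℝ ∞ (fun z => frameSecondFF e x ν z i j) U :=
  (h.smooth_normal.inner ℝ ((h.smooth.dirDeriv h.isOpen _).dirDeriv h.isOpen _)).neg

lemma contDiffOn_meanCurvature (h : HypersurfaceFrame U e x ν) :
    ContDiffOn ℝ ∞ (frameMeanCurvature e x ν) U :=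
  ContDiffOn.sum fun i _ => ContDiffOn.sum fun j _ =>
    (h.contDiffOn_metricInv i j).mul (h.contDiffOn_secondFF i j)

lemma dirDeriv_metricInv (h : HypersurfaceFrame U e x ν) (hz : z ∈ U) (d : Z) (i j : Fin n) :
    dirDeriv d (fun z => frameMetricInv e x z i j) z =
      - (∑ a, frameMetricInv e x z i a *
          inner ℝ (dirDeriv (e a) (dirDeriv d x) z) (frameDual e x z j) +
        ∑ a, frameMetricInv e x z j a *
          inner ℝ (dirDeriv (e a) (dirDeriv d x) z) (frameDual e x z i)) := by
  set G : Z → Matrix (Fin n) (Fin n) ℝ := fun z => Matrix.gram ℝ fun i => dirDeriv (e i) x z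
  have hd : ∀ a, DifferentiableAt ℝ (dirDeriv (e a) x) z := fun a =>
    (h.smooth.dirDeriv h.isOpen _).differentiableAt_of_isOpen h.isOpen hz
  have hG : ∀ a b, DifferentiableAt ℝ (fun z => G z a b) z := fun a b => (hd a).inner ℝ (hd b)
  have hGi : ∀ a b, DifferentiableAt ℝ (fun z => frameMetricInv e x z a b) z := fun a b =>
    (h.contDiffOn_metricInv a b).differentiableAt_of_isOpen h.isOpen hz
  have hDG : ∀ a b, dirDeriv d (fun z => G z a b) z =
      inner ℝ (dirDeriv (e a) (dirDeriv d x) z) (dirDeriv (e b) x z) +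
      inner ℝ (dirDeriv (e a) x z) (dirDeriv (e b) (dirDeriv d x) z) := by
    intro a b
    rw [dirDeriv_comm h.smooth h.isOpen hz, dirDeriv_comm h.smooth h.isOpen hz (e b)]
    exact dirDeriv_inner (hd a) (hd b) d
  set DG : Matrix (Fin n) (Fin n) ℝ := Matrix.of fun a b => dirDeriv d (fun z => G z a b) z
  set DI : Matrix (Fin n) (Fin n) ℝ :=
    Matrix.of fun a b => dirDeriv d (fun z => frameMetricInv e x z a b) z
  have h1 : DI * G z + frameMetricInv e x z * DG = 0 := by
    ext a b
    have hc : EqOn (fun z => ∑ c, frameMetricInv e x z a c * G z c b)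
        (fun _ => (1 : Matrix (Fin n) (Fin n) ℝ) a b) U := by
      intro z hz
      have := Matrix.nonsing_inv_mul _ (isUnit_det_gram (h.linearIndependent z hz))
      exact congrFun (congrFun this a) b
    have := dirDeriv_congr h.isOpen hz hc d
    rw [dirDeriv_const, dirDeriv_sum (fun c _ => (hGi a c).fun_mul (hG c b))] at this
    simp only [dirDeriv_mul (hGi a _) (hG _ b), Finset.sum_add_distrib] at this
    exact this
  have h2 : DI = - (frameMetricInv e x z * DG * frameMetricInv e x z) := by
    have hu := Matrix.mul_nonsing_inv _ (isUnit_det_gram (h.linearIndependent z hz))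
    have h3 := congrArg (· * frameMetricInv e x z) h1
    simp only [add_mul, zero_mul] at h3
    rw [Matrix.mul_assoc DI] at h3
    have hu' : G z * frameMetricInv e x z = 1 := hu
    rw [hu', mul_one] at h3
    exact eq_neg_of_add_eq_zero_left h3
  have h4 := congrFun (congrFun h2 i) j
  change dirDeriv d (fun z => frameMetricInv e x z i j) z = _ at h4
  rw [h4, Matrix.neg_apply, Matrix.mul_assoc, Matrix.mul_apply]
  congr 1
  simp only [Matrix.mul_apply, DG, Matrix.of_apply, hDG, add_mul, Finset.sum_add_distrib, mul_add,
    inner_frameDual]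
  congr 1
  · refine Finset.sum_congr rfl fun a _ => ?_
    congr 1
    refine Finset.sum_congr rfl fun b _ => ?_
    rw [frameMetricInv_symm e x z j b]; ring
  · simp only [Finset.mul_sum]
    rw [Finset.sum_comm]
    refine Finset.sum_congr rfl fun a _ => Finset.sum_congr rfl fun b _ => ?_
    rw [frameMetricInv_symm e x z j a, real_inner_comm]; ring

section

variable (h : HypersurfaceFrame U e x ν) (hz : z ∈ U)
include h hz

lemma differentiableAt : DifferentiableAt ℝ x z :=
  h.smooth.differentiableAt_of_isOpen h.isOpen hz

lemma differentiableAt_normal : DifferentiableAt ℝ ν z :=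
  h.smooth_normal.differentiableAt_of_isOpen h.isOpen hz

lemma inner_dirDeriv_normal_self (d : Z) : inner ℝ (dirDeriv d ν z) (ν z) = (0 : ℝ) := by
  have hc : EqOn (fun z => (inner ℝ (ν z) (ν z) : ℝ)) (fun _ => 1) U := fun z hz => h.unit z hz
  have := dirDeriv_congr h.isOpen hz hc d
  rw [dirDeriv_const, dirDeriv_inner (h.differentiableAt_normal hz) (h.differentiableAt_normal hz),
    real_inner_comm (dirDeriv d ν z)] at this
  linarith

/-- The tangential components of the derivative of the normal in an arbitrary direction. -/
lemma inner_dirDeriv_normal_frame (d : Z) (i : Fin n) :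
    inner ℝ (dirDeriv d ν z) (dirDeriv (e i) x z) =
      - (inner ℝ (ν z) (dirDeriv (e i) (dirDeriv d x) z) : ℝ) := by
  have hc : EqOn (fun z => (inner ℝ (ν z) (dirDeriv (e i) x z) : ℝ)) (fun _ => 0) U :=
    fun z hz => h.normal z hz i
  have := dirDeriv_congr h.isOpen hz hc d
  rw [dirDeriv_const, dirDeriv_inner (h.differentiableAt_normal hz)
    ((h.smooth.dirDeriv h.isOpen _).differentiableAt_of_isOpen h.isOpen hz)] at this
  rw [dirDeriv_comm h.smooth h.isOpen hz (e i) d]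
  linarith

lemma secondFF_eq (i j : Fin n) :
    frameSecondFF e x ν z i j = inner ℝ (dirDeriv (e i) ν z) (dirDeriv (e j) x z) := by
  rw [h.inner_dirDeriv_normal_frame hz, frameSecondFF,
    dirDeriv_comm h.smooth h.isOpen hz (e i)]

lemma secondFF_symm (i j : Fin n) :
    frameSecondFF e x ν z i j = frameSecondFF e x ν z j i := by
  rw [frameSecondFF, frameSecondFF, dirDeriv_comm h.smooth h.isOpen hz (e i)]

/-- The first variation of the mean curvature under an arbitrary, not necessarily normal,
variation `∂_d x`. -/
lemma dirDeriv_meanCurvature (d : Z) :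
    dirDeriv d (frameMeanCurvature e x ν) z =
      - inner ℝ (ν z) (frameLaplacian e x (dirDeriv d x) z) -
      2 * ∑ i, ∑ j, frameMetricInv e x z i j *
        inner ℝ (dirDeriv (e i) (dirDeriv d x) z) (dirDeriv (e j) ν z) := by
  have hGi : ∀ a b, DifferentiableAt ℝ (fun z => frameMetricInv e x z a b) z := fun a b =>
    (h.contDiffOn_metricInv a b).differentiableAt_of_isOpen h.isOpen hz
  have hF : ∀ a b, DifferentiableAt ℝ (fun z => frameSecondFF e x ν z a b) z := fun a b =>
    (h.contDiffOn_secondFF a b).differentiableAt_of_isOpen h.isOpen hz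
  have hDF : ∀ i j, dirDeriv d (fun z => frameSecondFF e x ν z i j) z =
      - (inner ℝ (ν z) (frameCovHess e x (dirDeriv d x) z i j) : ℝ) := by
    intro i j
    have hd2 : DifferentiableAt ℝ (dirDeriv (e i) (dirDeriv (e j) x)) z :=
      ((h.smooth.dirDeriv h.isOpen _).dirDeriv h.isOpen _).differentiableAt_of_isOpen h.isOpen hz
    have hcomm : dirDeriv d (dirDeriv (e i) (dirDeriv (e j) x)) z =
        dirDeriv (e i) (dirDeriv (e j) (dirDeriv d x)) z := by
      rw [dirDeriv_comm (h.smooth.dirDeriv h.isOpen _) h.isOpen hz]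
      exact dirDeriv_congr h.isOpen hz
        (fun y hy => dirDeriv_comm h.smooth h.isOpen hy d (e j)) (e i)
    change dirDeriv d (fun z => - inner ℝ (ν z) (dirDeriv (e i) (dirDeriv (e j) x) z)) z = _
    rw [dirDeriv_neg, dirDeriv_inner (h.differentiableAt_normal hz) hd2, hcomm]
    -- the tangential part of `D_d ν` supplies the Christoffel terms
    rw [real_inner_comm, h.inner_eq hz _ (dirDeriv d ν z), h.inner_dirDeriv_normal_self hz,
      frameCovHess, inner_sub_right, inner_sum]
    simp only [h.inner_dirDeriv_normal_frame hz, inner_smul_right]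
    simp only [mul_neg, Finset.sum_neg_distrib, mul_zero, zero_add,
      real_inner_comm (dirDeriv (e i) (dirDeriv (e j) x) z)]
    ring
  have key : ∀ i a, ∑ j, (inner ℝ (dirDeriv (e a) (dirDeriv d x) z) (frameDual e x z j) : ℝ) *
      frameSecondFF e x ν z i j =
        inner ℝ (dirDeriv (e a) (dirDeriv d x) z) (dirDeriv (e i) ν z) := by
    intro i a
    rw [h.inner_eq hz _ (dirDeriv (e i) ν z), h.inner_dirDeriv_normal_self hz]
    simp only [h.secondFF_eq hz, mul_zero, zero_add]
  -- the two terms of the derivative of `gⁱʲ` contribute equally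
  have key1 : ∑ i, ∑ j, (∑ a, frameMetricInv e x z i a *
          inner ℝ (dirDeriv (e a) (dirDeriv d x) z) (frameDual e x z j)) *
        frameSecondFF e x ν z i j = ∑ i, ∑ j, frameMetricInv e x z i j *
        inner ℝ (dirDeriv (e i) (dirDeriv d x) z) (dirDeriv (e j) ν z) := by
    rw [Finset.sum_comm (γ := Fin n) (f := fun i j => frameMetricInv e x z i j *
        inner ℝ (dirDeriv (e i) (dirDeriv d x) z) (dirDeriv (e j) ν z))]
    refine Finset.sum_congr rfl fun i _ => ?_
    simp only [Finset.sum_mul]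
    rw [Finset.sum_comm]
    refine Finset.sum_congr rfl fun a _ => ?_
    simp only [mul_assoc, ← Finset.mul_sum]
    rw [key, frameMetricInv_symm]
  have key2 : ∑ i, ∑ j, (∑ a, frameMetricInv e x z j a *
          inner ℝ (dirDeriv (e a) (dirDeriv d x) z) (frameDual e x z i)) *
        frameSecondFF e x ν z i j = ∑ i, ∑ j, frameMetricInv e x z i j *
        inner ℝ (dirDeriv (e i) (dirDeriv d x) z) (dirDeriv (e j) ν z) := by
    rw [Finset.sum_comm, ← key1]
    refine Finset.sum_congr rfl fun i _ => Finset.sum_congr rfl fun j _ => ?_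
    rw [h.secondFF_symm hz i j]
  change dirDeriv d (fun z => ∑ i, ∑ j, frameMetricInv e x z i j * frameSecondFF e x ν z i j) z = _
  rw [dirDeriv_sum fun i _ => DifferentiableAt.fun_sum fun j _ => (hGi i j).fun_mul (hF i j)]
  simp only [dirDeriv_sum fun j _ => (hGi _ j).fun_mul (hF _ j),
    dirDeriv_mul (hGi _ _) (hF _ _), hDF,
    h.dirDeriv_metricInv hz, frameLaplacian, inner_sum, inner_smul_right, neg_mul, add_mul,
    Finset.sum_add_distrib, Finset.sum_neg_distrib, mul_neg]
  rw [key1, key2]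
  ring

lemma laplacian_inner {f g : Z → EuclideanSpace ℝ (Fin (n + 1))} (hf : ContDiffOn ℝ ∞ f U)
    (hg : ContDiffOn ℝ ∞ g U) :
    frameLaplacian e x (fun z => (inner ℝ (f z) (g z) : ℝ)) z =
      inner ℝ (frameLaplacian e x f z) (g z) +
      2 * ∑ i, ∑ j, frameMetricInv e x z i j *
        inner ℝ (dirDeriv (e i) f z) (dirDeriv (e j) g z) +
      inner ℝ (f z) (frameLaplacian e x g z) := by
  have df : ∀ {y}, y ∈ U → DifferentiableAt ℝ f y :=
    fun hy => hf.differentiableAt_of_isOpen h.isOpen hy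
  have dg : ∀ {y}, y ∈ U → DifferentiableAt ℝ g y :=
    fun hy => hg.differentiableAt_of_isOpen h.isOpen hy
  have df' : ∀ v, DifferentiableAt ℝ (dirDeriv v f) z :=
    fun v => (hf.dirDeriv h.isOpen v).differentiableAt_of_isOpen h.isOpen hz
  have dg' : ∀ v, DifferentiableAt ℝ (dirDeriv v g) z :=
    fun v => (hg.dirDeriv h.isOpen v).differentiableAt_of_isOpen h.isOpen hz
  have h2 : ∀ i j, frameCovHess e x (fun z => (inner ℝ (f z) (g z) : ℝ)) z i j =
      inner ℝ (frameCovHess e x f z i j) (g z) +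
      (inner ℝ (dirDeriv (e i) f z) (dirDeriv (e j) g z) +
        inner ℝ (dirDeriv (e j) f z) (dirDeriv (e i) g z)) +
      inner ℝ (f z) (frameCovHess e x g z i j) := by
    intro i j
    have hcongr : EqOn (dirDeriv (e j) (fun z => (inner ℝ (f z) (g z) : ℝ)))
        (fun y => inner ℝ (dirDeriv (e j) f y) (g y) + inner ℝ (f y) (dirDeriv (e j) g y)) U :=
      fun y hy => dirDeriv_inner (df hy) (dg hy) (e j)
    simp only [frameCovHess]
    rw [dirDeriv_congr h.isOpen hz hcongr, dirDeriv_add ((df' _).inner ℝ (dg hz))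
      ((df hz).inner ℝ (dg' _)), dirDeriv_inner (df' _) (dg hz), dirDeriv_inner (df hz) (dg' _)]
    simp only [dirDeriv_inner (df hz) (dg hz), inner_sub_left, inner_sub_right, sum_inner,
      inner_sum, inner_smul_left, inner_smul_right, smul_eq_mul, mul_add, Finset.sum_add_distrib,
      RCLike.conj_to_real]
    ring
  have h3 : ∑ i, ∑ j, frameMetricInv e x z i j *
        (inner ℝ (dirDeriv (e j) f z) (dirDeriv (e i) g z) : ℝ) =
      ∑ i, ∑ j, frameMetricInv e x z i j *
        inner ℝ (dirDeriv (e i) f z) (dirDeriv (e j) g z) := by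
    rw [Finset.sum_comm]
    refine Finset.sum_congr rfl fun i _ => Finset.sum_congr rfl fun j _ => ?_
    rw [frameMetricInv_symm]
  simp only [frameLaplacian, h2, smul_eq_mul, mul_add, Finset.sum_add_distrib, h3, sum_inner,
    inner_sum, inner_smul_left, inner_smul_right, RCLike.conj_to_real]
  ring

lemma laplacian_eq_zero_of_eqOn_const {f : Z → V} {c : V} (hf : EqOn f (fun _ => c) U) :
    frameLaplacian e x f z = 0 := by
  have h1 : ∀ v, EqOn (dirDeriv v f) (fun _ => 0) U := fun v y hy => by
    rw [dirDeriv_congr h.isOpen hy hf, dirDeriv_const]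
  have h2 : ∀ v w, dirDeriv v (dirDeriv w f) z = 0 := fun v w => by
    rw [dirDeriv_congr h.isOpen hz (h1 w), dirDeriv_const]
  simp [frameLaplacian, frameCovHess, h2, fun v => h1 v hz]

/-- The tangential part of `Δν` is the gradient of the mean curvature. Since `⟨∂ₖ x, ν⟩ = 0`, this
follows from the first variation formula for the variation `∂ₖ x`, in place of the Codazzi
equation. -/
lemma inner_frame_laplacian_normal (k : Fin n) :
    inner ℝ (dirDeriv (e k) x z) (frameLaplacian e x ν z) =
      dirDeriv (e k) (frameMeanCurvature e x ν) z := by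
  have h0 : EqOn (fun z => (inner ℝ (dirDeriv (e k) x z) (ν z) : ℝ)) (fun _ => 0) U := by
    intro y hy
    change inner ℝ (dirDeriv (e k) x y) (ν y) = (0 : ℝ)
    rw [real_inner_comm, h.normal y hy]
  have h1 := h.laplacian_inner hz (h.smooth.dirDeriv h.isOpen (e k)) h.smooth_normal
  rw [h.laplacian_eq_zero_of_eqOn_const hz h0] at h1
  rw [h.dirDeriv_meanCurvature hz]
  linarith [real_inner_comm (ν z) (frameLaplacian e x (dirDeriv (e k) x) z)]

lemma normSq_eq : frameNormSq e x ν z = ∑ i, ∑ j, frameMetricInv e x z i j *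
    inner ℝ (dirDeriv (e i) ν z) (dirDeriv (e j) ν z) := by
  have h1 : ∀ i k, (inner ℝ (dirDeriv (e i) ν z) (dirDeriv (e k) ν z) : ℝ) =
      ∑ j, ∑ l, frameMetricInv e x z j l * frameSecondFF e x ν z i j *
        frameSecondFF e x ν z k l := by
    intro i k
    rw [h.inner_eq hz, h.inner_dirDeriv_normal_self hz, zero_mul, zero_add, Finset.sum_comm]
    simp only [inner_frameDual, h.secondFF_eq hz, Finset.sum_mul]
    refine Finset.sum_congr rfl fun j _ => Finset.sum_congr rfl fun l _ => ?_
    rw [frameMetricInv_symm]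
  simp only [h1, frameNormSq, Finset.mul_sum]
  refine Finset.sum_congr rfl fun i _ => ?_
  rw [Finset.sum_comm]
  refine Finset.sum_congr rfl fun k _ => Finset.sum_congr rfl fun j _ =>
    Finset.sum_congr rfl fun l _ => ?_
  ring

/-- `Δν = ∇H - |A|² ν`, tested against an arbitrary vector. -/
lemma inner_laplacian_normal (a : EuclideanSpace ℝ (Fin (n + 1))) :
    inner ℝ a (frameLaplacian e x ν z) =
      ∑ i, inner ℝ a (frameDual e x z i) * dirDeriv (e i) (frameMeanCurvature e x ν) z -
        frameNormSq e x ν z * inner ℝ a (ν z) := by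
  have h0 : EqOn (fun z => (inner ℝ (ν z) (ν z) : ℝ)) (fun _ => 1) U := fun z hz => h.unit z hz
  have h1 := h.laplacian_inner hz h.smooth_normal h.smooth_normal
  rw [h.laplacian_eq_zero_of_eqOn_const hz h0, real_inner_comm, ← h.normSq_eq hz] at h1
  have h2 : inner ℝ (frameLaplacian e x ν z) (ν z) = - frameNormSq e x ν z := by
    rw [real_inner_comm]; linarith
  rw [h.inner_eq hz, h2]
  simp only [real_inner_comm (dirDeriv _ x z) (frameLaplacian e x ν z),
    ← h.inner_frame_laplacian_normal hz]
  ring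

/-- The evolution `∂ₜν` of the normal under a motion with the normal velocity of the rescaled mean
curvature flow, tested against an arbitrary vector. -/
lemma inner_dirDeriv_normal_of_normal_flow {τ : Z}
    (hflow : ∀ y ∈ U, inner ℝ (dirDeriv τ x y) (ν y) =
      - frameMeanCurvature e x ν y + inner ℝ (x y) (ν y))
    (a : EuclideanSpace ℝ (Fin (n + 1))) :
    inner ℝ a (dirDeriv τ ν z) = inner ℝ a (frameLaplacian e x ν z) +
      frameNormSq e x ν z * inner ℝ a (ν z) +
      ∑ i, inner ℝ a (frameDual e x z i) *
        inner ℝ (dirDeriv τ x z - x z) (dirDeriv (e i) ν z) := by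
  have dν := h.differentiableAt_normal hz
  have dx := h.differentiableAt hz
  have dτ : DifferentiableAt ℝ (dirDeriv τ x) z :=
    (h.smooth.dirDeriv h.isOpen τ).differentiableAt_of_isOpen h.isOpen hz
  have dH : DifferentiableAt ℝ (frameMeanCurvature e x ν) z :=
    h.contDiffOn_meanCurvature.differentiableAt_of_isOpen h.isOpen hz
  have h1 : ∀ i, inner ℝ (dirDeriv τ ν z) (dirDeriv (e i) x z) =
      dirDeriv (e i) (frameMeanCurvature e x ν) z +
        inner ℝ (dirDeriv τ x z - x z) (dirDeriv (e i) ν z) := by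
    intro i
    have := dirDeriv_congr h.isOpen hz hflow (e i)
    rw [dirDeriv_inner dτ dν, dirDeriv_add dH.fun_neg (dx.inner ℝ dν), dirDeriv_neg,
      dirDeriv_inner dx dν, real_inner_comm, real_inner_comm (ν z) (dirDeriv (e i) x z),
      h.normal z hz] at this
    rw [h.inner_dirDeriv_normal_frame hz, inner_sub_left]
    linarith
  rw [h.inner_eq hz, h.inner_dirDeriv_normal_self hz, h.inner_laplacian_normal hz]
  simp only [h1, mul_add, Finset.sum_add_distrib]
  ring

/-- The linearized rescaled flow: `σ` is the direction of the variation parameter and `τ` that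
of time. -/
lemma dirDeriv_normal_variation {σ τ : Z}
    (hflow : ∀ y ∈ U, inner ℝ (dirDeriv τ x y) (ν y) =
      - frameMeanCurvature e x ν y + inner ℝ (x y) (ν y))
    (hz' : dirDeriv τ x z = - (frameMeanCurvature e x ν z • ν z) + x z) :
    dirDeriv τ (fun y => (inner ℝ (dirDeriv σ x y) (ν y) : ℝ)) z =
      frameLaplacian e x (fun y => (inner ℝ (dirDeriv σ x y) (ν y) : ℝ)) z +
      frameNormSq e x ν z * inner ℝ (dirDeriv σ x z) (ν z) + inner ℝ (dirDeriv σ x z) (ν z) := by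
  have dν := h.differentiableAt_normal hz
  have dx := h.differentiableAt hz
  have d1 : ∀ v, DifferentiableAt ℝ (dirDeriv v x) z := fun v =>
    (h.smooth.dirDeriv h.isOpen v).differentiableAt_of_isOpen h.isOpen hz
  have dH : DifferentiableAt ℝ (frameMeanCurvature e x ν) z :=
    h.contDiffOn_meanCurvature.differentiableAt_of_isOpen h.isOpen hz
  have hzero : ∀ d, inner ℝ (dirDeriv τ x z - x z) (dirDeriv d ν z) = (0 : ℝ) := by
    intro d
    rw [hz', add_sub_cancel_right, inner_neg_left, inner_smul_left, real_inner_comm,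
      h.inner_dirDeriv_normal_self hz]
    simp
  have h1 := dirDeriv_congr h.isOpen hz hflow σ
  rw [dirDeriv_inner (d1 τ) dν, dirDeriv_add dH.fun_neg (dx.inner ℝ dν), dirDeriv_neg,
    dirDeriv_inner dx dν, h.dirDeriv_meanCurvature hz, dirDeriv_comm h.smooth h.isOpen hz σ τ] at h1
  have h2 := hzero σ
  rw [inner_sub_left] at h2
  rw [dirDeriv_inner (d1 σ) dν, h.inner_dirDeriv_normal_of_normal_flow hz hflow,
    h.laplacian_inner hz (h.smooth.dirDeriv h.isOpen σ) h.smooth_normal]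
  simp only [hzero, mul_zero, Finset.sum_const_zero]
  linarith [real_inner_comm (ν z) (frameLaplacian e x (dirDeriv σ x) z)]

/-- The Gauss formula for `Δx`. -/
lemma inner_laplacian_self : inner ℝ (frameLaplacian e x x z) (ν z) =
    - frameMeanCurvature e x ν z := by
  rw [real_inner_comm]
  simp only [frameLaplacian, inner_sum, inner_smul_right, frameCovHess, inner_sub_right,
    h.normal z hz, frameMeanCurvature, frameSecondFF]
  simp

/-- The evolution of `⟨x - y, ν⟩` for a hypersurface `y` that does not depend on time. -/
lemma dirDeriv_normal_displacement {τ : Z} {y : Z → EuclideanSpace ℝ (Fin (n + 1))}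
    (hflow : ∀ y ∈ U, inner ℝ (dirDeriv τ x y) (ν y) =
      - frameMeanCurvature e x ν y + inner ℝ (x y) (ν y))
    (hy : ContDiffOn ℝ ∞ y U) (hyτ : dirDeriv τ y z = 0) :
    dirDeriv τ (fun z => (inner ℝ (x z - y z) (ν z) : ℝ)) z =
      frameLaplacian e x (fun z => (inner ℝ (x z - y z) (ν z) : ℝ)) z +
      frameNormSq e x ν z * inner ℝ (x z - y z) (ν z) + inner ℝ (x z - y z) (ν z) +
      inner ℝ (y z + frameLaplacian e x y z) (ν z) -
      2 * ∑ i, ∑ j, frameMetricInv e x z i j *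
        inner ℝ (dirDeriv (e i) (fun z => x z - y z) z) (dirDeriv (e j) ν z) +
      ∑ i, inner ℝ (x z - y z) (frameDual e x z i) *
        inner ℝ (dirDeriv τ x z - x z) (dirDeriv (e i) ν z) := by
  have dν := h.differentiableAt_normal hz
  have dx : ∀ {z}, z ∈ U → DifferentiableAt ℝ x z := h.differentiableAt
  have dy : ∀ {z}, z ∈ U → DifferentiableAt ℝ y z :=
    fun hz => hy.differentiableAt_of_isOpen h.isOpen hz
  have hlap : frameLaplacian e x (fun z => x z - y z) z =
      frameLaplacian e x x z - frameLaplacian e x y z := by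
    have h2 : ∀ i j, dirDeriv (e i) (dirDeriv (e j) fun z => x z - y z) z =
        dirDeriv (e i) (dirDeriv (e j) x) z - dirDeriv (e i) (dirDeriv (e j) y) z := by
      intro i j
      rw [dirDeriv_congr h.isOpen hz (fun z hz => dirDeriv_sub (dx hz) (dy hz) (e j)),
        dirDeriv_sub ((h.smooth.dirDeriv h.isOpen _).differentiableAt_of_isOpen h.isOpen hz)
          ((hy.dirDeriv h.isOpen _).differentiableAt_of_isOpen h.isOpen hz)]
    simp only [frameLaplacian, frameCovHess, h2, dirDeriv_sub (dx hz) (dy hz),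
      ← Finset.sum_sub_distrib, ← smul_sub]
    refine Finset.sum_congr rfl fun i _ => Finset.sum_congr rfl fun j _ => ?_
    simp only [smul_sub, Finset.sum_sub_distrib]
    abel
  have hsub : ContDiffOn ℝ ∞ (fun z => x z - y z) U := h.smooth.sub hy
  rw [dirDeriv_inner ((dx hz).fun_sub (dy hz)) dν, h.inner_dirDeriv_normal_of_normal_flow hz hflow,
    h.laplacian_inner hz hsub h.smooth_normal, hlap,
    inner_sub_left (frameLaplacian e x x z), h.inner_laplacian_self hz,
    dirDeriv_sub (dx hz) (dy hz), hyτ, sub_zero, hflow z hz,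
    inner_add_left (y z), inner_sub_left (x z) (y z) (ν z)]
  ring

end

end HypersurfaceFrame

end HypersurfaceFrame

/-! ### The coordinate formulas on slices of the parameter space -/

section Slices

variable {n : ℕ} {Z V : Type*} [NormedAddCommGroup Z] [NormedSpace ℝ Z]
  [NormedAddCommGroup V] [NormedSpace ℝ V]

lemma pderiv_congr {f g : EuclideanSpace ℝ (Fin n) → V} {y : EuclideanSpace ℝ (Fin n)}
    (h : f =ᶠ[nhds y] g) (i : Fin n) : pderiv i f y = pderiv i g y := by
  simp only [pderiv, h.fderiv_eq]

lemma coordCovHess_congr {F : EuclideanSpace ℝ (Fin n) → EuclideanSpace ℝ (Fin (n + 1))}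
    {f g : EuclideanSpace ℝ (Fin n) → V} {y : EuclideanSpace ℝ (Fin n)} (h : f =ᶠ[nhds y] g)
    (i j : Fin n) : coordCovHess F f y i j = coordCovHess F g y i j := by
  have h' : pderiv j f =ᶠ[nhds y] pderiv j g := by
    filter_upwards [h.eventually_nhds] with b hb
    exact pderiv_congr hb j
  simp only [coordCovHess, pderiv_congr h, pderiv_congr h']

variable {sl : EuclideanSpace ℝ (Fin n) → Z} {ι : EuclideanSpace ℝ (Fin n) →L[ℝ] Z}
  (hsl : ∀ y, HasFDerivAt sl ι y) {U : Set Z} {y : EuclideanSpace ℝ (Fin n)}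
include hsl

lemma pderiv_slice {f : Z → V} (hf : DifferentiableAt ℝ f (sl y)) (i : Fin n) :
    pderiv i (fun y => f (sl y)) y = dirDeriv (ι (EuclideanSpace.single i 1)) f (sl y) := by
  have := (hf.hasFDerivAt.comp y (hsl y)).fderiv
  simp only [pderiv, dirDeriv]
  change fderiv ℝ (f ∘ sl) y _ = _
  rw [this]
  rfl

lemma pderiv_pderiv_slice {f : Z → V} (hU : IsOpen U) (hy : sl y ∈ U) (hf : ContDiffOn ℝ ∞ f U)
    (i j : Fin n) :
    pderiv i (pderiv j (fun y => f (sl y))) y =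
      dirDeriv (ι (EuclideanSpace.single i 1))
        (dirDeriv (ι (EuclideanSpace.single j 1)) f) (sl y) := by
  have hev : pderiv j (fun y => f (sl y)) =ᶠ[nhds y]
      fun y => dirDeriv (ι (EuclideanSpace.single j 1)) f (sl y) := by
    filter_upwards [(hsl y).continuousAt.preimage_mem_nhds (hU.mem_nhds hy)] with y' hy'
    exact pderiv_slice hsl (hf.differentiableAt_of_isOpen hU hy') j
  rw [pderiv_congr hev, pderiv_slice hsl ((hf.dirDeriv hU _).differentiableAt_of_isOpen hU hy)]

lemma coordMetric_slice {x : Z → EuclideanSpace ℝ (Fin (n + 1))}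
    (hx : DifferentiableAt ℝ x (sl y)) :
    coordMetric (fun y => x (sl y)) y =
      Matrix.gram ℝ fun i => dirDeriv (ι (EuclideanSpace.single i 1)) x (sl y) := by
  ext i j
  simp [coordMetric, pderiv_slice hsl hx, Matrix.gram_apply]

lemma coordMetricInv_slice {x : Z → EuclideanSpace ℝ (Fin (n + 1))}
    (hx : DifferentiableAt ℝ x (sl y)) :
    coordMetricInv (fun y => x (sl y)) y =
      frameMetricInv (fun i => ι (EuclideanSpace.single i 1)) x (sl y) := by
  rw [coordMetricInv, coordMetric_slice hsl hx]
  rfl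

/-- The Christoffel symbols of the induced metric are `Γᵏᵢⱼ = ⟨gᵏˡ ∂ₗx, ∂ᵢ∂ⱼx⟩`. -/
lemma coordChristoffel_slice {x : Z → EuclideanSpace ℝ (Fin (n + 1))} (hU : IsOpen U)
    (hy : sl y ∈ U) (hx : ContDiffOn ℝ ∞ x U) (k i j : Fin n) :
    coordChristoffel (fun y => x (sl y)) k i j y =
      inner ℝ (frameDual (fun i => ι (EuclideanSpace.single i 1)) x (sl y) k)
        (dirDeriv (ι (EuclideanSpace.single i 1))
          (dirDeriv (ι (EuclideanSpace.single j 1)) x) (sl y)) := by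
  have hd : ∀ a, DifferentiableAt ℝ (dirDeriv (ι (EuclideanSpace.single a 1)) x) (sl y) := fun a =>
    (hx.dirDeriv hU _).differentiableAt_of_isOpen hU hy
  have hmet : ∀ a b c, pderiv a (fun z => coordMetric (fun y => x (sl y)) z b c) y =
      inner ℝ (dirDeriv (ι (EuclideanSpace.single a 1))
          (dirDeriv (ι (EuclideanSpace.single b 1)) x) (sl y))
        (dirDeriv (ι (EuclideanSpace.single c 1)) x (sl y)) +
      inner ℝ (dirDeriv (ι (EuclideanSpace.single b 1)) x (sl y))
        (dirDeriv (ι (EuclideanSpace.single a 1))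
          (dirDeriv (ι (EuclideanSpace.single c 1)) x) (sl y)) := by
    intro a b c
    have hev : (fun z => coordMetric (fun y => x (sl y)) z b c) =ᶠ[nhds y]
        fun y => (fun z => (inner ℝ (dirDeriv (ι (EuclideanSpace.single b 1)) x z)
          (dirDeriv (ι (EuclideanSpace.single c 1)) x z) : ℝ)) (sl y) := by
      filter_upwards [(hsl y).continuousAt.preimage_mem_nhds (hU.mem_nhds hy)] with y' hy'
      rw [coordMetric_slice hsl (hx.differentiableAt_of_isOpen hU hy'), Matrix.gram_apply]
    rw [pderiv_congr hev, pderiv_slice (f := fun z =>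
      (inner ℝ (dirDeriv (ι (EuclideanSpace.single b 1)) x z)
          (dirDeriv (ι (EuclideanSpace.single c 1)) x z) : ℝ)) hsl ((hd b).inner ℝ (hd c)),
      dirDeriv_inner (hd b) (hd c)]
  rw [real_inner_comm, inner_frameDual]
  simp only [coordChristoffel, coordMetricInv_slice hsl (hx.differentiableAt_of_isOpen hU hy), hmet]
  rw [Finset.mul_sum]
  refine Finset.sum_congr rfl fun l _ => ?_
  rw [dirDeriv_comm hx hU hy (ι (EuclideanSpace.single j 1)) (ι (EuclideanSpace.single i 1)),
    dirDeriv_comm hx hU hy (ι (EuclideanSpace.single l 1)) (ι (EuclideanSpace.single i 1)),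
    dirDeriv_comm hx hU hy (ι (EuclideanSpace.single l 1)) (ι (EuclideanSpace.single j 1)),
    real_inner_comm (dirDeriv (ι (EuclideanSpace.single j 1)) x (sl y))
      (dirDeriv (ι (EuclideanSpace.single i 1))
        (dirDeriv (ι (EuclideanSpace.single l 1)) x) (sl y))]
  ring

lemma coordCovHess_slice {x : Z → EuclideanSpace ℝ (Fin (n + 1))} {φ : Z → V} (hU : IsOpen U)
    (hy : sl y ∈ U) (hx : ContDiffOn ℝ ∞ x U) (hφ : ContDiffOn ℝ ∞ φ U) (i j : Fin n) :
    coordCovHess (fun y => x (sl y)) (fun y => φ (sl y)) y i j =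
      frameCovHess (fun i => ι (EuclideanSpace.single i 1)) x φ (sl y) i j := by
  simp only [coordCovHess, frameCovHess, pderiv_pderiv_slice hsl hU hy hφ,
    coordChristoffel_slice hsl hU hy hx, pderiv_slice hsl (hφ.differentiableAt_of_isOpen hU hy)]

lemma coordSecondFF_slice {x ν : Z → EuclideanSpace ℝ (Fin (n + 1))} (hU : IsOpen U)
    (hy : sl y ∈ U) (hx : ContDiffOn ℝ ∞ x U) (i j : Fin n) :
    coordSecondFF (fun y => x (sl y)) (ν (sl y)) y i j =
      frameSecondFF (fun i => ι (EuclideanSpace.single i 1)) x ν (sl y) i j := by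
  simp only [coordSecondFF, frameSecondFF, pderiv_pderiv_slice hsl hU hy hx]

end Slices

/-! ### Invariance of the mean curvature under changes of coordinates -/

section Invariance

variable {n : ℕ}

lemma pderiv_pderiv {W : Type*} [NormedAddCommGroup W] [NormedSpace ℝ W]
    {f : EuclideanSpace ℝ (Fin n) → W} {y : EuclideanSpace ℝ (Fin n)}
    (hf : ContDiffAt ℝ ∞ f y) (i j : Fin n) :
    pderiv i (pderiv j f) y =
      fderiv ℝ (fderiv ℝ f) y (EuclideanSpace.single i 1) (EuclideanSpace.single j 1) := by
  have hd : DifferentiableAt ℝ (fderiv ℝ f) y :=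
    (hf.fderiv_right (m := ∞) (by simp)).differentiableAt (by simp)
  change fderiv ℝ (fun z => fderiv ℝ f z (EuclideanSpace.single j 1)) y _ = _
  rw [fderiv_clm_apply hd (differentiableAt_const _)]
  simp

/-- The mean curvature computed from coordinate expressions does not depend on the coordinates: the
second derivatives of the transition map contribute only tangentially, and the trace `gⁱʲ hᵢⱼ` is
invariant under linear changes of the frame. -/
lemma sum_metricInv_mul_secondFF_comp
    {f : EuclideanSpace ℝ (Fin n) → EuclideanSpace ℝ (Fin (n + 1))}
    {φ : EuclideanSpace ℝ (Fin n) → EuclideanSpace ℝ (Fin n)} {a : EuclideanSpace ℝ (Fin n)}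
    (hφ : ContDiffAt ℝ ∞ φ a) (hf : ContDiffAt ℝ ∞ f (φ a))
    (hinj : Injective (fderiv ℝ φ a)) {N : EuclideanSpace ℝ (Fin (n + 1))}
    (hN : ∀ v, inner ℝ N (fderiv ℝ f (φ a) v) = (0 : ℝ)) :
    ∑ i, ∑ j, coordMetricInv (f ∘ φ) a i j * coordSecondFF (f ∘ φ) N a i j =
      ∑ i, ∑ j, coordMetricInv f (φ a) i j * coordSecondFF f N (φ a) i j := by
  have dφ : DifferentiableAt ℝ φ a := hφ.differentiableAt (by simp)
  have df : DifferentiableAt ℝ f (φ a) := hf.differentiableAt (by simp)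
  have dφ' : DifferentiableAt ℝ (fderiv ℝ φ) a :=
    (hφ.fderiv_right (m := ∞) (by simp)).differentiableAt (by simp)
  have df' : DifferentiableAt ℝ (fderiv ℝ f) (φ a) :=
    (hf.fderiv_right (m := ∞) (by simp)).differentiableAt (by simp)
  set J : Matrix (Fin n) (Fin n) ℝ :=
    Matrix.of fun k i => fderiv ℝ φ a (EuclideanSpace.single i 1) k
  have hexp : ∀ i, fderiv ℝ φ a (EuclideanSpace.single i 1) =
      ∑ k, J k i • EuclideanSpace.single k (1 : ℝ) := by
    intro i
    ext k
    simp [J, Pi.single_apply]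
  have hJ : IsUnit J := by
    rw [← Matrix.mulVec_injective_iff_isUnit]
    intro v w hvw
    have key : ∀ v : Fin n → ℝ, fderiv ℝ φ a (WithLp.toLp 2 v) = WithLp.toLp 2 (J.mulVec v) := by
      intro v
      have : (WithLp.toLp 2 v : EuclideanSpace ℝ (Fin n)) =
          ∑ i, v i • EuclideanSpace.single i (1 : ℝ) := by
        ext k; simp [Pi.single_apply]
      rw [this, map_sum]
      ext k
      simp [J, Matrix.mulVec, dotProduct, mul_comm]
    have := hinj ((key v).trans ((congrArg (WithLp.toLp 2) hvw).trans (key w).symm))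
    simpa using this
  have hev : ∀ᶠ b in nhds a, fderiv ℝ (f ∘ φ) b = (fderiv ℝ f (φ b)).comp (fderiv ℝ φ b) := by
    have h1 : ∀ᶠ b in nhds a, DifferentiableAt ℝ φ b :=
      ((hφ.of_le (m := 1) (by simp)).eventually (by simp)).mono
        fun b hb => hb.differentiableAt (by simp)
    have h2 : ∀ᶠ b in nhds a, DifferentiableAt ℝ f (φ b) :=
      hφ.continuousAt.eventually (((hf.of_le (m := 1) (by simp)).eventually (by simp)).mono
        fun b hb => hb.differentiableAt (by simp))
    filter_upwards [h1, h2] with b hb1 hb2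
    exact fderiv_comp b hb2 hb1
  have hmet : coordMetric (f ∘ φ) a = J.transpose * coordMetric f (φ a) * J := by
    ext i j
    simp only [coordMetric, Matrix.of_apply, pderiv, hev.self_of_nhds, Matrix.mul_apply,
      Matrix.transpose_apply, ContinuousLinearMap.comp_apply, hexp, map_sum, map_smul, sum_inner,
      inner_sum, inner_smul_left, inner_smul_right, Finset.sum_mul, Finset.mul_sum,
      RCLike.conj_to_real]
    refine Finset.sum_congr rfl fun k _ => Finset.sum_congr rfl fun l _ => ?_
    ring
  have hsff : Matrix.of (coordSecondFF (f ∘ φ) N a) =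
      J.transpose * Matrix.of (coordSecondFF f N (φ a)) * J := by
    ext i j
    have h2 : pderiv i (pderiv j (f ∘ φ)) a =
        fderiv ℝ (fderiv ℝ f) (φ a) (fderiv ℝ φ a (EuclideanSpace.single i 1))
          (fderiv ℝ φ a (EuclideanSpace.single j 1)) +
        fderiv ℝ f (φ a) (fderiv ℝ (fderiv ℝ φ) a (EuclideanSpace.single i 1)
          (EuclideanSpace.single j 1)) := by
      rw [pderiv_pderiv (hf.comp a hφ), Filter.EventuallyEq.fderiv_eq hev,
        fderiv_clm_comp (c := fun b => fderiv ℝ f (φ b)) (df'.comp a dφ) dφ']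
      have h3 : fderiv ℝ (fun b => fderiv ℝ f (φ b)) a =
          (fderiv ℝ (fderiv ℝ f) (φ a)).comp (fderiv ℝ φ a) := fderiv_comp a df' dφ
      rw [h3]
      simp only [add_apply, ContinuousLinearMap.comp_apply,
        ContinuousLinearMap.compL_apply, ContinuousLinearMap.flip_apply]
      exact add_comm _ _
    simp only [Matrix.of_apply, coordSecondFF, h2, inner_add_right, hN, add_zero,
      pderiv_pderiv hf, Matrix.mul_apply, Matrix.transpose_apply]
    rw [hexp i, hexp j]
    simp only [map_sum, map_smul, sum_apply, smul_apply]
    simp only [inner_sum, inner_smul_right]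
    simp only [Finset.sum_mul, Finset.mul_sum, mul_neg, neg_mul, Finset.sum_neg_distrib, neg_inj]
    refine Finset.sum_congr rfl fun k _ => Finset.sum_congr rfl fun l _ => ?_
    ring
  have htrace : ∀ A B : Matrix (Fin n) (Fin n) ℝ,
      ∑ i, ∑ j, A i j * B i j = (A * B.transpose).trace := by
    intro A B
    simp [Matrix.trace, Matrix.mul_apply]
  have e1 := htrace (coordMetricInv (f ∘ φ) a) (Matrix.of (coordSecondFF (f ∘ φ) N a))
  have e2 := htrace (coordMetricInv f (φ a)) (Matrix.of (coordSecondFF f N (φ a)))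
  simp only [Matrix.of_apply] at e1 e2
  rw [e1, e2, coordMetricInv, coordMetricInv, hmet, hsff]
  have hJt : IsUnit J.transpose.det := by
    rw [Matrix.det_transpose]; exact (Matrix.isUnit_iff_isUnit_det J).1 hJ
  have hJd : IsUnit J.det := (Matrix.isUnit_iff_isUnit_det J).1 hJ
  simp only [Matrix.mul_inv_rev, Matrix.transpose_mul, Matrix.transpose_transpose, Matrix.mul_assoc]
  rw [← Matrix.mul_assoc (J.transpose)⁻¹, Matrix.nonsing_inv_mul _ hJt, Matrix.one_mul,
    Matrix.trace_mul_comm]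
  simp only [Matrix.mul_assoc]
  rw [Matrix.mul_nonsing_inv _ hJd, Matrix.mul_one]

end Invariance

/-! ### Families of immersions in a chart -/

section Families

lemma linearIndependent_apply_single {n : ℕ} {W : Type*} [NormedAddCommGroup W] [NormedSpace ℝ W]
    {L : EuclideanSpace ℝ (Fin n) →L[ℝ] W} (hL : Injective L) :
    LinearIndependent ℝ fun i : Fin n => L (EuclideanSpace.single i (1 : ℝ)) := by
  have hb : LinearIndependent ℝ fun i : Fin n => EuclideanSpace.single i (1 : ℝ) :=
    (EuclideanSpace.orthonormal_single (𝕜 := ℝ) (ι := Fin n)).linearIndependent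
  have hk : LinearMap.ker L.toLinearMap = ⊥ := LinearMap.ker_eq_bot.2 hL
  exact hb.map' L.toLinearMap hk

variable {n : ℕ} {M : Type*} [TopologicalSpace M] [ChartedSpace (EuclideanSpace ℝ (Fin n)) M]

lemma contMDiff_slice {T V : Type*} [NormedAddCommGroup T] [NormedSpace ℝ T]
     [NormedAddCommGroup V] [NormedSpace ℝ V]
    {f : T → M → V} {K : Set T}
    (hf : ContMDiffOn (𝓘(ℝ, T).prod (𝓡 n)) 𝓘(ℝ, V) ∞ (fun q : T × M => f q.1 q.2)
      (K ×ˢ (univ : Set M))) {θ : T} (hθ : θ ∈ K) : ContMDiff (𝓡 n) 𝓘(ℝ, V) ∞ (f θ) := by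
  rw [← contMDiffOn_univ]
  exact hf.comp (t := K ×ˢ (univ : Set M)) (f := fun q : M => (θ, q))
    (contMDiffOn_const.prodMk contMDiffOn_id) fun q _ => ⟨hθ, mem_univ _⟩

variable [IsManifold (𝓡 n) ∞ M]

lemma contMDiffAt_extChartAt_symm {p : M} {y : EuclideanSpace ℝ (Fin n)}
    (hy : y ∈ (extChartAt (𝓡 n) p).target) :
    ContMDiffAt 𝓘(ℝ, EuclideanSpace ℝ (Fin n)) (𝓡 n) ∞ (extChartAt (𝓡 n) p).symm y :=
  (contMDiffOn_extChartAt_symm p).contMDiffAt ((isOpen_extChartAt_target p).mem_nhds hy)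

lemma contDiffAt_inCoords {V : Type*} [NormedAddCommGroup V] [NormedSpace ℝ V] {F : M → V}
    (hF : ContMDiff (𝓡 n) 𝓘(ℝ, V) ∞ F) {p : M} {y : EuclideanSpace ℝ (Fin n)}
    (hy : y ∈ (extChartAt (𝓡 n) p).target) : ContDiffAt ℝ ∞ (inCoords F p) y :=
  contMDiffAt_iff_contDiffAt.1 (hF.contMDiffAt.comp y (contMDiffAt_extChartAt_symm hy))

lemma fderiv_inCoords {V : Type*} [NormedAddCommGroup V] [NormedSpace ℝ V] {F : M → V}
    (hF : ContMDiff (𝓡 n) 𝓘(ℝ, V) ∞ F) {p : M} {y : EuclideanSpace ℝ (Fin n)}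
    (hy : y ∈ (extChartAt (𝓡 n) p).target) :
    ∃ L : EuclideanSpace ℝ (Fin n) →L[ℝ] TangentSpace (𝓡 n) ((extChartAt (𝓡 n) p).symm y),
      Injective L ∧ ∀ v, fderiv ℝ (inCoords F p) y v =
        mfderiv (𝓡 n) 𝓘(ℝ, V) F ((extChartAt (𝓡 n) p).symm y) (L v) := by
  have hχ : MDifferentiableAt 𝓘(ℝ, EuclideanSpace ℝ (Fin n)) (𝓡 n)
      (extChartAt (𝓡 n) p).symm y := (contMDiffAt_extChartAt_symm hy).mdifferentiableAt (by simp)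
  have hF' : MDifferentiableAt (𝓡 n) 𝓘(ℝ, V) F ((extChartAt (𝓡 n) p).symm y) :=
    (hF _).mdifferentiableAt (by simp)
  have hinv : (mfderiv 𝓘(ℝ, EuclideanSpace ℝ (Fin n)) (𝓡 n)
      (extChartAt (𝓡 n) p).symm y).IsInvertible := by
    have h1 : IsManifold (𝓡 n) 1 M := IsManifold.of_le (n := ∞) (by simp)
    have := isInvertible_mfderivWithin_extChartAt_symm (I := 𝓡 n) hy
    simpa using this
  refine ⟨mfderiv 𝓘(ℝ, EuclideanSpace ℝ (Fin n)) (𝓡 n) (extChartAt (𝓡 n) p).symm y,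
    hinv.injective, fun v => ?_⟩
  have := mfderiv_comp y hF' hχ
  rw [mfderiv_eq_fderiv] at this
  exact congrArg (fun A => A v) this

lemma IsUnitNormal.injective_fderiv_inCoords {F ν : M → EuclideanSpace ℝ (Fin (n + 1))}
    (hν : IsUnitNormal F ν) (hF : ContMDiff (𝓡 n) 𝓘(ℝ, EuclideanSpace ℝ (Fin (n + 1))) ∞ F)
    {p : M} {y : EuclideanSpace ℝ (Fin n)} (hy : y ∈ (extChartAt (𝓡 n) p).target) :
    Injective (fderiv ℝ (inCoords F p) y) := by
  obtain ⟨L, hL, hL'⟩ := fderiv_inCoords hF hy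
  intro v w hvw
  rw [hL', hL'] at hvw
  exact hL (hν.immersion _ hvw)

lemma IsUnitNormal.inner_fderiv_inCoords {F ν : M → EuclideanSpace ℝ (Fin (n + 1))}
    (hν : IsUnitNormal F ν) (hF : ContMDiff (𝓡 n) 𝓘(ℝ, EuclideanSpace ℝ (Fin (n + 1))) ∞ F)
    {p : M} {y : EuclideanSpace ℝ (Fin n)} (hy : y ∈ (extChartAt (𝓡 n) p).target)
    (v : EuclideanSpace ℝ (Fin n)) :
    inner ℝ (ν ((extChartAt (𝓡 n) p).symm y)) (fderiv ℝ (inCoords F p) y v) = (0 : ℝ) := by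
  obtain ⟨L, -, hL⟩ := fderiv_inCoords hF hy
  rw [hL]
  exact hν.normal _ _

/-- The mean curvature at `q` may be computed in the preferred chart of any other point `p`. -/
lemma meanCurvature_eq_of_mem_source {F ν : M → EuclideanSpace ℝ (Fin (n + 1))}
    (hF : ContMDiff (𝓡 n) 𝓘(ℝ, EuclideanSpace ℝ (Fin (n + 1))) ∞ F) (hν : IsUnitNormal F ν)
    {p q : M} (hq : q ∈ (extChartAt (𝓡 n) p).source) :
    meanCurvature F ν q = ∑ i, ∑ j,
      coordMetricInv (inCoords F p) (extChartAt (𝓡 n) p q) i j *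
        coordSecondFF (inCoords F p) (ν q) (extChartAt (𝓡 n) p q) i j := by
  set χ := extChartAt (𝓡 n) p
  set ψ := extChartAt (𝓡 n) q
  set a := ψ q
  have ha : a ∈ ψ.target := mem_extChartAt_target q
  have hψa : ψ.symm a = q := extChartAt_to_inv q
  have hφa : (χ ∘ ψ.symm) a = χ q := by simp [hψa]
  have hsmooth : ContMDiffAt 𝓘(ℝ, EuclideanSpace ℝ (Fin n)) 𝓘(ℝ, EuclideanSpace ℝ (Fin n)) ∞
      (χ ∘ ψ.symm) a := by
    refine ContMDiffAt.comp a ?_ (contMDiffAt_extChartAt_symm ha)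
    rw [hψa]
    exact contMDiffAt_extChartAt' (by rwa [← extChartAt_source (𝓡 n)])
  have hy : χ q ∈ χ.target := χ.map_source hq
  have hχ : ContDiffAt ℝ ∞ (inCoords F p) ((χ ∘ ψ.symm) a) := by
    rw [hφa]; exact contDiffAt_inCoords hF hy
  have hev : inCoords F q =ᶠ[nhds a] inCoords F p ∘ (χ ∘ ψ.symm) := by
    have hc : ContinuousAt ψ.symm a := (contMDiffAt_extChartAt_symm ha).continuousAt
    have hm : χ.source ∈ nhds (ψ.symm a) := by
      rw [hψa]; exact (isOpen_extChartAt_source p).mem_nhds hq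
    filter_upwards [hc.preimage_mem_nhds hm] with b hb
    simp only [inCoords, comp_apply]
    rw [χ.left_inv hb]
  have hdiff := (contMDiffAt_iff_contDiffAt.1 hsmooth)
  have hfd : fderiv ℝ (inCoords F q) a =
      (fderiv ℝ (inCoords F p) ((χ ∘ ψ.symm) a)).comp (fderiv ℝ (χ ∘ ψ.symm) a) := by
    rw [hev.fderiv_eq]
    exact fderiv_comp a (hχ.differentiableAt (by simp)) (hdiff.differentiableAt (by simp))
  have hinj : Injective (fderiv ℝ (χ ∘ ψ.symm) a) := by
    intro v w hvw
    refine hν.injective_fderiv_inCoords hF ha ?_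
    rw [hfd]; simp [hvw]
  have hnormal : ∀ v, inner ℝ (ν q) (fderiv ℝ (inCoords F p) ((χ ∘ ψ.symm) a) v) = (0 : ℝ) := by
    intro v
    rw [hφa]
    have hn := hν.inner_fderiv_inCoords hF hy v
    rwa [show ν (χ.symm (χ q)) = ν q by rw [χ.left_inv hq]] at hn
  have key := sum_metricInv_mul_secondFF_comp hdiff hχ hinj hnormal
  rw [hφa] at key
  rw [← key]
  have hp : ∀ i, pderiv i (inCoords F q) =ᶠ[nhds a] pderiv i (inCoords F p ∘ (χ ∘ ψ.symm)) := by
    intro i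
    filter_upwards [hev.eventually_nhds] with b hb
    exact pderiv_congr hb i
  simp only [meanCurvature, metricInvAt, secondFFAt, coordMetricInv, coordMetric, coordSecondFF]
  simp only [pderiv_congr (hp _), (hp _).self_of_nhds, a, ψ]

variable {T : Type*} [NormedAddCommGroup T] [NormedSpace ℝ T]

/-- The `i`-th coordinate direction of the chart, in the product with a parameter space `T`. -/
noncomputable def coordDir (T : Type*) [NormedAddCommGroup T] [NormedSpace ℝ T] (n : ℕ)
    (i : Fin n) : T × EuclideanSpace ℝ (Fin n) :=
  ContinuousLinearMap.inr ℝ T (EuclideanSpace ℝ (Fin n)) (EuclideanSpace.single i 1)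

lemma hasFDerivAt_prodMk_inr (θ : T) (y : EuclideanSpace ℝ (Fin n)) :
    HasFDerivAt (fun y => (θ, y))
      (ContinuousLinearMap.inr ℝ T (EuclideanSpace ℝ (Fin n))) y :=
  hasFDerivAt_prodMk_right θ y

/-- A family `f θ : M → V` in the chart around `p`. -/
noncomputable def familyInCoords {V : Type*} (f : T → M → V) (p : M) :
    T × EuclideanSpace ℝ (Fin n) → V :=
  fun z => f z.1 ((extChartAt (𝓡 n) p).symm z.2)

lemma contDiffOn_familyInCoords {V : Type*} [NormedAddCommGroup V] [NormedSpace ℝ V]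
    {f : T → M → V} {K : Set T}
    (hf : ContMDiffOn (𝓘(ℝ, T).prod (𝓡 n)) 𝓘(ℝ, V) ∞ (fun q : T × M => f q.1 q.2)
      (K ×ˢ (univ : Set M))) (p : M) :
    ContDiffOn ℝ ∞ (familyInCoords f p) (K ×ˢ (extChartAt (𝓡 n) p).target) := by
  have h : ContMDiffOn (𝓘(ℝ, T).prod 𝓘(ℝ, EuclideanSpace ℝ (Fin n))) 𝓘(ℝ, V) ∞
      (familyInCoords f p) (K ×ˢ (extChartAt (𝓡 n) p).target) :=
    hf.comp (t := K ×ˢ (univ : Set M))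
      (f := fun z : T × EuclideanSpace ℝ (Fin n) => (z.1, (extChartAt (𝓡 n) p).symm z.2))
      (contMDiffOn_fst.prodMk
        ((contMDiffOn_extChartAt_symm p).comp contMDiffOn_snd fun z hz => hz.2))
      fun z hz => ⟨hz.1, mem_univ _⟩
  rwa [← contMDiffOn_iff_contDiffOn, modelWithCornersSelf_prod, ← chartedSpaceSelf_prod]

/-- A smooth family of immersed hypersurfaces with unit normals, in the chart around `p`. -/
lemma hypersurfaceFrame_familyInCoords {x ν : T → M → EuclideanSpace ℝ (Fin (n + 1))} {K : Set T}
    (hK : IsOpen K)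
    (hx : ContMDiffOn (𝓘(ℝ, T).prod (𝓡 n)) 𝓘(ℝ, EuclideanSpace ℝ (Fin (n + 1))) ∞
      (fun q : T × M => x q.1 q.2) (K ×ˢ (univ : Set M)))
    (hν : ContMDiffOn (𝓘(ℝ, T).prod (𝓡 n)) 𝓘(ℝ, EuclideanSpace ℝ (Fin (n + 1))) ∞
      (fun q : T × M => ν q.1 q.2) (K ×ˢ (univ : Set M)))
    (hxν : ∀ θ ∈ K, IsUnitNormal (x θ) (ν θ)) (p : M) :
    HypersurfaceFrame (K ×ˢ (extChartAt (𝓡 n) p).target) (coordDir T n)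
      (familyInCoords x p) (familyInCoords ν p) := by
  have hU : IsOpen (K ×ˢ (extChartAt (𝓡 n) p).target) := hK.prod (isOpen_extChartAt_target p)
  have hxU := contDiffOn_familyInCoords hx p
  have hd : ∀ z ∈ K ×ˢ (extChartAt (𝓡 n) p).target, ∀ i,
      dirDeriv (coordDir T n i) (familyInCoords x p) z =
        fderiv ℝ (inCoords (x z.1) p) z.2 (EuclideanSpace.single i 1) := fun z hz i =>
    (pderiv_slice (hasFDerivAt_prodMk_inr z.1) (hxU.differentiableAt_of_isOpen hU hz) i).symm
  refine ⟨hU, hxU, contDiffOn_familyInCoords hν p, ?_, ?_, ?_⟩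
  · intro z hz
    rw [real_inner_self_eq_norm_sq]
    simp [familyInCoords, (hxν z.1 hz.1).unit]
  · intro z hz i
    rw [hd z hz]
    exact (hxν z.1 hz.1).inner_fderiv_inCoords (contMDiff_slice hx hz.1) hz.2 _
  · intro z hz
    simp only [hd z hz]
    exact linearIndependent_apply_single
      ((hxν z.1 hz.1).injective_fderiv_inCoords (contMDiff_slice hx hz.1) hz.2)

section Geometry

variable {x ν : T → M → EuclideanSpace ℝ (Fin (n + 1))} {K : Set T}
  (hK : IsOpen K)
  (hx : ContMDiffOn (𝓘(ℝ, T).prod (𝓡 n)) 𝓘(ℝ, EuclideanSpace ℝ (Fin (n + 1))) ∞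
      (fun q : T × M => x q.1 q.2) (K ×ˢ (univ : Set M)))
  {θ : T} (hθ : θ ∈ K) (p : M)
include hK hx hθ

lemma metricInvAt_eq : metricInvAt (x θ) p =
    frameMetricInv (coordDir T n) (familyInCoords x p) (θ, extChartAt (𝓡 n) p p) :=
  coordMetricInv_slice (x := familyInCoords x p) (hasFDerivAt_prodMk_inr θ)
    ((contDiffOn_familyInCoords hx p).differentiableAt_of_isOpen
      (hK.prod (isOpen_extChartAt_target p)) ⟨hθ, mem_extChartAt_target p⟩)

omit [IsManifold (𝓡 n) ∞ M] [NormedAddCommGroup T] [NormedSpace ℝ T] hK hx hθ in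
lemma eventuallyEq_inCoords {V : Type*} {φ : M → V} {Φ : T × EuclideanSpace ℝ (Fin n) → V} {p : M}
    (hφ : ∀ y ∈ (extChartAt (𝓡 n) p).target, Φ (θ, y) = inCoords φ p y) :
    inCoords φ p =ᶠ[nhds (extChartAt (𝓡 n) p p)] fun y => Φ (θ, y) := by
  filter_upwards [extChartAt_target_mem_nhds (I := 𝓡 n) p] with y hy
  exact (hφ y hy).symm

omit [IsManifold (𝓡 n) ∞ M] hx in
lemma partialAt_eq {V : Type*} [NormedAddCommGroup V] [NormedSpace ℝ V] {φ : M → V}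
    {Φ : T × EuclideanSpace ℝ (Fin n) → V}
    (hΦ : ContDiffOn ℝ ∞ Φ (K ×ˢ (extChartAt (𝓡 n) p).target))
    (hφ : ∀ y ∈ (extChartAt (𝓡 n) p).target, Φ (θ, y) = inCoords φ p y) (i : Fin n) :
    partialAt φ p i = dirDeriv (coordDir T n i) Φ (θ, extChartAt (𝓡 n) p p) := by
  rw [partialAt, pderiv_congr (eventuallyEq_inCoords hφ)]
  exact pderiv_slice (f := Φ) (hasFDerivAt_prodMk_inr θ)
    (hΦ.differentiableAt_of_isOpen
      (hK.prod (isOpen_extChartAt_target p)) ⟨hθ, mem_extChartAt_target p⟩) i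

lemma covHessAt_eq {V : Type*} [NormedAddCommGroup V] [NormedSpace ℝ V] {φ : M → V}
    {Φ : T × EuclideanSpace ℝ (Fin n) → V}
    (hΦ : ContDiffOn ℝ ∞ Φ (K ×ˢ (extChartAt (𝓡 n) p).target))
    (hφ : ∀ y ∈ (extChartAt (𝓡 n) p).target, Φ (θ, y) = inCoords φ p y) (i j : Fin n) :
    covHessAt (x θ) φ p i j =
      frameCovHess (coordDir T n) (familyInCoords x p) Φ (θ, extChartAt (𝓡 n) p p) i j := by
  rw [covHessAt, coordCovHess_congr (eventuallyEq_inCoords hφ)]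
  exact coordCovHess_slice (x := familyInCoords x p) (φ := Φ) (hasFDerivAt_prodMk_inr θ)
    (hK.prod (isOpen_extChartAt_target p)) ⟨hθ, mem_extChartAt_target p⟩
    (contDiffOn_familyInCoords hx p) hΦ i j

lemma laplaceBeltrami_eq {φ : M → ℝ} {Φ : T × EuclideanSpace ℝ (Fin n) → ℝ}
    (hΦ : ContDiffOn ℝ ∞ Φ (K ×ˢ (extChartAt (𝓡 n) p).target))
    (hφ : ∀ y ∈ (extChartAt (𝓡 n) p).target, Φ (θ, y) = inCoords φ p y) :
    laplaceBeltrami (x θ) φ p =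
      frameLaplacian (coordDir T n) (familyInCoords x p) Φ (θ, extChartAt (𝓡 n) p p) := by
  simp only [laplaceBeltrami, frameLaplacian, metricInvAt_eq hK hx hθ,
    covHessAt_eq hK hx hθ p hΦ hφ, smul_eq_mul]

lemma secondFFAt_eq (i j : Fin n) :
    secondFFAt (x θ) (ν θ) p i j = frameSecondFF (coordDir T n) (familyInCoords x p)
      (familyInCoords ν p) (θ, extChartAt (𝓡 n) p p) i j := by
  have h := coordSecondFF_slice (x := familyInCoords x p) (ν := familyInCoords ν p)
    (hasFDerivAt_prodMk_inr θ) (hK.prod (isOpen_extChartAt_target p))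
    ⟨hθ, mem_extChartAt_target p⟩ (contDiffOn_familyInCoords hx p) i j
  simp only [familyInCoords, extChartAt_to_inv] at h
  exact h

lemma normSqSecondFF_eq : normSqSecondFF (x θ) (ν θ) p =
    frameNormSq (coordDir T n) (familyInCoords x p) (familyInCoords ν p)
      (θ, extChartAt (𝓡 n) p p) := by
  simp only [normSqSecondFF, frameNormSq, metricInvAt_eq hK hx hθ,
    secondFFAt_eq (ν := ν) hK hx hθ]

lemma meanCurvature_eq (hxν : IsUnitNormal (x θ) (ν θ)) {y : EuclideanSpace ℝ (Fin n)}
    (hy : y ∈ (extChartAt (𝓡 n) p).target) :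
    meanCurvature (x θ) (ν θ) ((extChartAt (𝓡 n) p).symm y) =
      frameMeanCurvature (coordDir T n) (familyInCoords x p) (familyInCoords ν p) (θ, y) := by
  have hU := hK.prod (isOpen_extChartAt_target (I := 𝓡 n) p)
  have hxU := contDiffOn_familyInCoords hx p
  rw [meanCurvature_eq_of_mem_source (contMDiff_slice hx hθ) hxν
    ((extChartAt (𝓡 n) p).map_target hy), (extChartAt (𝓡 n) p).right_inv hy, frameMeanCurvature]
  refine Finset.sum_congr rfl fun i _ => Finset.sum_congr rfl fun j _ => ?_
  congr 1
  · exact congrFun (congrFun (coordMetricInv_slice (x := familyInCoords x p)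
      (hasFDerivAt_prodMk_inr θ) (hxU.differentiableAt_of_isOpen hU ⟨hθ, hy⟩)) i) j
  · exact coordSecondFF_slice (x := familyInCoords x p) (ν := familyInCoords ν p)
      (hasFDerivAt_prodMk_inr θ) hU ⟨hθ, hy⟩ hxU i j

end Geometry

end Families

/-! ### The linearized equation -/

section Linearized

lemma DifferentiableAt.hasDerivAt_comp_curve {Z V : Type*} [NormedAddCommGroup Z] [NormedSpace ℝ Z]
    [NormedAddCommGroup V] [NormedSpace ℝ V] {f : Z → V} {γ : ℝ → Z} {r : ℝ} {v : Z}
    (hf : DifferentiableAt ℝ f (γ r)) (hγ : HasDerivAt γ v r) :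
    HasDerivAt (fun s => f (γ s)) (dirDeriv v f (γ r)) r :=
  hf.hasFDerivAt.comp_hasDerivAt r hγ

variable {n : ℕ} {M : Type*} [TopologicalSpace M] [ChartedSpace (EuclideanSpace ℝ (Fin n)) M]

lemma contMDiffOn_uncurry_parameters {V : Type*} [NormedAddCommGroup V] [NormedSpace ℝ V]
    {J I : Set ℝ} {f : ℝ → ℝ → M → V}
    (hf : ContMDiffOn (𝓘(ℝ, ℝ).prod (𝓘(ℝ, ℝ).prod (𝓡 n))) 𝓘(ℝ, V) ∞
      (fun q : ℝ × ℝ × M => f q.1 q.2.1 q.2.2) (J ×ˢ I ×ˢ (univ : Set M))) :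
    ContMDiffOn (𝓘(ℝ, ℝ × ℝ).prod (𝓡 n)) 𝓘(ℝ, V) ∞
      (fun q : (ℝ × ℝ) × M => f q.1.1 q.1.2 q.2) ((J ×ˢ I) ×ˢ (univ : Set M)) := by
  have h1 : ContMDiff (𝓘(ℝ, ℝ × ℝ).prod (𝓡 n)) 𝓘(ℝ, ℝ) ∞ (fun q : (ℝ × ℝ) × M => q.1.1) :=
    (contDiff_fst.contMDiff (f := (Prod.fst : ℝ × ℝ → ℝ))).comp contMDiff_fst
  have h2 : ContMDiff (𝓘(ℝ, ℝ × ℝ).prod (𝓡 n)) 𝓘(ℝ, ℝ) ∞ (fun q : (ℝ × ℝ) × M => q.1.2) :=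
    (contDiff_snd.contMDiff (f := (Prod.snd : ℝ × ℝ → ℝ))).comp contMDiff_fst
  exact hf.comp (h1.prodMk (h2.prodMk contMDiff_snd)).contMDiffOn
    fun q hq => ⟨hq.1.1, hq.1.2, hq.2⟩

variable [IsManifold (𝓡 n) ∞ M]

theorem IsRescaledMCFVariation.hasDerivAt_normalVariation {J I : Set ℝ}
    {x ν : ℝ → ℝ → M → EuclideanSpace ℝ (Fin (n + 1))} (hJ : IsOpen J) (h0 : (0 : ℝ) ∈ J)
    (hI : IsOpen I) (h : IsRescaledMCFVariation J I x ν) {t : ℝ} (ht : t ∈ I) (p : M) :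
    HasDerivAt (fun τ => normalVariation x ν τ p)
      (laplaceBeltrami (x 0 t) (normalVariation x ν t) p
        + normSqSecondFF (x 0 t) (ν 0 t) p * normalVariation x ν t p
        + normalVariation x ν t p) t := by
  set X : ℝ × ℝ → M → EuclideanSpace ℝ (Fin (n + 1)) := fun θ => x θ.1 θ.2
  set N : ℝ × ℝ → M → EuclideanSpace ℝ (Fin (n + 1)) := fun θ => ν θ.1 θ.2
  have hK : IsOpen (J ×ˢ I) := hJ.prod hI
  have hX := contMDiffOn_uncurry_parameters h.smooth
  have hN := contMDiffOn_uncurry_parameters h.smooth_normal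
  have hF := hypersurfaceFrame_familyInCoords (x := X) (ν := N) hK hX hN
    (fun θ hθ => h.isUnitNormal θ.1 hθ.1 θ.2 hθ.2) p
  set χ := extChartAt (𝓡 n) p
  set U := (J ×ˢ I) ×ˢ χ.target
  set σ : (ℝ × ℝ) × EuclideanSpace ℝ (Fin n) := ((1, 0), 0)
  set τ : (ℝ × ℝ) × EuclideanSpace ℝ (Fin n) := ((0, 1), 0)
  have hσ : ∀ s t y, HasDerivAt (fun s : ℝ => (((s, t), y) : (ℝ × ℝ) × EuclideanSpace ℝ (Fin n)))
      σ s := fun s t y =>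
    ((hasDerivAt_id s).prodMk (hasDerivAt_const s t)).prodMk (hasDerivAt_const s y)
  have hτ : ∀ s t y, HasDerivAt (fun t : ℝ => (((s, t), y) : (ℝ × ℝ) × EuclideanSpace ℝ (Fin n)))
      τ t := fun s t y =>
    ((hasDerivAt_const t s).prodMk (hasDerivAt_id t)).prodMk (hasDerivAt_const t y)
  have hdX : ∀ z ∈ U, DifferentiableAt ℝ (familyInCoords X p) z := fun z hz =>
    hF.differentiableAt hz
  have hderivσ : ∀ t ∈ I, ∀ y ∈ χ.target, deriv (fun s => x s t (χ.symm y)) 0 =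
      dirDeriv σ (familyInCoords X p) ((0, t), y) := fun t ht y hy =>
    ((hdX ((0, t), y) ⟨⟨h0, ht⟩, hy⟩).hasDerivAt_comp_curve (hσ 0 t y)).deriv
  have hderivτ : ∀ s ∈ J, ∀ t ∈ I, ∀ y ∈ χ.target, HasDerivAt (fun t => x s t (χ.symm y))
      (dirDeriv τ (familyInCoords X p) ((s, t), y)) t := fun s hs t ht y hy =>
    (hdX ((s, t), y) ⟨⟨hs, ht⟩, hy⟩).hasDerivAt_comp_curve (hτ s t y)
  have hflow : ∀ z ∈ U, inner ℝ (dirDeriv τ (familyInCoords X p) z) (familyInCoords N p z) =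
      - frameMeanCurvature (coordDir (ℝ × ℝ) n) (familyInCoords X p) (familyInCoords N p) z +
        inner ℝ (familyInCoords X p z) (familyInCoords N p z) := by
    rintro ⟨⟨s, t⟩, y⟩ ⟨⟨hs, ht⟩, hy⟩
    have h1 := h.normal_flow s hs t ht (χ.symm y)
    rwa [(hderivτ s hs t ht y hy).deriv,
      meanCurvature_eq (x := X) (ν := N) hK hX (θ := (s, t)) ⟨hs, ht⟩ p
        (h.isUnitNormal s hs t ht) hy] at h1
  have hp : χ p ∈ χ.target := mem_extChartAt_target p
  have hpp : χ.symm (χ p) = p := extChartAt_to_inv p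
  set z : (ℝ × ℝ) × EuclideanSpace ℝ (Fin n) := ((0, t), χ p)
  have hz : z ∈ U := ⟨⟨h0, ht⟩, hp⟩
  have hz' : dirDeriv τ (familyInCoords X p) z =
      - (frameMeanCurvature (coordDir (ℝ × ℝ) n) (familyInCoords X p) (familyInCoords N p) z •
        familyInCoords N p z) + familyInCoords X p z := by
    have h1 := h.flow t ht (χ.symm (χ p))
    rw [meanCurvature_eq (x := X) (ν := N) hK hX (θ := (0, t)) ⟨h0, ht⟩ p
        (h.isUnitNormal 0 h0 t ht) hp] at h1
    exact (hderivτ 0 h0 t ht _ hp).unique h1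
  set Φ : (ℝ × ℝ) × EuclideanSpace ℝ (Fin n) → ℝ :=
    fun z => inner ℝ (dirDeriv σ (familyInCoords X p) z) (familyInCoords N p z)
  have hΦ : ContDiffOn ℝ ∞ Φ U := (hF.smooth.dirDeriv hF.isOpen σ).inner ℝ hF.smooth_normal
  have hw : ∀ t ∈ I, ∀ y ∈ χ.target, Φ ((0, t), y) = inCoords (normalVariation x ν t) p y := by
    intro t ht y hy
    change _ = normalVariation x ν t (χ.symm y)
    rw [normalVariation, hderivσ t ht y hy]
    rfl
  have hwp : ∀ t ∈ I, normalVariation x ν t p = Φ ((0, t), χ p) := by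
    intro t ht
    rw [hw t ht _ hp]
    change _ = normalVariation x ν t (χ.symm (χ p))
    rw [hpp]
  have hlap : laplaceBeltrami (x 0 t) (normalVariation x ν t) p =
      frameLaplacian (coordDir (ℝ × ℝ) n) (familyInCoords X p) Φ z :=
    laplaceBeltrami_eq (x := X) hK hX (θ := (0, t)) ⟨h0, ht⟩ p hΦ (hw t ht)
  have hnsq : normSqSecondFF (x 0 t) (ν 0 t) p =
      frameNormSq (coordDir (ℝ × ℝ) n) (familyInCoords X p) (familyInCoords N p) z :=
    normSqSecondFF_eq (x := X) (ν := N) hK hX (θ := (0, t)) ⟨h0, ht⟩ p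
  have hmain := hF.dirDeriv_normal_variation hz hflow hz' (σ := σ)
  rw [hlap, hnsq, hwp t ht, ← hmain]
  refine HasDerivAt.congr_of_eventuallyEq
    ((hΦ.differentiableAt_of_isOpen hF.isOpen hz).hasDerivAt_comp_curve (hτ 0 t (χ p))) ?_
  filter_upwards [hI.mem_nhds ht] with t' ht'
  exact hwp t' ht'

end Linearized

/-! ### The sphere as a stationary solution -/

section Sphere

namespace HypersurfaceFrame

variable {n : ℕ} {Z : Type*} [NormedAddCommGroup Z] [NormedSpace ℝ Z]
  {U : Set Z} {e : Fin n → Z} {x ν : Z → EuclideanSpace ℝ (Fin (n + 1))} {z : Z}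
  (h : HypersurfaceFrame U e x ν) (hz : z ∈ U)
include h hz

/-- The trace `gⁱʲ gᵢⱼ`. -/
lemma sum_metricInv_mul_metric : ∑ i, ∑ j, frameMetricInv e x z i j *
    inner ℝ (dirDeriv (e i) x z) (dirDeriv (e j) x z) = (n : ℝ) := by
  have hd : ∀ i, ∑ j, frameMetricInv e x z i j *
      inner ℝ (dirDeriv (e i) x z) (dirDeriv (e j) x z) = (1 : ℝ) := by
    intro i
    rw [← inner_frameDual, frameDual, inner_dualFrame (h.linearIndependent z hz), if_pos rfl]
  simp [hd]

variable {c : ℝ} (hc : ∀ z ∈ U, x z = c • ν z)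
include hc

lemma secondFF_of_eq_smul (i j : Fin n) : c * frameSecondFF e x ν z i j =
    inner ℝ (dirDeriv (e i) x z) (dirDeriv (e j) x z) := by
  have h1 : dirDeriv (e i) x z = c • dirDeriv (e i) ν z := by
    rw [dirDeriv_congr h.isOpen hz hc]
    simp only [dirDeriv]
    rw [fderiv_fun_const_smul (h.differentiableAt_normal hz)]
    rfl
  rw [h.secondFF_eq hz, h1, inner_smul_left]
  rfl

lemma meanCurvature_of_eq_smul : c * frameMeanCurvature e x ν z = n := by
  rw [← h.sum_metricInv_mul_metric hz, frameMeanCurvature, Finset.mul_sum]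
  refine Finset.sum_congr rfl fun i _ => ?_
  rw [Finset.mul_sum]
  refine Finset.sum_congr rfl fun j _ => ?_
  rw [← h.secondFF_of_eq_smul hz hc]; ring

lemma normSq_of_eq_smul : c ^ 2 * frameNormSq e x ν z = n := by
  have h1 : ∀ i j, c ^ 2 * (inner ℝ (dirDeriv (e i) ν z) (dirDeriv (e j) ν z) : ℝ) =
      inner ℝ (dirDeriv (e i) x z) (dirDeriv (e j) x z) := by
    intro i j
    have h1 : ∀ i, dirDeriv (e i) x z = c • dirDeriv (e i) ν z := by
      intro i
      rw [dirDeriv_congr h.isOpen hz hc]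
      simp only [dirDeriv]
      rw [fderiv_fun_const_smul (h.differentiableAt_normal hz)]
      rfl
    rw [h1, h1, inner_smul_left, inner_smul_right]
    simp only [RCLike.conj_to_real]; ring
  rw [h.normSq_eq hz, ← h.sum_metricInv_mul_metric hz, Finset.mul_sum]
  refine Finset.sum_congr rfl fun i _ => ?_
  rw [Finset.mul_sum]
  refine Finset.sum_congr rfl fun j _ => ?_
  rw [← h1]; ring

end HypersurfaceFrame

variable {n : ℕ}

lemma fact_finrank_euclideanSpace (n : ℕ) :
    Fact (Module.finrank ℝ (EuclideanSpace ℝ (Fin (n + 1))) = n + 1) :=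
  ⟨finrank_euclideanSpace_fin⟩

lemma contMDiff_coe_usphere : ContMDiff (𝓡 n) 𝓘(ℝ, EuclideanSpace ℝ (Fin (n + 1))) ∞
    (fun p : USphere n => (p : EuclideanSpace ℝ (Fin (n + 1)))) :=
  have := fact_finrank_euclideanSpace n
  contMDiff_coe_sphere

lemma contMDiff_sphereEmb : ContMDiff (𝓡 n) 𝓘(ℝ, EuclideanSpace ℝ (Fin (n + 1))) ∞
    (sphereEmb n) :=
  (contDiff_const_smul (Real.sqrt n)).contMDiff.comp contMDiff_coe_usphere

lemma isUnitNormal_sphereEmb (hn : 1 ≤ n) :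
    IsUnitNormal (sphereEmb n) (fun p => (p : EuclideanSpace ℝ (Fin (n + 1)))) := by
  have := fact_finrank_euclideanSpace n
  have hs : Real.sqrt n ≠ 0 := (Real.sqrt_pos.2 (by exact_mod_cast hn)).ne'
  have hd : ∀ (p : USphere n) (v : TangentSpace (𝓡 n) p),
      (mfderiv (𝓡 n) 𝓘(ℝ, EuclideanSpace ℝ (Fin (n + 1))) (sphereEmb n) p v :
        EuclideanSpace ℝ (Fin (n + 1))) = Real.sqrt n •
      (mfderiv (𝓡 n) 𝓘(ℝ, EuclideanSpace ℝ (Fin (n + 1)))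
        (fun q : USphere n => (q : EuclideanSpace ℝ (Fin (n + 1)))) p v :
          EuclideanSpace ℝ (Fin (n + 1))) := by
    intro p v
    have hco : MDifferentiableAt (𝓡 n) 𝓘(ℝ, EuclideanSpace ℝ (Fin (n + 1)))
        (fun q : USphere n => (q : EuclideanSpace ℝ (Fin (n + 1)))) p :=
      contMDiff_coe_usphere.mdifferentiableAt (by simp)
    have := const_smul_mfderiv hco (Real.sqrt n)
    exact congrArg (fun A => A v) this
  refine ⟨fun p v w hvw => ?_, fun p => by simp, fun p v => ?_⟩
  · rw [hd, hd] at hvw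
    exact injective_mvfderiv_subtypeVal_sphere p (smul_right_injective _ hs hvw)
  · have h1 := range_mvfderiv_subtypeVal (n := n) p
    have h2 : (mfderiv (𝓡 n) 𝓘(ℝ, EuclideanSpace ℝ (Fin (n + 1)))
        (fun q : USphere n => (q : EuclideanSpace ℝ (Fin (n + 1)))) p v :
          EuclideanSpace ℝ (Fin (n + 1))) ∈
        (Submodule.span ℝ {(p : EuclideanSpace ℝ (Fin (n + 1)))})ᗮ := by
      rw [← h1]; exact ⟨v, rfl⟩
    refine Submodule.mem_orthogonal_singleton_iff_inner_right.1 ?_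
    rw [hd]
    exact Submodule.smul_mem _ _ h2

lemma contMDiffOn_static {M V : Type*} [TopologicalSpace M]
    [ChartedSpace (EuclideanSpace ℝ (Fin n)) M] [NormedAddCommGroup V] [NormedSpace ℝ V]
    {f : M → V} (hf : ContMDiff (𝓡 n) 𝓘(ℝ, V) ∞ f) (K : Set ℝ) :
    ContMDiffOn (𝓘(ℝ, ℝ).prod (𝓡 n)) 𝓘(ℝ, V) ∞ (fun q : ℝ × M => (fun _ : ℝ => f) q.1 q.2)
      (K ×ˢ (univ : Set M)) :=
  (hf.comp contMDiff_snd).contMDiffOn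

/-- The sphere of radius `√n` with its outer normal, as a static family in a chart. -/
lemma hypersurfaceFrame_sphere (hn : 1 ≤ n) {K : Set ℝ} (hK : IsOpen K) (p : USphere n) :
    HypersurfaceFrame (K ×ˢ (extChartAt (𝓡 n) p).target) (coordDir ℝ n)
      (familyInCoords (fun _ => sphereEmb n) p)
      (familyInCoords (fun _ (q : USphere n) => (q : EuclideanSpace ℝ (Fin (n + 1)))) p) :=
  hypersurfaceFrame_familyInCoords hK (contMDiffOn_static contMDiff_sphereEmb K)
    (contMDiffOn_static contMDiff_coe_usphere K) (fun _ _ => isUnitNormal_sphereEmb hn) p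

lemma meanCurvature_sphereEmb (hn : 1 ≤ n) (p : USphere n) :
    meanCurvature (sphereEmb n) (fun q => (q : EuclideanSpace ℝ (Fin (n + 1)))) p =
      Real.sqrt n := by
  have hs : 0 < Real.sqrt n := Real.sqrt_pos.2 (by exact_mod_cast hn)
  have hp := mem_extChartAt_target (I := 𝓡 n) p
  have h1 := meanCurvature_eq (x := fun _ => sphereEmb n)
    (ν := fun _ (q : USphere n) => (q : EuclideanSpace ℝ (Fin (n + 1)))) isOpen_univ
    (contMDiffOn_static contMDiff_sphereEmb univ) (mem_univ (0 : ℝ)) p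
    (isUnitNormal_sphereEmb hn) hp
  rw [extChartAt_to_inv] at h1
  have h2 := (hypersurfaceFrame_sphere hn isOpen_univ p).meanCurvature_of_eq_smul
    (z := (0, extChartAt (𝓡 n) p p)) ⟨mem_univ _, hp⟩ (c := Real.sqrt n) fun z _ => rfl
  rw [h1]
  have h3 : Real.sqrt n * Real.sqrt n = n := Real.mul_self_sqrt (Nat.cast_nonneg n)
  exact mul_left_cancel₀ hs.ne' (h2.trans h3.symm)

lemma isRescaledMCF_sphereEmb (hn : 1 ≤ n) :
    IsRescaledMCF univ (fun _ => sphereEmb n)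
      (fun _ p => (p : EuclideanSpace ℝ (Fin (n + 1)))) := by
  intro t _ p
  have h : -(meanCurvature (sphereEmb n) (fun q => (q : EuclideanSpace ℝ (Fin (n + 1)))) p •
      (p : EuclideanSpace ℝ (Fin (n + 1)))) + sphereEmb n p = 0 := by
    rw [meanCurvature_sphereEmb hn]; exact neg_add_cancel _
  rw [h]
  exact hasDerivAt_const t _

lemma IsUnitNormal.eq_smul_of_sphereEmb (hn : 1 ≤ n)
    {ν : USphere n → EuclideanSpace ℝ (Fin (n + 1))} (hν : IsUnitNormal (sphereEmb n) ν)
    (p : USphere n) : ∃ c : ℝ, c ^ 2 = 1 ∧ ν p = c • (p : EuclideanSpace ℝ (Fin (n + 1))) := by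
  have hp := mem_extChartAt_target (I := 𝓡 n) p
  have hF := hypersurfaceFrame_sphere hn isOpen_univ p
  have hz : ((0 : ℝ), extChartAt (𝓡 n) p p) ∈ (univ : Set ℝ) ×ˢ (extChartAt (𝓡 n) p).target :=
    ⟨mem_univ _, hp⟩
  have hdual : ∀ i, inner ℝ (ν p) (frameDual (coordDir ℝ n)
      (familyInCoords (fun _ => sphereEmb n) p) (0, extChartAt (𝓡 n) p p) i) = (0 : ℝ) := by
    intro i
    rw [inner_frameDual]
    refine Finset.sum_eq_zero fun j _ => ?_
    have h1 := hν.inner_fderiv_inCoords contMDiff_sphereEmb hp (EuclideanSpace.single j 1)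
    rw [extChartAt_to_inv] at h1
    have h2 := pderiv_slice (hasFDerivAt_prodMk_inr (0 : ℝ)) (hF.differentiableAt hz) j
    exact mul_eq_zero_of_right _ ((congrArg (inner ℝ (ν p)) h2.symm).trans h1)
  have hsplit := eq_normal_add_tangent (hF.linearIndependent _ hz) (hF.unit _ hz) (hF.normal _ hz)
    (ν p)
  have hN : familyInCoords (fun (_ : ℝ) (q : USphere n) => (q : EuclideanSpace ℝ (Fin (n + 1)))) p
      (0, extChartAt (𝓡 n) p p) = p := by
    simp only [familyInCoords, extChartAt_to_inv]
  simp only [frameDual] at hdual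
  rw [hN] at hsplit
  simp only [hdual, zero_smul, Finset.sum_const_zero, add_zero] at hsplit
  refine ⟨_, ?_, hsplit⟩
  have hu := hν.unit p
  rw [hsplit, norm_smul, norm_eq_of_mem_sphere, mul_one] at hu
  rw [← sq_abs, ← Real.norm_eq_abs, hu, one_pow]

lemma normSqSecondFF_sphereEmb (hn : 1 ≤ n)
    {ν : USphere n → EuclideanSpace ℝ (Fin (n + 1))} (hν : IsUnitNormal (sphereEmb n) ν)
    (p : USphere n) : normSqSecondFF (sphereEmb n) ν p = 1 := by
  have hn0 : (n : ℝ) ≠ 0 := by positivity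
  have hp := mem_extChartAt_target (I := 𝓡 n) p
  have h1 := normSqSecondFF_eq (x := fun _ => sphereEmb n)
    (ν := fun _ (q : USphere n) => (q : EuclideanSpace ℝ (Fin (n + 1)))) isOpen_univ
    (contMDiffOn_static contMDiff_sphereEmb univ) (mem_univ (0 : ℝ)) p
  have h2 := (hypersurfaceFrame_sphere hn isOpen_univ p).normSq_of_eq_smul
    (z := (0, extChartAt (𝓡 n) p p)) ⟨mem_univ _, hp⟩ (c := Real.sqrt n) fun z _ => rfl
  rw [← h1, Real.sq_sqrt (Nat.cast_nonneg n)] at h2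
  obtain ⟨c, hc, hcν⟩ := hν.eq_smul_of_sphereEmb hn p
  have h3 : ∀ i j, secondFFAt (sphereEmb n) ν p i j =
      c * secondFFAt (sphereEmb n) (fun q => (q : EuclideanSpace ℝ (Fin (n + 1)))) p i j := by
    intro i j
    simp only [secondFFAt, coordSecondFF, hcν, inner_smul_left, RCLike.conj_to_real]
    ring
  have h4 : normSqSecondFF (sphereEmb n) ν p = c ^ 2 *
      normSqSecondFF (sphereEmb n) (fun q => (q : EuclideanSpace ℝ (Fin (n + 1)))) p := by
    simp only [normSqSecondFF, Finset.mul_sum, h3]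
    refine Finset.sum_congr rfl fun i _ => Finset.sum_congr rfl fun j _ =>
      Finset.sum_congr rfl fun k _ => Finset.sum_congr rfl fun l _ => ?_
    ring
  rw [h4, hc, one_mul]
  exact mul_left_cancel₀ hn0 (h2.trans (mul_one _).symm)

end Sphere

/-! ### The nonlinear terms as functions of the jet -/

section Jets

/-- The ambient space `ℝⁿ⁺¹`. -/
abbrev Ambient (n : ℕ) : Type := EuclideanSpace ℝ (Fin (n + 1))

variable {n : ℕ}

/-- The standard basis of `ℝⁿ⁺¹`. -/
noncomputable abbrev ambientBasis (α : Fin (n + 1)) : Ambient n := EuclideanSpace.single α 1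

/-- The inner product of `ℝⁿ⁺¹` as a bilinear map. -/
noncomputable def ambientInner (n : ℕ) : Ambient n →L[ℝ] Ambient n →L[ℝ] ℝ := innerSL ℝ

/-- The projection `a ↦ a - ⟨p, a⟩ p` to the tangent space of the sphere at the unit vector `p`. -/
noncomputable def tangentProj (p : Ambient n) : Ambient n →L[ℝ] Ambient n :=
  1 - (innerSL ℝ p).smulRight p

/-- The differential `1 + ∇u` of `x = x_{Sⁿ} + u`. -/
noncomputable def jetDiff (q : Ambient n × PairJet n) : Ambient n →L[ℝ] Ambient n :=
  1 + q.2.1.2.1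

/-- The metric induced by `x` on the tangent space of the sphere, extended by the identity in the
normal direction `p` so as to be invertible on the ambient space. -/
noncomputable def jetMetric (q : Ambient n × PairJet n) : Ambient n →L[ℝ] Ambient n :=
  tangentProj q.1 * (ContinuousLinearMap.adjoint (jetDiff q) * jetDiff q) * tangentProj q.1 +
    (1 - tangentProj q.1)

/-- The inverse metric `gⁱʲ yᵢ ⊗ yⱼ`, where `yᵢ` is a frame of the tangent space of the sphere. -/
noncomputable def jetMetricInv (q : Ambient n × PairJet n) : Ambient n →L[ℝ] Ambient n :=
  tangentProj q.1 * Ring.inverse (jetMetric q) * tangentProj q.1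

/-- The map `a ↦ gⁱʲ ⟨∂ᵢx, a⟩ yⱼ`: the tangential part of `a` along `x`, pulled back to the
sphere. -/
noncomputable def jetPullback (q : Ambient n × PairJet n) : Ambient n →L[ℝ] Ambient n :=
  jetMetricInv q * ContinuousLinearMap.adjoint (jetDiff q)

/-- The component of `p` normal to `x`. -/
noncomputable def jetNormalVec (q : Ambient n × PairJet n) : Ambient n :=
  q.1 - jetDiff q (jetPullback q q.1)

/-- The outer unit normal of `x`. -/
noncomputable def jetNormal (q : Ambient n × PairJet n) : Ambient n :=
  ‖jetNormalVec q‖⁻¹ • jetNormalVec q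

/-- The second covariant derivative of `x = x_{Sⁿ} + u` on the sphere of radius `√n`. -/
noncomputable def jetHess (q : Ambient n × PairJet n) :
    Ambient n →L[ℝ] Ambient n →L[ℝ] Ambient n :=
  q.2.1.2.2 - (Real.sqrt n)⁻¹ •
    ((ContinuousLinearMap.smulRightL ℝ (Ambient n) (Ambient n)).flip q.1).comp (ambientInner n)

/-- The trace `gⁱʲ ∇ᵢ∇ⱼ x`, with the covariant derivatives of the sphere. -/
noncomputable def jetTraceHess (q : Ambient n × PairJet n) : Ambient n :=
  ∑ α, jetHess q (ambientBasis α) (jetMetricInv q (ambientBasis α))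

/-- `Δw`, for the metric induced by `x`; the second term accounts for the difference of the
Christoffel symbols of this metric and of that of the sphere. -/
noncomputable def jetLaplacian (q : Ambient n × PairJet n) : ℝ :=
  ∑ α, q.2.2.2.2 (ambientBasis α) (jetMetricInv q (ambientBasis α)) -
    q.2.2.2.1 (jetPullback q (jetTraceHess q))

/-- `|A|²`: the norm of `⟨ν, ∇ᵢ∇ⱼ x⟩`, as the second fundamental form does not depend on the
connection used in the second derivative. -/
noncomputable def jetNormSq (q : Ambient n × PairJet n) : ℝ :=
  ∑ α, ∑ β, inner ℝ (jetNormal q) (jetHess q (ambientBasis α) (ambientBasis β)) *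
    inner ℝ (jetNormal q)
      (jetHess q (jetMetricInv q (ambientBasis α)) (jetMetricInv q (ambientBasis β)))

/-- The trace `gⁱʲ ⟨yᵢ, yⱼ⟩` of the metric of the sphere with respect to that of `x`. -/
noncomputable def jetTrace (q : Ambient n × PairJet n) : ℝ :=
  ∑ α, inner ℝ (ambientBasis α) (jetMetricInv q (ambientBasis α))

/-- `⟨x_{Sⁿ} + Δ x_{Sⁿ}, ν⟩`, for the metric induced by `x`. -/
noncomputable def jetBase (q : Ambient n × PairJet n) : ℝ :=
  (Real.sqrt n - (Real.sqrt n)⁻¹ * jetTrace q) * inner ℝ q.1 (jetNormal q) -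
    inner ℝ (jetPullback q (jetTraceHess q)) (jetNormal q)

/-- `-gⁱʲ ⟨∂ᵢu, ∂ⱼν⟩`. -/
noncomputable def jetCross (q : Ambient n × PairJet n) : ℝ :=
  ∑ α, inner ℝ (jetNormal q) (jetHess q (jetMetricInv q (ambientBasis α))
    (jetPullback q (q.2.1.2.1 (ambientBasis α))))

/-- The contribution `-gⁱʲ ⟨u, ∂ᵢx⟩ ⟨∂ₜx - x, ∂ⱼν⟩` of the tangential velocity of a radial graph. -/
noncomputable def jetRadial (q : Ambient n × PairJet n) : ℝ :=
  inner ℝ (jetNormal q) (jetHess q (jetPullback q q.2.1.1) (jetPullback q q.1)) *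
    (inner ℝ (jetNormal q) (jetTraceHess q) / inner ℝ q.1 (jetNormal q))

/-- `Δw` on the sphere. -/
noncomputable def jetSphereLaplacian (q : Ambient n × PairJet n) : ℝ :=
  ∑ α, q.2.2.2.2 (ambientBasis α) (tangentProj q.1 (ambientBasis α))

/-- The nonlinear part of the equation of `w` for solutions of the rescaled flow. -/
noncomputable def flowTerm (q : Ambient n × PairJet n) : ℝ :=
  jetLaplacian q - jetSphereLaplacian q + (jetNormSq q - 1) * q.2.2.1 + jetBase q + 2 * jetCross q

/-- The nonlinear part of the equation of `w` for radial graphs. -/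
noncomputable def radialTerm (q : Ambient n × PairJet n) : ℝ := flowTerm q - jetRadial q

/-- The points and jets at which the nonlinear terms are smooth: the inverse metric, the
normalization of the normal and the division in `jetRadial` are meaningful. -/
def jetDomain (n : ℕ) : Set (Ambient n × PairJet n) :=
  {q | IsUnit (jetMetric q) ∧ jetNormalVec q ≠ 0 ∧ inner ℝ q.1 (jetNormal q) ≠ (0 : ℝ)}

lemma tangentProj_apply (p a : Ambient n) :
    tangentProj p a = a - (inner ℝ p a : ℝ) • p := rfl

lemma jetHess_apply (q : Ambient n × PairJet n) (v w : Ambient n) :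
    jetHess q v w = q.2.1.2.2 v w - ((Real.sqrt n)⁻¹ * inner ℝ v w) • q.1 := by
  simp only [jetHess, sub_apply, smul_apply, mul_smul]
  rfl

/-! ### Smoothness of the nonlinear terms -/

section Smooth

variable {q : Ambient n × PairJet n}

lemma contDiff_tangentProj : ContDiff ℝ ∞ fun q : Ambient n × PairJet n => tangentProj q.1 := by
  have h : (fun q : Ambient n × PairJet n => tangentProj q.1) = fun q =>
      1 - ContinuousLinearMap.smulRightL ℝ (Ambient n) (Ambient n) (ambientInner n q.1) q.1 := rfl
  rw [h]
  exact contDiff_const.sub ((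
    (ContinuousLinearMap.smulRightL ℝ (Ambient n) (Ambient n)).contDiff.comp
    ((ambientInner n).contDiff.comp contDiff_fst)).clm_apply contDiff_fst)

lemma contDiff_jetDiff : ContDiff ℝ ∞ (jetDiff (n := n)) := by
  unfold jetDiff
  fun_prop

lemma contDiff_adjoint_jetDiff :
    ContDiff ℝ ∞ fun q : Ambient n × PairJet n => ContinuousLinearMap.adjoint (jetDiff q) :=
  (ContinuousLinearMap.adjoint (𝕜 := ℝ) (E := Ambient n)
    (F := Ambient n)).toContinuousLinearEquiv.contDiff.comp contDiff_jetDiff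

lemma ContDiffAt.clm_mul {Y V : Type*} [NormedAddCommGroup Y] [NormedSpace ℝ Y]
    [NormedAddCommGroup V] [NormedSpace ℝ V] {f g : Y → V →L[ℝ] V} {y : Y}
    (hf : ContDiffAt ℝ ∞ f y) (hg : ContDiffAt ℝ ∞ g y) :
    ContDiffAt ℝ ∞ (fun y => f y * g y) y := hf.clm_comp hg

lemma contDiffAt_jetMetric : ContDiffAt ℝ ∞ (jetMetric (n := n)) q := by
  have h1 := (contDiff_tangentProj (n := n)).contDiffAt (x := q)
  have h2 := (contDiff_jetDiff (n := n)).contDiffAt (x := q)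
  have h3 := (contDiff_adjoint_jetDiff (n := n)).contDiffAt (x := q)
  exact ((h1.clm_mul (h3.clm_mul h2)).clm_mul h1).add (contDiffAt_const.sub h1)

lemma contDiff_jetHess : ContDiff ℝ ∞ (jetHess (n := n)) := by
  have hB : ContDiff ℝ ∞ (fun q : Ambient n × PairJet n => q.2.1.2.2) := by fun_prop
  exact hB.sub (ContDiff.const_smul _
    (((ContinuousLinearMap.contDiff _).comp contDiff_fst).clm_comp contDiff_const))

lemma contDiffAt_jetHess_apply {v w : Ambient n × PairJet n → Ambient n}
    (hv : ContDiffAt ℝ ∞ v q) (hw : ContDiffAt ℝ ∞ w q) :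
    ContDiffAt ℝ ∞ (fun q => jetHess q (v q) (w q)) q :=
  (contDiff_jetHess.contDiffAt.clm_apply hv).clm_apply hw

section

variable (hG : IsUnit (jetMetric q))
include hG

lemma contDiffAt_inverse_jetMetric :
    ContDiffAt ℝ ∞ (fun q : Ambient n × PairJet n => Ring.inverse (jetMetric q)) q := by
  obtain ⟨G, hG⟩ := hG
  have h : ContDiffAt ℝ ∞ Ring.inverse (jetMetric q) := hG ▸ contDiffAt_ringInverse ℝ G
  exact h.comp q contDiffAt_jetMetric

lemma contDiffAt_jetMetricInv : ContDiffAt ℝ ∞ (jetMetricInv (n := n)) q := by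
  have h1 := (contDiff_tangentProj (n := n)).contDiffAt (x := q)
  exact (h1.clm_mul (contDiffAt_inverse_jetMetric hG)).clm_mul h1

lemma contDiffAt_jetPullback : ContDiffAt ℝ ∞ (jetPullback (n := n)) q :=
  (contDiffAt_jetMetricInv hG).clm_mul contDiff_adjoint_jetDiff.contDiffAt

lemma contDiffAt_jetNormalVec : ContDiffAt ℝ ∞ (jetNormalVec (n := n)) q :=
  contDiffAt_fst.sub (contDiff_jetDiff.contDiffAt.clm_apply
    ((contDiffAt_jetPullback hG).clm_apply contDiffAt_fst))

lemma contDiffAt_jetTraceHess : ContDiffAt ℝ ∞ (jetTraceHess (n := n)) q :=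
  ContDiffAt.sum fun _ _ => contDiffAt_jetHess_apply contDiffAt_const
    ((contDiffAt_jetMetricInv hG).clm_apply contDiffAt_const)

lemma contDiffAt_jetLaplacian : ContDiffAt ℝ ∞ (jetLaplacian (n := n)) q := by
  have hb : ContDiffAt ℝ ∞ (fun q : Ambient n × PairJet n => q.2.2.2.2) q := by fun_prop
  have ha : ContDiffAt ℝ ∞ (fun q : Ambient n × PairJet n => q.2.2.2.1) q := by fun_prop
  exact (ContDiffAt.sum fun _ _ => (hb.clm_apply contDiffAt_const).clm_apply
    ((contDiffAt_jetMetricInv hG).clm_apply contDiffAt_const)).sub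
    (ha.clm_apply ((contDiffAt_jetPullback hG).clm_apply (contDiffAt_jetTraceHess hG)))

lemma contDiffAt_jetTrace : ContDiffAt ℝ ∞ (jetTrace (n := n)) q :=
  ContDiffAt.sum fun _ _ => contDiffAt_const.inner ℝ
    ((contDiffAt_jetMetricInv hG).clm_apply contDiffAt_const)

variable (hN : jetNormalVec q ≠ 0)
include hN

lemma contDiffAt_jetNormal : ContDiffAt ℝ ∞ (jetNormal (n := n)) q :=
  (((contDiffAt_jetNormalVec hG).norm ℝ hN).inv (norm_ne_zero_iff.2 hN)).smul
    (contDiffAt_jetNormalVec hG)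

lemma contDiffAt_jetNormSq : ContDiffAt ℝ ∞ (jetNormSq (n := n)) q :=
  ContDiffAt.sum fun _ _ => ContDiffAt.sum fun _ _ =>
    ((contDiffAt_jetNormal hG hN).inner ℝ
      (contDiffAt_jetHess_apply contDiffAt_const contDiffAt_const)).mul
    ((contDiffAt_jetNormal hG hN).inner ℝ (contDiffAt_jetHess_apply
      ((contDiffAt_jetMetricInv hG).clm_apply contDiffAt_const)
      ((contDiffAt_jetMetricInv hG).clm_apply contDiffAt_const)))

lemma contDiffAt_jetBase : ContDiffAt ℝ ∞ (jetBase (n := n)) q :=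
  ((contDiffAt_const.sub (contDiffAt_const.mul (contDiffAt_jetTrace hG))).mul
    (contDiffAt_fst.inner ℝ (contDiffAt_jetNormal hG hN))).sub
    (((contDiffAt_jetPullback hG).clm_apply (contDiffAt_jetTraceHess hG)).inner ℝ
      (contDiffAt_jetNormal hG hN))

lemma contDiffAt_jetCross : ContDiffAt ℝ ∞ (jetCross (n := n)) q := by
  have hA : ContDiffAt ℝ ∞ (fun q : Ambient n × PairJet n => q.2.1.2.1) q := by fun_prop
  exact ContDiffAt.sum fun _ _ => (contDiffAt_jetNormal hG hN).inner ℝ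
    (contDiffAt_jetHess_apply ((contDiffAt_jetMetricInv hG).clm_apply contDiffAt_const)
      ((contDiffAt_jetPullback hG).clm_apply (hA.clm_apply contDiffAt_const)))

lemma contDiffAt_flowTerm : ContDiffAt ℝ ∞ (flowTerm (n := n)) q := by
  have hb : ContDiffAt ℝ ∞ (fun q : Ambient n × PairJet n => q.2.2.2.2) q := by fun_prop
  have hw : ContDiffAt ℝ ∞ (fun q : Ambient n × PairJet n => q.2.2.1) q := by fun_prop
  have hS : ContDiffAt ℝ ∞ (jetSphereLaplacian (n := n)) q :=
    ContDiffAt.sum fun _ _ => (hb.clm_apply contDiffAt_const).clm_apply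
      (contDiff_tangentProj.contDiffAt.clm_apply contDiffAt_const)
  exact ((((contDiffAt_jetLaplacian hG).sub hS).add
    (((contDiffAt_jetNormSq hG hN).sub contDiffAt_const).mul hw)).add
    (contDiffAt_jetBase hG hN)).add (contDiffAt_const.mul (contDiffAt_jetCross hG hN))

lemma contDiffAt_radialTerm (hpN : inner ℝ q.1 (jetNormal q) ≠ (0 : ℝ)) :
    ContDiffAt ℝ ∞ (radialTerm (n := n)) q := by
  have hu : ContDiffAt ℝ ∞ (fun q : Ambient n × PairJet n => q.2.1.1) q := by fun_prop
  have hν := contDiffAt_jetNormal hG hN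
  have hK := contDiffAt_jetPullback hG
  exact (contDiffAt_flowTerm hG hN).sub
    ((hν.inner ℝ (contDiffAt_jetHess_apply (hK.clm_apply hu) (hK.clm_apply contDiffAt_fst))).mul
      ((hν.inner ℝ (contDiffAt_jetTraceHess hG)).div (contDiffAt_fst.inner ℝ hν) hpN))

end

end Smooth

end Jets

/-! ### The nonlinear terms are quadratic -/

section Quadratic

open Asymptotics Filter Topology

section Uniform

variable {S E J V : Type*} [NormedAddCommGroup E] [NormedSpace ℝ E] [NormedAddCommGroup J]
  [NormedAddCommGroup V] [NormedSpace ℝ V]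

/-- The filter on `S × J` of second components tending to zero, uniformly in the first component. -/
def uniformlySmall (S J : Type*) [NormedAddCommGroup J] : Filter (S × J) := ⊤ ×ˢ 𝓝 0

lemma tendsto_norm_uniformlySmall :
    Tendsto (fun q : S × J => ‖q.2‖) (uniformlySmall S J) (𝓝 0) := by
  have h : Tendsto (fun q : S × J => q.2) (uniformlySmall S J) (𝓝 0) := tendsto_snd
  simpa using h.norm

lemma exists_forall_of_eventually_uniformlySmall {s : S × J → Prop}
    (h : ∀ᶠ q in uniformlySmall S J, s q) :
    ∃ ε > 0, ∀ (p : S) (j : J), ‖j‖ < ε → s (p, j) := by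
  rw [uniformlySmall, top_prod, eventually_comap, Metric.eventually_nhds_iff] at h
  obtain ⟨ε, hε, h⟩ := h
  exact ⟨ε, hε, fun p j hj => h (by simpa using hj) (p, j) rfl⟩

/-- A map that is smooth near the compact set `S × {0}` is Lipschitz in the second variable there,
uniformly in the first. -/
lemma isBigO_sub_of_contDiffAt [NormedSpace ℝ J] [TopologicalSpace S] [CompactSpace S] {c : S → E}
    (hc : Continuous c) {f : E × J → V} (hf : ∀ p : S, ContDiffAt ℝ ∞ f (c p, 0)) :
    (fun q : S × J => f (c q.1, q.2) - f (c q.1, 0)) =O[uniformlySmall S J] fun q => ‖q.2‖ := by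
  rw [uniformlySmall, ← principal_univ]
  refine isCompact_univ.induction_on (p := fun s : Set S =>
    (fun q : S × J => f (c q.1, q.2) - f (c q.1, 0)) =O[𝓟 s ×ˢ 𝓝 0] fun q => ‖q.2‖) ?_ ?_ ?_ ?_
  · rw [principal_empty, bot_prod]
    exact IsBigO.of_bound 0 eventually_bot
  · intro s t hst ht
    exact ht.mono (prod_mono (principal_mono.2 hst) le_rfl)
  · intro s t hs ht
    rw [← sup_principal, sup_prod]
    exact hs.sup ht
  · intro p _
    obtain ⟨K, t, ht, hK⟩ := ((hf p).of_le (m := 1) (by simp)).exists_lipschitzOnWith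
    have hcont : ContinuousAt (fun q : S × J => (c q.1, q.2)) (p, 0) := by
      fun_prop
    have hpre := hcont.preimage_mem_nhds ht
    rw [nhds_prod_eq, mem_prod_iff] at hpre
    obtain ⟨a, ha, b, hb, hab⟩ := hpre
    refine ⟨a, by simpa using ha, IsBigO.of_bound K ?_⟩
    filter_upwards [prod_mem_prod (mem_principal_self a) hb] with q hq
    have h1 := hK.dist_le_mul _ (hab hq) _ (hab (show (q.1, (0 : J)) ∈ a ×ˢ b from
      ⟨hq.1, mem_of_mem_nhds hb⟩))
    rw [dist_eq_norm] at h1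
    refine h1.trans (le_of_eq ?_)
    simp [Prod.dist_eq]

end Uniform

variable {n : ℕ}

/-- Jets tending to zero, uniformly in the point of the sphere. -/
noncomputable abbrev smallJets (n : ℕ) : Filter (USphere n × PairJet n) :=
  uniformlySmall (USphere n) (PairJet n)

lemma isBigO_jet_sub {V : Type*} [NormedAddCommGroup V] [NormedSpace ℝ V]
    {f : Ambient n × PairJet n → V}
    (hf : ∀ p : USphere n, ContDiffAt ℝ ∞ f ((p : Ambient n), 0)) :
    (fun q : USphere n × PairJet n => f ((q.1 : Ambient n), q.2) - f ((q.1 : Ambient n), 0))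
      =O[smallJets n] fun q => ‖q.2‖ :=
  isBigO_sub_of_contDiffAt continuous_subtype_val hf

lemma IsBigO.clm_apply_norm {Y V V' : Type*} [NormedAddCommGroup V] [NormedSpace ℝ V]
    [NormedAddCommGroup V'] [NormedSpace ℝ V'] {l : Filter Y} {L : Y → V →L[ℝ] V'} {v : Y → V}
    {g g' : Y → ℝ} (hL : L =O[l] g) (hv : v =O[l] g') :
    (fun y => L y (v y)) =O[l] fun y => g y * g' y :=
  (IsBigO.of_norm_le fun y => (L y).le_opNorm (v y)).trans (hL.norm_left.mul hv.norm_left)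

section AtZero

variable (p : USphere n)

lemma inner_self_usphere : inner ℝ (p : Ambient n) (p : Ambient n) = (1 : ℝ) := by
  rw [real_inner_self_eq_norm_sq, norm_eq_of_mem_sphere]; norm_num

lemma inner_tangentProj_self (a : Ambient n) :
    inner ℝ (p : Ambient n) (tangentProj p a) = (0 : ℝ) := by
  rw [tangentProj_apply, inner_sub_right, inner_smul_right, inner_self_usphere]; ring

lemma tangentProj_self : tangentProj (p : Ambient n) p = 0 := by
  rw [tangentProj_apply, inner_self_usphere, one_smul, sub_self]

lemma tangentProj_tangentProj (a : Ambient n) :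
    tangentProj (p : Ambient n) (tangentProj p a) = tangentProj p a := by
  rw [tangentProj_apply _ (tangentProj _ a), inner_tangentProj_self, zero_smul, sub_zero]

lemma tangentProj_mul_self :
    tangentProj (p : Ambient n) * tangentProj (p : Ambient n) = tangentProj p :=
  ContinuousLinearMap.ext fun a => tangentProj_tangentProj p a

lemma inner_tangentProj_comm (q a b : Ambient n) :
    inner ℝ (tangentProj q a) b = (inner ℝ a (tangentProj q b) : ℝ) := by
  rw [tangentProj_apply, tangentProj_apply, inner_sub_left, inner_sub_right, inner_smul_left,
    inner_smul_right, real_inner_comm q a]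
  simp only [RCLike.conj_to_real]; ring

lemma sum_inner_basis (a b : Ambient n) :
    ∑ α, inner ℝ a (ambientBasis α) * inner ℝ (ambientBasis α) b = (inner ℝ a b : ℝ) := by
  have := (EuclideanSpace.basisFun (Fin (n + 1)) ℝ).sum_inner_mul_inner a b
  simpa using this

lemma sum_inner_tangentProj :
    ∑ α, inner ℝ (ambientBasis α) (tangentProj (p : Ambient n) (ambientBasis α)) = (n : ℝ) := by
  simp only [tangentProj_apply, inner_sub_right, inner_smul_right, Finset.sum_sub_distrib]
  rw [sum_inner_basis, inner_self_usphere]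
  simp

lemma jetDiff_zero : jetDiff ((p : Ambient n), 0) = 1 := by
  simp [jetDiff]

lemma jetMetric_zero : jetMetric ((p : Ambient n), 0) = 1 := by
  rw [jetMetric, jetDiff_zero]
  have : ContinuousLinearMap.adjoint (1 : Ambient n →L[ℝ] Ambient n) = 1 :=
    ContinuousLinearMap.adjoint_id
  rw [this, mul_one, mul_one, tangentProj_mul_self]
  abel

lemma jetMetricInv_zero : jetMetricInv ((p : Ambient n), 0) = tangentProj p := by
  rw [jetMetricInv, jetMetric_zero, Ring.inverse_one, mul_one, tangentProj_mul_self]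

lemma jetPullback_zero : jetPullback ((p : Ambient n), 0) = tangentProj p := by
  rw [jetPullback, jetMetricInv_zero, jetDiff_zero]
  have : ContinuousLinearMap.adjoint (1 : Ambient n →L[ℝ] Ambient n) = 1 :=
    ContinuousLinearMap.adjoint_id
  rw [this, mul_one]

lemma jetNormalVec_zero : jetNormalVec ((p : Ambient n), 0) = p := by
  rw [jetNormalVec, jetPullback_zero, tangentProj_self]
  simp

lemma jetNormal_zero : jetNormal ((p : Ambient n), 0) = p := by
  rw [jetNormal, jetNormalVec_zero, norm_eq_of_mem_sphere, inv_one, one_smul]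

lemma jetHess_zero (v w : Ambient n) :
    jetHess ((p : Ambient n), 0) v w = -(((Real.sqrt n)⁻¹ * inner ℝ v w) • (p : Ambient n)) := by
  rw [jetHess_apply]
  simp

lemma jetTraceHess_zero : jetTraceHess ((p : Ambient n), 0) =
    -(((Real.sqrt n)⁻¹ * n) • (p : Ambient n)) := by
  simp only [jetTraceHess, jetHess_zero, jetMetricInv_zero, Finset.sum_neg_distrib,
    ← Finset.sum_smul, ← Finset.mul_sum, sum_inner_tangentProj]

lemma jetTrace_zero : jetTrace ((p : Ambient n), 0) = n := by
  rw [jetTrace, jetMetricInv_zero, sum_inner_tangentProj]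

lemma jetPullback_jetTraceHess_zero :
    jetPullback ((p : Ambient n), 0) (jetTraceHess ((p : Ambient n), 0)) = 0 := by
  rw [jetPullback_zero, jetTraceHess_zero, map_neg, map_smul, tangentProj_self, smul_zero, neg_zero]

lemma jetNormSq_zero (hn : 1 ≤ n) : jetNormSq ((p : Ambient n), 0) = 1 := by
  have hn0 : (n : ℝ) ≠ 0 := by positivity
  have h1 : ∀ v w : Ambient n, inner ℝ (p : Ambient n) (jetHess ((p : Ambient n), 0) v w) =
      -((Real.sqrt n)⁻¹ * inner ℝ v w) := by
    intro v w
    rw [jetHess_zero, inner_neg_right, inner_smul_right, inner_self_usphere, mul_one]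
  have h2 : (Real.sqrt n)⁻¹ * (Real.sqrt n)⁻¹ = (n : ℝ)⁻¹ := by
    rw [← mul_inv, Real.mul_self_sqrt (Nat.cast_nonneg n)]
  have h3 : ∀ α, ∑ β, (inner ℝ (ambientBasis α) (ambientBasis β) : ℝ) *
      inner ℝ (tangentProj (p : Ambient n) (ambientBasis α)) (tangentProj p (ambientBasis β)) =
        inner ℝ (ambientBasis α) (tangentProj (p : Ambient n) (ambientBasis α)) := by
    intro α
    simp only [inner_tangentProj_comm, tangentProj_tangentProj]
    rw [← inner_tangentProj_comm, real_inner_comm,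
      ← sum_inner_basis (ambientBasis α) (tangentProj (p : Ambient n) (ambientBasis α))]
    refine Finset.sum_congr rfl fun β _ => ?_
    rw [← inner_tangentProj_comm, real_inner_comm (ambientBasis β) (ambientBasis α),
      real_inner_comm (ambientBasis β) (tangentProj _ _)]
  simp only [jetNormSq, jetNormal_zero, h1, jetMetricInv_zero]
  have h4 : ∀ α β : Fin (n + 1),
      -((Real.sqrt n)⁻¹ * (inner ℝ (ambientBasis α) (ambientBasis β) : ℝ)) *
      -((Real.sqrt n)⁻¹ * inner ℝ (tangentProj (p : Ambient n) (ambientBasis α))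
        (tangentProj (p : Ambient n) (ambientBasis β))) =
      (n : ℝ)⁻¹ * ((inner ℝ (ambientBasis α) (ambientBasis β) : ℝ) *
        inner ℝ (tangentProj (p : Ambient n) (ambientBasis α))
          (tangentProj (p : Ambient n) (ambientBasis β))) := by
    intro α β
    rw [← h2]; ring
  simp only [h4, ← Finset.mul_sum, h3, sum_inner_tangentProj]
  exact inv_mul_cancel₀ hn0

lemma isUnit_jetMetric_zero : IsUnit (jetMetric ((p : Ambient n), 0)) := by
  rw [jetMetric_zero]; exact isUnit_one

lemma jetNormalVec_zero_ne : jetNormalVec ((p : Ambient n), 0) ≠ 0 := by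
  rw [jetNormalVec_zero]; exact ne_zero_of_mem_unit_sphere p

lemma inner_jetPullback_self (j : PairJet n) (c : Ambient n) :
    inner ℝ (p : Ambient n) (jetPullback ((p : Ambient n), j) c) = (0 : ℝ) :=
  inner_tangentProj_self p _

end AtZero

lemma eventually_jetDomain :
    ∀ᶠ q : USphere n × PairJet n in smallJets n, ((q.1 : Ambient n), q.2) ∈ jetDomain n := by
  have htend : ∀ {V : Type} [NormedAddCommGroup V] [NormedSpace ℝ V]
      {f : Ambient n × PairJet n → V}, (∀ p : USphere n, ContDiffAt ℝ ∞ f ((p : Ambient n), 0)) →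
      ∀ᶠ q : USphere n × PairJet n in smallJets n,
        ‖f ((q.1 : Ambient n), q.2) - f ((q.1 : Ambient n), 0)‖ < 1 := by
    intro V _ _ f hf
    have h1 := (isBigO_jet_sub hf).trans_tendsto tendsto_norm_uniformlySmall
    have h2 := h1.norm
    rw [norm_zero] at h2
    exact h2.eventually (gt_mem_nhds one_pos)
  have hG := htend (f := jetMetric) fun p => contDiffAt_jetMetric
  have hN := htend (f := jetNormalVec) fun p => contDiffAt_jetNormalVec (isUnit_jetMetric_zero p)
  have hI := htend (f := fun q => (inner ℝ q.1 (jetNormal q) : ℝ)) fun p =>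
    contDiffAt_fst.inner ℝ (contDiffAt_jetNormal (isUnit_jetMetric_zero p) (jetNormalVec_zero_ne p))
  filter_upwards [hG, hN, hI] with q hG hN hI
  refine ⟨?_, fun h0 => ?_, fun h0 => ?_⟩
  · rw [jetMetric_zero] at hG
    have := isUnit_one_sub_of_norm_lt_one (x := -(jetMetric ((q.1 : Ambient n), q.2) - 1))
      (by rwa [norm_neg])
    rwa [sub_neg_eq_add, add_sub_cancel] at this
  · rw [h0, jetNormalVec_zero, zero_sub, norm_neg, norm_eq_of_mem_sphere] at hN
    exact lt_irrefl _ hN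
  · simp only [jetNormal_zero] at hI
    simp only at h0
    rw [h0, inner_self_usphere] at hI
    norm_num at hI

end Quadratic

section QuadraticBound

open Asymptotics Filter Topology

variable {n : ℕ}

lemma IsBigO.inner_norm {Y V : Type*} [NormedAddCommGroup V] [InnerProductSpace ℝ V]
    {l : Filter Y} {f g : Y → V} {a b : Y → ℝ} (hf : f =O[l] a) (hg : g =O[l] b) :
    (fun y => (inner ℝ (f y) (g y) : ℝ)) =O[l] fun y => a y * b y :=
  (IsBigO.of_norm_le fun y => norm_inner_le_norm (f y) (g y)).trans (hf.norm_left.mul hg.norm_left)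

lemma isBigO_tangentProj (a : Ambient n) :
    (fun q : USphere n × PairJet n => tangentProj (q.1 : Ambient n) a) =O[smallJets n]
      fun _ => (1 : ℝ) := by
  refine IsBigO.of_bound (‖a‖ + ‖a‖) (Eventually.of_forall fun q => ?_)
  rw [tangentProj_apply, norm_one, mul_one]
  refine (norm_sub_le _ _).trans (add_le_add le_rfl ?_)
  rw [norm_smul, norm_eq_of_mem_sphere, mul_one]
  exact (norm_inner_le_norm _ _).trans (by rw [norm_eq_of_mem_sphere, one_mul])

lemma isBigO_jet_gradient :
    (fun q : USphere n × PairJet n => q.2.1.2.1) =O[smallJets n] fun q => ‖q.2‖ :=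
  IsBigO.of_norm_le fun q =>
    (norm_fst_le q.2.1.2).trans ((norm_snd_le q.2.1).trans (norm_fst_le q.2))

lemma isBigO_jet_gradient_apply {v : USphere n × PairJet n → Ambient n}
    (hv : v =O[smallJets n] fun _ => (1 : ℝ)) :
    (fun q : USphere n × PairJet n => q.2.1.2.1 (v q)) =O[smallJets n] fun q => ‖q.2‖ := by
  simpa using IsBigO.clm_apply_norm isBigO_jet_gradient hv

lemma isBigO_jetPullback_jetTraceHess :
    (fun q : USphere n × PairJet n => jetPullback ((q.1 : Ambient n), q.2)
      (jetTraceHess ((q.1 : Ambient n), q.2))) =O[smallJets n] fun q => ‖q.2‖ := by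
  have h := isBigO_jet_sub (f := fun q : Ambient n × PairJet n => jetPullback q (jetTraceHess q))
    fun p => (contDiffAt_jetPullback (isUnit_jetMetric_zero p)).clm_apply
      (contDiffAt_jetTraceHess (isUnit_jetMetric_zero p))
  simpa only [jetPullback_jetTraceHess_zero, sub_zero] using h

lemma isBigO_jetNormal_sub :
    (fun q : USphere n × PairJet n => jetNormal ((q.1 : Ambient n), q.2) - (q.1 : Ambient n))
      =O[smallJets n] fun q => ‖q.2‖ := by
  have h := isBigO_jet_sub (f := jetNormal (n := n)) fun p =>
    contDiffAt_jetNormal (isUnit_jetMetric_zero p) (jetNormalVec_zero_ne p)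
  simpa only [jetNormal_zero] using h

lemma isBigO_jetLaplacian_sub :
    (fun q : USphere n × PairJet n => jetLaplacian ((q.1 : Ambient n), q.2) -
      jetSphereLaplacian ((q.1 : Ambient n), q.2)) =O[smallJets n] fun q => ‖q.2‖ * ‖q.2‖ := by
  have hb : (fun q : USphere n × PairJet n => q.2.2.2.2) =O[smallJets n] fun q => ‖q.2‖ :=
    IsBigO.of_norm_le fun q =>
      (norm_snd_le q.2.2.2).trans ((norm_snd_le q.2.2).trans (norm_snd_le q.2))
  have ha : (fun q : USphere n × PairJet n => q.2.2.2.1) =O[smallJets n] fun q => ‖q.2‖ :=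
    IsBigO.of_norm_le fun q =>
      (norm_fst_le q.2.2.2).trans ((norm_snd_le q.2.2).trans (norm_snd_le q.2))
  have h1 : ∀ α : Fin (n + 1), (fun q : USphere n × PairJet n => q.2.2.2.2 (ambientBasis α)
      (jetMetricInv ((q.1 : Ambient n), q.2) (ambientBasis α) -
        tangentProj (q.1 : Ambient n) (ambientBasis α))) =O[smallJets n]
      fun q => ‖q.2‖ * ‖q.2‖ := by
    intro α
    have h2 := isBigO_jet_sub (f := fun q : Ambient n × PairJet n =>
      jetMetricInv q (ambientBasis α)) fun p =>
        (contDiffAt_jetMetricInv (isUnit_jetMetric_zero p)).clm_apply contDiffAt_const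
    simp only [jetMetricInv_zero] at h2
    have h3 := IsBigO.clm_apply_norm hb (isBigO_const_const (ambientBasis α : Ambient n)
      (one_ne_zero (α := ℝ)) (smallJets n))
    simp only [mul_one] at h3
    exact IsBigO.clm_apply_norm h3 h2
  refine ((IsBigO.sum (s := Finset.univ) fun α _ => h1 α).sub
    (IsBigO.clm_apply_norm ha isBigO_jetPullback_jetTraceHess)).congr_left fun q => ?_
  simp only [Finset.sum_apply, jetLaplacian, jetSphereLaplacian, map_sub, Finset.sum_sub_distrib]
  ring

/-- The tangential divergence: the value `A p` drops out of the trace against tangent vectors. -/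
lemma sum_inner_tangentProj_apply (p : USphere n) (A : Ambient n →L[ℝ] Ambient n) :
    ∑ α, (inner ℝ (tangentProj (p : Ambient n) (ambientBasis α))
      (A (tangentProj (p : Ambient n) (ambientBasis α))) : ℝ) =
    ∑ α, inner ℝ (tangentProj (p : Ambient n) (ambientBasis α)) (A (ambientBasis α)) := by
  have h1 : ∑ α, (inner ℝ (p : Ambient n) (ambientBasis α) : ℝ) *
      inner ℝ (tangentProj (p : Ambient n) (ambientBasis α)) (A p) = 0 := by
    simp only [inner_tangentProj_comm]
    rw [sum_inner_basis, inner_tangentProj_self]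
  rw [← sub_eq_zero, ← Finset.sum_sub_distrib, ← neg_eq_zero, ← h1, ← Finset.sum_neg_distrib]
  refine Finset.sum_congr rfl fun α _ => ?_
  rw [← inner_sub_right, ← map_sub]
  have : tangentProj (p : Ambient n) (ambientBasis α) - ambientBasis α =
      -((inner ℝ (p : Ambient n) (ambientBasis α) : ℝ) • (p : Ambient n)) := by
    rw [tangentProj_apply]; abel
  rw [this, map_neg, map_smul, inner_neg_right, inner_smul_right, neg_neg]

lemma inner_jetMetric_tangentProj (p : USphere n) (j : PairJet n) (a : Ambient n) :
    inner ℝ (tangentProj (p : Ambient n) a)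
      (jetMetric ((p : Ambient n), j) (tangentProj (p : Ambient n) a)) =
    inner ℝ (tangentProj (p : Ambient n) a) (tangentProj (p : Ambient n) a) +
      2 * inner ℝ (tangentProj (p : Ambient n) a) (j.1.2.1 (tangentProj (p : Ambient n) a)) +
      (inner ℝ (j.1.2.1 (tangentProj (p : Ambient n) a))
        (j.1.2.1 (tangentProj (p : Ambient n) a)) : ℝ) := by
  set v := tangentProj (p : Ambient n) a
  have hv : tangentProj (p : Ambient n) v = v := tangentProj_tangentProj p a
  have h1 : jetMetric ((p : Ambient n), j) v = tangentProj (p : Ambient n)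
      (ContinuousLinearMap.adjoint (jetDiff ((p : Ambient n), j))
        (jetDiff ((p : Ambient n), j) (tangentProj (p : Ambient n) v))) +
      (v - tangentProj (p : Ambient n) v) := rfl
  rw [h1, hv, sub_self, add_zero, ← inner_tangentProj_comm, hv,
    ContinuousLinearMap.adjoint_inner_right]
  have h2 : jetDiff ((p : Ambient n), j) v = v + j.1.2.1 v := rfl
  rw [h2, inner_add_left, inner_add_right, inner_add_right, real_inner_comm v (j.1.2.1 v)]
  ring

/-- The trace `gⁱʲ ⟨yᵢ, yⱼ⟩` is `n - 2 div u` up to quadratic terms: on the tangent space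
`G⁻¹ = 1 - (G - 1) + O(|j|²)`, and `⟨v, G v⟩ = |v|² + 2 ⟨v, ∇ᵥu⟩ + |∇ᵥu|²`. -/
lemma isBigO_jetTrace :
    (fun q : USphere n × PairJet n => jetTrace ((q.1 : Ambient n), q.2) - n +
      2 * ∑ α, inner ℝ (tangentProj (q.1 : Ambient n) (ambientBasis α))
        (q.2.1.2.1 (ambientBasis α))) =O[smallJets n] fun q => ‖q.2‖ * ‖q.2‖ := by
  have hG := isBigO_jet_sub (f := jetMetric (n := n)) fun p => contDiffAt_jetMetric
  have hGi := isBigO_jet_sub (f := fun q : Ambient n × PairJet n => Ring.inverse (jetMetric q))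
    fun p => contDiffAt_inverse_jetMetric (isUnit_jetMetric_zero p)
  simp only [jetMetric_zero, Ring.inverse_one] at hG hGi
  have h1 : ∀ α : Fin (n + 1), (fun q : USphere n × PairJet n =>
      -(inner ℝ (tangentProj (q.1 : Ambient n) (ambientBasis α))
        ((Ring.inverse (jetMetric ((q.1 : Ambient n), q.2)) - 1)
          ((jetMetric ((q.1 : Ambient n), q.2) - 1)
            (tangentProj (q.1 : Ambient n) (ambientBasis α)))) : ℝ) -
      (inner ℝ (q.2.1.2.1 (tangentProj (q.1 : Ambient n) (ambientBasis α)))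
        (q.2.1.2.1 (tangentProj (q.1 : Ambient n) (ambientBasis α))) : ℝ)) =O[smallJets n]
      fun q => ‖q.2‖ * ‖q.2‖ := by
    intro α
    have hP := isBigO_tangentProj (n := n) (ambientBasis α)
    have h2 := IsBigO.clm_apply_norm hGi (IsBigO.clm_apply_norm hG hP)
    have h3 := IsBigO.inner_norm hP h2
    simp only [mul_one, one_mul] at h3
    exact h3.neg_left.sub (IsBigO.inner_norm (isBigO_jet_gradient_apply hP)
      (isBigO_jet_gradient_apply hP))
  refine (IsBigO.sum (s := Finset.univ) fun α _ => h1 α).congr' ?_ EventuallyEq.rfl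
  filter_upwards [eventually_jetDomain] with q hq
  obtain ⟨p, j⟩ := q
  have hinv := Ring.inverse_mul_cancel _ hq.1
  set G := jetMetric ((p : Ambient n), j)
  set Gi := Ring.inverse G
  have h2 : ∀ v : Ambient n, Gi (G v) = v := fun v => congrArg (fun L => L v) hinv
  have h3 : jetTrace ((p : Ambient n), j) = ∑ α, (inner ℝ
      (tangentProj (p : Ambient n) (ambientBasis α))
      (Gi (tangentProj (p : Ambient n) (ambientBasis α))) : ℝ) := by
    refine Finset.sum_congr rfl fun α _ => ?_
    exact (inner_tangentProj_comm _ _ _).symm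
  have h4 : (n : ℝ) = ∑ α : Fin (n + 1), (inner ℝ
      (tangentProj (p : Ambient n) (ambientBasis α))
      (tangentProj (p : Ambient n) (ambientBasis α)) : ℝ) := by
    rw [← sum_inner_tangentProj p]
    refine Finset.sum_congr rfl fun α _ => ?_
    rw [inner_tangentProj_comm, tangentProj_tangentProj]
  have h7 : jetTrace ((p : Ambient n), j) - n = ∑ α, ((inner ℝ
      (tangentProj (p : Ambient n) (ambientBasis α))
      (Gi (tangentProj (p : Ambient n) (ambientBasis α))) : ℝ) - inner ℝ
      (tangentProj (p : Ambient n) (ambientBasis α))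
      (tangentProj (p : Ambient n) (ambientBasis α))) := by
    rw [Finset.sum_sub_distrib, ← h3, ← h4]
  simp only [Finset.sum_apply]
  rw [h7, ← sum_inner_tangentProj_apply, Finset.mul_sum, ← Finset.sum_add_distrib]
  refine Finset.sum_congr rfl fun α _ => ?_
  have h5 := inner_jetMetric_tangentProj p j (ambientBasis α)
  set v := tangentProj (p : Ambient n) (ambientBasis α)
  have h6 : (Gi - 1) ((G - 1) v) = v - Gi v - (G v - v) := by
    change Gi (G v - v) - (G v - v) = _
    rw [map_sub, h2]
  rw [h6, inner_sub_right, inner_sub_right, inner_sub_right, h5]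
  ring

/-- The linear parts of `⟨x_{Sⁿ} + Δ x_{Sⁿ}, ν⟩` and of `-2 gⁱʲ ⟨∂ᵢu, ∂ⱼν⟩` cancel: they are
`2 n^{-1/2} div u` and `-2 n^{-1/2} div u`. -/
lemma isBigO_jetBase_add_jetCross :
    (fun q : USphere n × PairJet n => jetBase ((q.1 : Ambient n), q.2) +
      2 * jetCross ((q.1 : Ambient n), q.2)) =O[smallJets n] fun q => ‖q.2‖ * ‖q.2‖ := by
  have hν : ∀ p : USphere n, ContDiffAt ℝ ∞ (jetNormal (n := n)) ((p : Ambient n), 0) := fun p =>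
    contDiffAt_jetNormal (isUnit_jetMetric_zero p) (jetNormalVec_zero_ne p)
  have htr := isBigO_jet_sub (f := jetTrace (n := n)) fun p =>
    contDiffAt_jetTrace (isUnit_jetMetric_zero p)
  simp only [jetTrace_zero] at htr
  have hpν := isBigO_jet_sub (f := fun q : Ambient n × PairJet n =>
    (inner ℝ q.1 (jetNormal q) : ℝ)) fun p => contDiffAt_fst.inner ℝ (hν p)
  simp only [jetNormal_zero, inner_self_usphere] at hpν
  have hpull := IsBigO.inner_norm (isBigO_jetPullback_jetTraceHess (n := n)) isBigO_jetNormal_sub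
  -- the covector `c ↦ ⟨ν, ∇²x (gⁱʲ⟨yᵢ, εα⟩ yⱼ, c)⟩`, pulled back
  set L : Fin (n + 1) → Ambient n × PairJet n → Ambient n →L[ℝ] ℝ := fun α q =>
    (ambientInner n (jetNormal q)).comp
      ((jetHess q (jetMetricInv q (ambientBasis α))).comp (jetPullback q))
  have hL0 : ∀ α (p : USphere n) c, L α ((p : Ambient n), 0) c =
      -((Real.sqrt n)⁻¹ * inner ℝ (tangentProj (p : Ambient n) (ambientBasis α)) c) := by
    intro α p c
    change (inner ℝ (jetNormal ((p : Ambient n), 0)) (jetHess ((p : Ambient n), 0)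
      (jetMetricInv ((p : Ambient n), 0) (ambientBasis α))
      (jetPullback ((p : Ambient n), 0) c)) : ℝ) = _
    rw [jetNormal_zero, jetHess_zero, jetMetricInv_zero, jetPullback_zero, inner_neg_right,
      inner_smul_right, inner_self_usphere, mul_one, ← inner_tangentProj_comm,
      tangentProj_tangentProj]
  have hL : ∀ α, (fun q : USphere n × PairJet n =>
      (L α ((q.1 : Ambient n), q.2) - L α ((q.1 : Ambient n), 0)) (q.2.1.2.1 (ambientBasis α)))
      =O[smallJets n] fun q => ‖q.2‖ * ‖q.2‖ := by
    intro α
    refine IsBigO.clm_apply_norm (isBigO_jet_sub fun p => ?_) (isBigO_jet_gradient_apply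
      (isBigO_const_const _ one_ne_zero _))
    have hu := isUnit_jetMetric_zero p
    exact ((ambientInner n).contDiff.contDiffAt.comp _ (hν p)).clm_comp
      ((contDiff_jetHess.contDiffAt.clm_apply
        ((contDiffAt_jetMetricInv hu).clm_apply contDiffAt_const)).clm_comp
        (contDiffAt_jetPullback hu))
  refine (((((isBigO_jetTrace (n := n)).const_mul_left (-(Real.sqrt n)⁻¹)).sub
    ((htr.mul hpν).const_mul_left (Real.sqrt n)⁻¹)).sub hpull).add
    ((IsBigO.sum (s := Finset.univ) fun α _ => hL α).const_mul_left 2)).congr_left fun q => ?_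
  obtain ⟨p, j⟩ := q
  have h1 : jetCross ((p : Ambient n), j) =
      ∑ α, L α ((p : Ambient n), j) (j.1.2.1 (ambientBasis α)) := rfl
  have h2 : (inner ℝ (jetPullback ((p : Ambient n), j) (jetTraceHess ((p : Ambient n), j)))
      (p : Ambient n) : ℝ) = 0 := by
    rw [real_inner_comm, inner_jetPullback_self]
  have h3 : Real.sqrt n = (Real.sqrt n)⁻¹ * n := by
    rcases eq_or_ne (Real.sqrt n) 0 with h0 | h0
    · rw [h0]; simp
    · rw [eq_inv_mul_iff_mul_eq₀ h0, Real.mul_self_sqrt (Nat.cast_nonneg n)]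
  simp only [Finset.sum_apply, sub_apply, hL0, inner_sub_right, h2, h1, jetBase,
    Finset.sum_sub_distrib, Finset.sum_neg_distrib, ← Finset.mul_sum]
  linear_combination (-(inner ℝ (p : Ambient n) (jetNormal ((p : Ambient n), j)) : ℝ)) * h3

lemma isBigO_flowTerm (hn : 1 ≤ n) :
    (fun q : USphere n × PairJet n => flowTerm ((q.1 : Ambient n), q.2)) =O[smallJets n]
      fun q => ‖q.2‖ ^ 2 := by
  have h1 := isBigO_jet_sub (f := jetNormSq (n := n)) fun p =>
    contDiffAt_jetNormSq (isUnit_jetMetric_zero p) (jetNormalVec_zero_ne p)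
  simp only [jetNormSq_zero _ hn] at h1
  have hw : (fun q : USphere n × PairJet n => q.2.2.1) =O[smallJets n] fun q => ‖q.2‖ :=
    IsBigO.of_norm_le fun q => (norm_fst_le q.2.2).trans (norm_snd_le q.2)
  refine ((isBigO_jetLaplacian_sub.add (h1.mul hw)).add isBigO_jetBase_add_jetCross).congr
    (fun q => ?_) fun q => (sq _).symm
  simp only [flowTerm]
  ring

lemma contDiff_flip {V : Type*} [NormedAddCommGroup V] [NormedSpace ℝ V] :
    ContDiff ℝ ∞ (ContinuousLinearMap.flip : (V →L[ℝ] V →L[ℝ] V) → V →L[ℝ] V →L[ℝ] V) :=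
  (ContinuousLinearMap.flipₗᵢ ℝ V V V).toContinuousLinearEquiv.contDiff

/-- The additional term is linear in `u`, with a coefficient that vanishes at the zero jet because
`p` has no tangential part on the sphere. -/
lemma isBigO_radialTerm (hn : 1 ≤ n) :
    (fun q : USphere n × PairJet n => radialTerm ((q.1 : Ambient n), q.2)) =O[smallJets n]
      fun q => ‖q.2‖ ^ 2 := by
  set R : Ambient n × PairJet n → Ambient n →L[ℝ] ℝ := fun q =>
    (inner ℝ (jetNormal q) (jetTraceHess q) / inner ℝ q.1 (jetNormal q) : ℝ) •
      (ambientInner n (jetNormal q)).comp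
        (((jetHess q).flip (jetPullback q q.1)).comp (jetPullback q))
  have hR0 : ∀ p : USphere n, R ((p : Ambient n), 0) = 0 := by
    intro p
    have : jetPullback ((p : Ambient n), 0) (p : Ambient n) = 0 := by
      rw [jetPullback_zero, tangentProj_self]
    simp only [R, this, map_zero, ContinuousLinearMap.zero_comp, ContinuousLinearMap.comp_zero,
      smul_zero]
  have hR := isBigO_jet_sub (f := R) fun p => by
    have hu := isUnit_jetMetric_zero p
    have hν := contDiffAt_jetNormal hu (jetNormalVec_zero_ne p)
    have hK := contDiffAt_jetPullback hu
    have hflip : ContDiffAt ℝ ∞ (fun q : Ambient n × PairJet n => (jetHess q).flip)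
        ((p : Ambient n), 0) :=
      contDiff_flip.contDiffAt.comp _ contDiff_jetHess.contDiffAt
    refine ContDiffAt.smul ((hν.inner ℝ (contDiffAt_jetTraceHess hu)).div
      (contDiffAt_fst.inner ℝ hν) ?_)
      (((ambientInner n).contDiff.contDiffAt.comp _ hν).clm_comp
        ((hflip.clm_apply (hK.clm_apply contDiffAt_fst)).clm_comp hK))
    rw [jetNormal_zero, inner_self_usphere]
    exact one_ne_zero
  simp only [hR0, sub_zero] at hR
  have hu : (fun q : USphere n × PairJet n => q.2.1.1) =O[smallJets n] fun q => ‖q.2‖ :=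
    IsBigO.of_norm_le fun q => (norm_fst_le q.2.1).trans (norm_fst_le q.2)
  refine ((isBigO_flowTerm hn).sub ((IsBigO.clm_apply_norm hR hu).congr_right
    fun q => (sq _).symm)).congr_left fun q => ?_
  have : R ((q.1 : Ambient n), q.2) q.2.1.1 = jetRadial ((q.1 : Ambient n), q.2) := mul_comm _ _
  rw [this]
  rfl

lemma contMDiff_prodMk_coe_usphere {J : Type*} [NormedAddCommGroup J] [NormedSpace ℝ J] :
    ContMDiff ((𝓡 n).prod 𝓘(ℝ, J)) 𝓘(ℝ, Ambient n × J) ∞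
      (fun q : USphere n × J => ((q.1 : Ambient n), q.2)) := by
  rw [modelWithCornersSelf_prod, ← chartedSpaceSelf_prod]
  exact (contMDiff_coe_usphere.comp contMDiff_fst).prodMk contMDiff_snd

/-- A term that is smooth on `jetDomain` and quadratically small along small jets is a quadratic
term in a neighbourhood of the zero jet. -/
lemma exists_isQuadraticTerm {f : Ambient n × PairJet n → ℝ}
    (hf : ∀ q ∈ jetDomain n, ContDiffAt ℝ ∞ f q)
    (hO : (fun q : USphere n × PairJet n => f ((q.1 : Ambient n), q.2)) =O[smallJets n]
      fun q => ‖q.2‖ ^ 2) :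
    ∃ ε > 0, IsQuadraticTerm (n := n) ε (fun q => f ((q.1 : Ambient n), q.2)) ∧
      ∀ (p : USphere n) (j : PairJet n), ‖j‖ < ε → ((p : Ambient n), j) ∈ jetDomain n := by
  obtain ⟨C, hC⟩ := hO.bound
  obtain ⟨ε, hε, h⟩ := exists_forall_of_eventually_uniformlySmall (hC.and eventually_jetDomain)
  refine ⟨ε, hε, ⟨?_, C, fun p j hj => ?_⟩, fun p j hj => (h p j hj).2⟩
  · rintro ⟨p, j⟩ ⟨-, hj⟩
    have hd := (h p j (mem_ball_zero_iff.1 hj)).2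
    exact ((hf _ hd).contMDiffAt.comp (p, j)
      contMDiff_prodMk_coe_usphere.contMDiffAt).contMDiffWithinAt
  · rw [← norm_norm j, ← norm_pow]
    exact (h p j hj).1

end QuadraticBound

/-! ### Frames of a hypersurface parametrized over the sphere -/

section JetFrames

variable {n : ℕ}

/-- A frame `yᵢ` of the tangent space of the sphere at `p`, its image `xᵢ` under the differential
`1 + ∇u` recorded in the jet `j`, and a unit normal to the latter. -/
structure JetFrame (p : USphere n) (j : PairJet n) (Y X : Fin n → Ambient n) (N : Ambient n) :
    Prop where
  isUnit : IsUnit (jetMetric ((p : Ambient n), j))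
  linearIndependent : LinearIndependent ℝ Y
  inner_left : ∀ i, inner ℝ (p : Ambient n) (Y i) = (0 : ℝ)
  diff : ∀ i, jetDiff ((p : Ambient n), j) (Y i) = X i
  linearIndependent' : LinearIndependent ℝ X
  unit : inner ℝ N N = (1 : ℝ)
  normal : ∀ i, inner ℝ N (X i) = (0 : ℝ)

/-- The vectors `gⁱʲ yⱼ`, for the metric `g` of the frame `xᵢ`. -/
noncomputable def raisedFrame (Y X : Fin n → Ambient n) (i : Fin n) : Ambient n :=
  ∑ j, (Matrix.gram ℝ X)⁻¹ i j • Y j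

lemma sum_gram_inv_smul {V : Type*} [NormedAddCommGroup V] [NormedSpace ℝ V]
    (Y X : Fin n → Ambient n) (Ψ : Fin n → Ambient n →L[ℝ] V) :
    ∑ i, ∑ j, (Matrix.gram ℝ X)⁻¹ i j • Ψ i (Y j) = ∑ i, Ψ i (raisedFrame Y X i) := by
  simp only [raisedFrame, map_sum, map_smul]

lemma sum_inner_smul_raisedFrame (Y X : Fin n → Ambient n) (c : Ambient n) :
    ∑ i, (inner ℝ (X i) c : ℝ) • raisedFrame Y X i =
      ∑ i, (inner ℝ c (dualFrame X i) : ℝ) • Y i := by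
  simp only [raisedFrame, inner_dualFrame_left, Finset.smul_sum, Finset.sum_smul, smul_smul]
  rw [Finset.sum_comm]
  refine Finset.sum_congr rfl fun i _ => Finset.sum_congr rfl fun k _ => ?_
  rw [gram_inv_symm, real_inner_comm, mul_comm]

lemma sum_inner_ambientBasis_smul (a : Ambient n) :
    ∑ α, (inner ℝ a (ambientBasis α) : ℝ) • ambientBasis α = a := by
  have h := (EuclideanSpace.basisFun (Fin (n + 1)) ℝ).sum_repr' a
  simpa [real_inner_comm] using h

/-- The trace of `Ψ` with respect to a sum `∑ yᵢ ⊗ dᵢ` of rank one maps. -/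
lemma sum_ambientBasis_of_eq_sum {V : Type*} [NormedAddCommGroup V] [NormedSpace ℝ V]
    {K : Ambient n →L[ℝ] Ambient n} {Y D : Fin n → Ambient n}
    (hK : ∀ a, K a = ∑ i, (inner ℝ (Y i) a : ℝ) • D i) (Ψ : Ambient n →L[ℝ] Ambient n →L[ℝ] V) :
    ∑ α, Ψ (ambientBasis α) (K (ambientBasis α)) = ∑ i, Ψ (Y i) (D i) := by
  simp only [hK, map_sum, map_smul]
  rw [Finset.sum_comm]
  refine Finset.sum_congr rfl fun i _ => ?_
  conv_rhs => rw [← sum_inner_ambientBasis_smul (Y i)]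
  simp only [map_sum, map_smul, FunLike.coe_sum, Finset.sum_apply, smul_apply]

/-- The projection to the tangent space of the sphere in terms of a tangent frame. -/
lemma tangentProj_eq_sum {p : USphere n} {Y : Fin n → Ambient n} (hY : LinearIndependent ℝ Y)
    (hpY : ∀ i, inner ℝ (p : Ambient n) (Y i) = (0 : ℝ)) (a : Ambient n) :
    tangentProj (p : Ambient n) a = ∑ i, (inner ℝ (Y i) a : ℝ) • dualFrame Y i := by
  have h := eq_normal_add_tangent hY (inner_self_usphere p) hpY a
  have h2 := sum_inner_smul_raisedFrame Y Y a
  rw [tangentProj_apply, real_inner_comm]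
  rw [sub_eq_iff_eq_add']
  exact h.trans (congrArg _ h2.symm)

namespace JetFrame

variable {p : USphere n} {j : PairJet n} {Y X : Fin n → Ambient n} {N : Ambient n}
  (h : JetFrame p j Y X N)
include h

lemma diff_raisedFrame (i : Fin n) :
    jetDiff ((p : Ambient n), j) (raisedFrame Y X i) = dualFrame X i := by
  simp only [raisedFrame, map_sum, map_smul, h.diff, dualFrame]

/-- The ambient inverse metric is `gⁱʲ yᵢ ⊗ yⱼ`. -/
lemma jetMetricInv_apply (a : Ambient n) : jetMetricInv ((p : Ambient n), j) a =
    ∑ i, (inner ℝ (Y i) a : ℝ) • raisedFrame Y X i := by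
  set b := ∑ i, (inner ℝ (Y i) a : ℝ) • raisedFrame Y X i
  set G := jetMetric ((p : Ambient n), j)
  set D := jetDiff ((p : Ambient n), j)
  have hpY : ∀ i, inner ℝ (p : Ambient n) (raisedFrame Y X i) = (0 : ℝ) := fun i => by
    simp only [raisedFrame, inner_sum, inner_smul_right, h.inner_left, mul_zero,
      Finset.sum_const_zero]
  have hpb : inner ℝ (p : Ambient n) b = (0 : ℝ) := by
    simp only [b, inner_sum, inner_smul_right, hpY, mul_zero, Finset.sum_const_zero]
  have hPb : tangentProj (p : Ambient n) b = b := by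
    rw [tangentProj_apply, hpb, zero_smul, sub_zero]
  have hPY : ∀ k, tangentProj (p : Ambient n) (Y k) = Y k := fun k => by
    rw [tangentProj_apply, h.inner_left, zero_smul, sub_zero]
  have hDb : D b = ∑ i, (inner ℝ (Y i) a : ℝ) • dualFrame X i := by
    simp only [b, map_sum, map_smul, D, h.diff_raisedFrame]
  -- `b` solves `G b = P a`, as both sides have the same inner products with `p` and with `yₖ`
  have hGb : G b = tangentProj (p : Ambient n) a := by
    have h1 : G b = tangentProj (p : Ambient n)
        (ContinuousLinearMap.adjoint D (D (tangentProj (p : Ambient n) b))) +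
          (b - tangentProj (p : Ambient n) b) := rfl
    rw [h1, hPb, sub_self, add_zero, ← sub_eq_zero, ← map_sub]
    refine eq_zero_of_orthogonal_frame h.linearIndependent (inner_self_usphere p) h.inner_left
      ?_ fun k => ?_
    · rw [real_inner_comm, inner_tangentProj_self]
    · rw [inner_tangentProj_comm, hPY, inner_sub_left, ContinuousLinearMap.adjoint_inner_left,
        hDb, h.diff, sum_inner, sub_eq_zero]
      have h2 : ∀ i, (inner ℝ (dualFrame X i) (X k) : ℝ) = if i = k then 1 else 0 := fun i => by
        rw [real_inner_comm, inner_dualFrame h.linearIndependent']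
      simp only [inner_smul_left, h2, RCLike.conj_to_real]
      simp [real_inner_comm]
  have h3 : jetMetricInv ((p : Ambient n), j) a =
      tangentProj (p : Ambient n) (Ring.inverse G (tangentProj (p : Ambient n) a)) := rfl
  have h4 : Ring.inverse G (G b) = b :=
    congrArg (fun L => L b) (Ring.inverse_mul_cancel _ h.isUnit)
  rw [h3, ← hGb, h4, hPb]

/-- The pullback takes `xᵢ` to `yᵢ` and `N` to zero. -/
lemma jetPullback_apply (c : Ambient n) : jetPullback ((p : Ambient n), j) c =
    ∑ i, (inner ℝ c (dualFrame X i) : ℝ) • Y i := by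
  have h1 : jetPullback ((p : Ambient n), j) c = jetMetricInv ((p : Ambient n), j)
      (ContinuousLinearMap.adjoint (jetDiff ((p : Ambient n), j)) c) := rfl
  rw [h1, h.jetMetricInv_apply, ← sum_inner_smul_raisedFrame]
  simp only [ContinuousLinearMap.adjoint_inner_right, h.diff]

/-- The trace with respect to the metric of `x`, in ambient and in frame components. -/
lemma sum_ambientBasis {V : Type*} [NormedAddCommGroup V] [NormedSpace ℝ V]
    (Ψ : Ambient n →L[ℝ] Ambient n →L[ℝ] V) :
    ∑ α, Ψ (ambientBasis α) (jetMetricInv ((p : Ambient n), j) (ambientBasis α)) =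
      ∑ i, ∑ k, (Matrix.gram ℝ X)⁻¹ i k • Ψ (Y i) (Y k) := by
  rw [sum_ambientBasis_of_eq_sum h.jetMetricInv_apply, sum_gram_inv_smul Y X fun i => Ψ (Y i)]

/-- The component of `p` normal to `x` is `⟨p, N⟩ N`, so that the normal of the jet is `N` if `N` is
outward. -/
lemma jetNormal_eq (hpN : 0 < (inner ℝ N (p : Ambient n) : ℝ)) :
    jetNormal ((p : Ambient n), j) = N := by
  have h1 : jetNormalVec ((p : Ambient n), j) = (inner ℝ (p : Ambient n) N : ℝ) • N := by
    have h2 := eq_normal_add_tangent h.linearIndependent' h.unit h.normal (p : Ambient n)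
    have h3 : jetNormalVec ((p : Ambient n), j) =
        p - jetDiff ((p : Ambient n), j) (jetPullback ((p : Ambient n), j) p) := rfl
    rw [h3, h.jetPullback_apply, map_sum]
    simp only [map_smul, h.diff]
    rw [sub_eq_iff_eq_add]
    exact h2
  have hN : ‖N‖ = 1 := by
    have := h.unit
    rw [real_inner_self_eq_norm_sq] at this
    exact (pow_eq_one_iff_of_nonneg (norm_nonneg N) two_ne_zero).1 this
  rw [jetNormal, h1, norm_smul, hN, mul_one, real_inner_comm, Real.norm_of_nonneg hpN.le,
    smul_smul, inv_mul_cancel₀ hpN.ne', one_smul]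

lemma jetTraceHess_eq : jetTraceHess ((p : Ambient n), j) =
    ∑ i, ∑ k, (Matrix.gram ℝ X)⁻¹ i k • jetHess ((p : Ambient n), j) (Y i) (Y k) :=
  h.sum_ambientBasis _

lemma jetTrace_eq : jetTrace ((p : Ambient n), j) =
    ∑ i, ∑ k, (Matrix.gram ℝ X)⁻¹ i k * inner ℝ (Y i) (Y k) :=
  h.sum_ambientBasis (ambientInner n)

lemma jetNormSq_eq : jetNormSq ((p : Ambient n), j) =
    ∑ i, ∑ j', ∑ k, ∑ l, (Matrix.gram ℝ X)⁻¹ i k * (Matrix.gram ℝ X)⁻¹ j' l *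
      inner ℝ (jetNormal ((p : Ambient n), j)) (jetHess ((p : Ambient n), j) (Y i) (Y j')) *
      inner ℝ (jetNormal ((p : Ambient n), j)) (jetHess ((p : Ambient n), j) (Y k) (Y l)) := by
  set K := jetMetricInv ((p : Ambient n), j)
  set T : Ambient n →L[ℝ] Ambient n →L[ℝ] ℝ :=
    (ContinuousLinearMap.compL ℝ (Ambient n) (Ambient n) ℝ
      (ambientInner n (jetNormal ((p : Ambient n), j)))).comp (jetHess ((p : Ambient n), j))
  have hT : ∀ v w, inner ℝ (jetNormal ((p : Ambient n), j)) (jetHess ((p : Ambient n), j) v w) =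
      T v w := fun _ _ => rfl
  have h1 : jetNormSq ((p : Ambient n), j) =
      ∑ α, ∑ β, T (ambientBasis α) (ambientBasis β) * T (K (ambientBasis α)) (K (ambientBasis β)) :=
    rfl
  have h2 : ∀ f g : Ambient n →L[ℝ] ℝ, ∑ α, f (ambientBasis α) * g (K (ambientBasis α)) =
      ∑ i, f (Y i) * g (raisedFrame Y X i) := fun f g =>
    sum_ambientBasis_of_eq_sum h.jetMetricInv_apply (f.smulRight g)
  have h3 : ∀ v w, ∑ β, T v (ambientBasis β) * T w (K (ambientBasis β)) =
      ∑ i, T v (Y i) * T w (raisedFrame Y X i) := fun v w => h2 (T v) (T w)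
  have h4 : ∀ i, ∑ α, T (ambientBasis α) (Y i) * T (K (ambientBasis α)) (raisedFrame Y X i) =
      ∑ k, T (Y k) (Y i) * T (raisedFrame Y X k) (raisedFrame Y X i) := fun i =>
    h2 (T.flip (Y i)) (T.flip (raisedFrame Y X i))
  simp only [hT]
  rw [h1]
  simp only [h3]
  rw [Finset.sum_comm]
  simp only [h4]
  rw [Finset.sum_comm]
  refine Finset.sum_congr rfl fun i _ => Finset.sum_congr rfl fun k _ => ?_
  simp only [raisedFrame, map_sum, map_smul, FunLike.coe_sum, Finset.sum_apply, smul_apply,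
    Finset.mul_sum, smul_eq_mul]
  rw [Finset.sum_comm]
  refine Finset.sum_congr rfl fun a _ => Finset.sum_congr rfl fun b _ => ?_
  ring

lemma jetCross_eq : jetCross ((p : Ambient n), j) =
    ∑ i, ∑ k, (Matrix.gram ℝ X)⁻¹ i k * inner ℝ (jetNormal ((p : Ambient n), j))
      (jetHess ((p : Ambient n), j) (Y k)
        (jetPullback ((p : Ambient n), j) (j.1.2.1 (Y i)))) := by
  have h1 := h.sum_ambientBasis
    ((ContinuousLinearMap.compL ℝ (Ambient n) (Ambient n) ℝ
      (ambientInner n (jetNormal ((p : Ambient n), j)))).comp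
      ((jetHess ((p : Ambient n), j)).flip.comp
        ((jetPullback ((p : Ambient n), j)).comp j.1.2.1)))
  exact h1

lemma jetSphereLaplacian_eq : jetSphereLaplacian ((p : Ambient n), j) =
    ∑ i, ∑ k, (Matrix.gram ℝ Y)⁻¹ i k * j.2.2.2 (Y i) (Y k) := by
  have h1 := sum_ambientBasis_of_eq_sum (tangentProj_eq_sum h.linearIndependent h.inner_left)
    j.2.2.2
  have h2 := sum_gram_inv_smul Y Y fun i => j.2.2.2 (Y i)
  exact h1.trans h2.symm

end JetFrame

end JetFrames

/-! ### The evolution equation in terms of the jet -/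

section JetEvolution

variable {n : ℕ} {Z : Type*} [NormedAddCommGroup Z] [NormedSpace ℝ Z]
  {V : Type*} [NormedAddCommGroup V] [NormedSpace ℝ V]
  {U : Set Z} {e : Fin n → Z} {x ν y η : Z → Ambient n} {z : Z}

namespace HypersurfaceFrame

lemma inner_frame_frameDual (h : HypersurfaceFrame U e x ν) (hz : z ∈ U) (i k : Fin n) :
    inner ℝ (frameDual e x z i) (dirDeriv (e k) x z) = if i = k then (1 : ℝ) else 0 := by
  rw [real_inner_comm]
  exact inner_dualFrame (h.linearIndependent z hz) i k

/-- Covariant derivatives with respect to the metrics of two hypersurfaces: the difference of the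
Christoffel symbols is the tangential part of `∇ᵢ∇ⱼ x`. -/
lemma frameCovHess_sub (h : HypersurfaceFrame U e x ν) (hz : z ∈ U) (φ : Z → V) (i j : Fin n) :
    frameCovHess e x φ z i j = frameCovHess e y φ z i j -
      ∑ k, (inner ℝ (frameDual e x z k) (frameCovHess e y x z i j) : ℝ) • dirDeriv (e k) φ z := by
  have h1 : ∀ k, (inner ℝ (frameDual e x z k) (frameCovHess e y x z i j) : ℝ) =
      inner ℝ (frameDual e x z k) (dirDeriv (e i) (dirDeriv (e j) x) z) -
      inner ℝ (frameDual e y z k) (dirDeriv (e i) (dirDeriv (e j) y) z) := by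
    intro k
    rw [frameCovHess, inner_sub_right, inner_sum]
    simp only [inner_smul_right, h.inner_frame_frameDual hz]
    simp
  simp only [h1, sub_smul, Finset.sum_sub_distrib]
  rw [frameCovHess, frameCovHess]
  abel

/-- The second fundamental form by the second covariant derivative of `x` with respect to another
metric. -/
lemma secondFF_eq_covHess (h : HypersurfaceFrame U e x ν) (hz : z ∈ U) (i j : Fin n) :
    frameSecondFF e x ν z i j = -(inner ℝ (ν z) (frameCovHess e y x z i j) : ℝ) := by
  rw [frameSecondFF, frameCovHess, inner_sub_right, inner_sum]
  simp only [inner_smul_right, h.normal z hz, mul_zero, Finset.sum_const_zero, sub_zero]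

/-- The second covariant derivative of the position vector of a sphere is normal. -/
lemma frameCovHess_self_of_eq_smul (hS : HypersurfaceFrame U e y η) (hz : z ∈ U) {c : ℝ}
    (hc0 : c ≠ 0) (hc : ∀ z ∈ U, y z = c • η z) (i j : Fin n) :
    frameCovHess e y y z i j =
      -((c⁻¹ * inner ℝ (dirDeriv (e i) y z) (dirDeriv (e j) y z)) • η z) := by
  have h1 := eq_normal_add_tangent (hS.linearIndependent z hz) (hS.unit z hz) (hS.normal z hz)
    (dirDeriv (e i) (dirDeriv (e j) y) z)
  have h2 := hS.secondFF_of_eq_smul hz hc i j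
  have h3 : frameCovHess e y y z i j =
      (inner ℝ (dirDeriv (e i) (dirDeriv (e j) y) z) (η z) : ℝ) • η z := by
    rw [frameCovHess, sub_eq_iff_eq_add]
    simp only [real_inner_comm (dirDeriv (e i) (dirDeriv (e j) y) z) (frameDual e y z _)]
    exact h1
  rw [h3, ← h2, frameSecondFF, ← neg_smul, real_inner_comm (η z)]
  congr 1
  field_simp

end HypersurfaceFrame

lemma frameCovHess_sub_apply {f g : Z → V} (hU : IsOpen U) (hz : z ∈ U) (hf : ContDiffOn ℝ ∞ f U)
    (hg : ContDiffOn ℝ ∞ g U) (i j : Fin n) :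
    frameCovHess e x (fun z => f z - g z) z i j =
      frameCovHess e x f z i j - frameCovHess e x g z i j := by
  have h1 : ∀ k, ∀ z' ∈ U, dirDeriv (e k) (fun z => f z - g z) z' =
      dirDeriv (e k) f z' - dirDeriv (e k) g z' := fun k z' hz' =>
    dirDeriv_sub (hf.differentiableAt_of_isOpen hU hz') (hg.differentiableAt_of_isOpen hU hz') _
  rw [frameCovHess, dirDeriv_congr hU hz (h1 j),
    dirDeriv_sub ((hf.dirDeriv hU _).differentiableAt_of_isOpen hU hz)
      ((hg.dirDeriv hU _).differentiableAt_of_isOpen hU hz)]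
  simp only [h1 _ z hz, smul_sub, Finset.sum_sub_distrib, frameCovHess]
  abel

/-- The hypersurface `x` is parametrized over the sphere `y` of radius `√n` with outer normal `η`,
and `j` is the jet of `x - y` and `⟨x - y, ν⟩` at the point `p` of the sphere. Its covariant
derivatives are prescribed on the coordinate vectors of the sphere. At `p` the formal metric of `j`
is nondegenerate and `ν` is outward. -/
structure IsDisplacementJet (U : Set Z) (e : Fin n → Z) (x ν y η : Z → Ambient n) (z : Z)
    (p : USphere n) (j : PairJet n) : Prop where
  frame : HypersurfaceFrame U e x ν
  sphere : HypersurfaceFrame U e y η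
  mem : z ∈ U
  eq_smul : ∀ z ∈ U, y z = Real.sqrt n • η z
  eq_coe : η z = p
  displacement : j.1.1 = x z - y z
  gradient : ∀ i, j.1.2.1 (dirDeriv (e i) y z) = dirDeriv (e i) (fun z => x z - y z) z
  hessian : ∀ i k, j.1.2.2 (dirDeriv (e i) y z) (dirDeriv (e k) y z) =
    frameCovHess e y (fun z => x z - y z) z i k
  normalDisplacement : j.2.1 = inner ℝ (x z - y z) (ν z)
  normalGradient : ∀ i, j.2.2.1 (dirDeriv (e i) y z) =
    dirDeriv (e i) (fun z => (inner ℝ (x z - y z) (ν z) : ℝ)) z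
  normalHessian : ∀ i k, j.2.2.2 (dirDeriv (e i) y z) (dirDeriv (e k) y z) =
    frameCovHess e y (fun z => (inner ℝ (x z - y z) (ν z) : ℝ)) z i k
  isUnit : IsUnit (jetMetric ((p : Ambient n), j))
  outward : 0 < (inner ℝ (ν z) (p : Ambient n) : ℝ)

namespace IsDisplacementJet

variable {p : USphere n} {j : PairJet n} (h : IsDisplacementJet U e x ν y η z p j)
include h

lemma jetFrame : JetFrame p j (fun i => dirDeriv (e i) y z) (fun i => dirDeriv (e i) x z)
    (ν z) where
  isUnit := h.isUnit
  linearIndependent := h.sphere.linearIndependent z h.mem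
  inner_left := fun i => h.eq_coe ▸ h.sphere.normal z h.mem i
  diff := fun i => by
    have h1 : jetDiff ((p : Ambient n), j) (dirDeriv (e i) y z) =
      dirDeriv (e i) y z + j.1.2.1 (dirDeriv (e i) y z) := rfl
    rw [h1, h.gradient, dirDeriv_sub (h.frame.differentiableAt h.mem)
      (h.sphere.differentiableAt h.mem), add_sub_cancel]
  linearIndependent' := h.frame.linearIndependent z h.mem
  unit := h.frame.unit z h.mem
  normal := h.frame.normal z h.mem

lemma jetNormal_eq : jetNormal ((p : Ambient n), j) = ν z := h.jetFrame.jetNormal_eq h.outward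

lemma jetPullback_eq (c : Ambient n) : jetPullback ((p : Ambient n), j) c =
    ∑ i, (inner ℝ c (frameDual e x z i) : ℝ) • dirDeriv (e i) y z := h.jetFrame.jetPullback_apply c

variable (hn : 1 ≤ n)
include hn

lemma jetHess_eq (i k : Fin n) :
    jetHess ((p : Ambient n), j) (dirDeriv (e i) y z) (dirDeriv (e k) y z) =
      frameCovHess e y x z i k := by
  rw [jetHess_apply, h.hessian, frameCovHess_sub_apply h.frame.isOpen h.mem h.frame.smooth
    h.sphere.smooth, h.sphere.frameCovHess_self_of_eq_smul h.mem
      (Real.sqrt_pos.2 (by exact_mod_cast hn)).ne' h.eq_smul, h.eq_coe]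
  abel

lemma jetTraceHess_eq : jetTraceHess ((p : Ambient n), j) =
    ∑ i, ∑ k, frameMetricInv e x z i k • frameCovHess e y x z i k := by
  rw [h.jetFrame.jetTraceHess_eq]
  simp only [h.jetHess_eq hn]
  rfl

lemma meanCurvature_eq : frameMeanCurvature e x ν z =
    -(inner ℝ (ν z) (jetTraceHess ((p : Ambient n), j)) : ℝ) := by
  simp only [h.jetTraceHess_eq hn, inner_sum, inner_smul_right, frameMeanCurvature,
    h.frame.secondFF_eq_covHess (y := y) h.mem, mul_neg, Finset.sum_neg_distrib]

lemma normSq_eq : frameNormSq e x ν z = jetNormSq ((p : Ambient n), j) := by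
  rw [h.jetFrame.jetNormSq_eq, h.jetNormal_eq]
  simp only [h.jetHess_eq hn, frameNormSq, h.frame.secondFF_eq_covHess (y := y) h.mem]
  refine Finset.sum_congr rfl fun a _ => Finset.sum_congr rfl fun b _ =>
    Finset.sum_congr rfl fun c _ => Finset.sum_congr rfl fun d _ => ?_
  simp only [frameMetricInv]
  ring

/-- `Δ φ` with respect to the metric of `x`, by the covariant derivatives of the sphere. -/
lemma frameLaplacian_eq (φ : Z → V) {a : Ambient n →L[ℝ] V}
    (ha : ∀ i, a (dirDeriv (e i) y z) = dirDeriv (e i) φ z) :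
    frameLaplacian e x φ z = ∑ i, ∑ k, frameMetricInv e x z i k • frameCovHess e y φ z i k -
      a (jetPullback ((p : Ambient n), j) (jetTraceHess ((p : Ambient n), j))) := by
  have h1 : a (jetPullback ((p : Ambient n), j) (jetTraceHess ((p : Ambient n), j))) =
      ∑ i, ∑ k, frameMetricInv e x z i k • ∑ l, (inner ℝ (frameDual e x z l)
        (frameCovHess e y x z i k) : ℝ) • dirDeriv (e l) φ z := by
    rw [h.jetPullback_eq, map_sum]
    simp only [map_smul, ha]
    simp only [h.jetTraceHess_eq hn, sum_inner, inner_smul_left, RCLike.conj_to_real,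
      Finset.sum_smul, Finset.smul_sum, mul_smul]
    rw [Finset.sum_comm]
    refine Finset.sum_congr rfl fun a _ => ?_
    rw [Finset.sum_comm]
    refine Finset.sum_congr rfl fun b _ => Finset.sum_congr rfl fun c _ => ?_
    rw [real_inner_comm]
  rw [h1, frameLaplacian, ← Finset.sum_sub_distrib]
  refine Finset.sum_congr rfl fun i _ => ?_
  rw [← Finset.sum_sub_distrib]
  refine Finset.sum_congr rfl fun k _ => ?_
  rw [h.frame.frameCovHess_sub (y := y) h.mem, smul_sub]

lemma laplacian_normalDisplacement :
    frameLaplacian e x (fun z => (inner ℝ (x z - y z) (ν z) : ℝ)) z =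
      jetLaplacian ((p : Ambient n), j) := by
  rw [h.frameLaplacian_eq hn _ h.normalGradient]
  have h1 := h.jetFrame.sum_ambientBasis j.2.2.2
  simp only [h.normalHessian] at h1
  rw [jetLaplacian]
  exact congrArg (· - _) h1.symm

lemma inner_base : inner ℝ (y z + frameLaplacian e x y z) (ν z) =
    jetBase ((p : Ambient n), j) := by
  have h1 := h.frameLaplacian_eq hn y (a := ContinuousLinearMap.id ℝ (Ambient n)) fun i => rfl
  have h2 : ∑ i, ∑ k, frameMetricInv e x z i k • frameCovHess e y y z i k =
      -(((Real.sqrt n)⁻¹ * jetTrace ((p : Ambient n), j)) • (p : Ambient n)) := by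
    rw [h.jetFrame.jetTrace_eq, Finset.mul_sum, Finset.sum_smul, ← Finset.sum_neg_distrib]
    refine Finset.sum_congr rfl fun i _ => ?_
    rw [Finset.mul_sum, Finset.sum_smul, ← Finset.sum_neg_distrib]
    refine Finset.sum_congr rfl fun k _ => ?_
    rw [h.sphere.frameCovHess_self_of_eq_smul h.mem
      (Real.sqrt_pos.2 (by exact_mod_cast hn)).ne' h.eq_smul, h.eq_coe, smul_neg, smul_smul]
    congr 2
    exact mul_left_comm _ _ _
  rw [h1, h2, h.eq_smul z h.mem, h.eq_coe, jetBase, h.jetNormal_eq]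
  simp only [inner_add_left, inner_sub_left, inner_neg_left, inner_smul_left, RCLike.conj_to_real,
    ContinuousLinearMap.id_apply]
  ring

/-- The derivative of the normal in terms of the second covariant derivative of `x`. -/
lemma inner_dirDeriv_normal (c : Ambient n) (i : Fin n) :
    inner ℝ c (dirDeriv (e i) ν z) = -(inner ℝ (ν z) (jetHess ((p : Ambient n), j)
      (dirDeriv (e i) y z) (jetPullback ((p : Ambient n), j) c)) : ℝ) := by
  rw [h.frame.inner_eq h.mem, h.frame.inner_dirDeriv_normal_self h.mem, mul_zero, zero_add,
    h.jetPullback_eq, map_sum, inner_sum, ← Finset.sum_neg_distrib]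
  refine Finset.sum_congr rfl fun k _ => ?_
  rw [map_smul, inner_smul_right, h.jetHess_eq hn, ← h.frame.secondFF_eq h.mem,
    h.frame.secondFF_eq_covHess (y := y) h.mem]
  ring

lemma sum_inner_gradient_normal : ∑ i, ∑ k, frameMetricInv e x z i k *
    inner ℝ (dirDeriv (e i) (fun z => x z - y z) z) (dirDeriv (e k) ν z) =
      -jetCross ((p : Ambient n), j) := by
  rw [h.jetFrame.jetCross_eq, h.jetNormal_eq, ← Finset.sum_neg_distrib]
  refine Finset.sum_congr rfl fun i _ => ?_
  rw [← Finset.sum_neg_distrib]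
  refine Finset.sum_congr rfl fun k _ => ?_
  rw [h.inner_dirDeriv_normal hn, h.gradient, mul_neg]
  rfl

/-- The contribution of a vector `c` in place of `∂ₜx - x`. -/
lemma sum_inner_displacement_normal (c : Ambient n) :
    ∑ i, inner ℝ (x z - y z) (frameDual e x z i) * inner ℝ c (dirDeriv (e i) ν z) =
      -(inner ℝ (ν z) (jetHess ((p : Ambient n), j) (jetPullback ((p : Ambient n), j) j.1.1)
        (jetPullback ((p : Ambient n), j) c)) : ℝ) := by
  rw [h.displacement, h.jetPullback_eq (x z - y z), map_sum, FunLike.coe_sum, Finset.sum_apply,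
    inner_sum, ← Finset.sum_neg_distrib]
  refine Finset.sum_congr rfl fun i _ => ?_
  rw [h.inner_dirDeriv_normal hn, map_smul, smul_apply, inner_smul_right, mul_neg]

omit hn in
lemma sphereLaplacian_eq :
    frameLaplacian e y (fun z => (inner ℝ (x z - y z) (ν z) : ℝ)) z =
      jetSphereLaplacian ((p : Ambient n), j) := by
  rw [h.jetFrame.jetSphereLaplacian_eq]
  simp only [h.normalHessian]
  rfl

variable {τ : Z} (hflow : ∀ z ∈ U, inner ℝ (dirDeriv τ x z) (ν z) =
    - frameMeanCurvature e x ν z + inner ℝ (x z) (ν z)) (hτ : dirDeriv τ y z = 0)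
include hflow hτ

/-- The evolution equation in terms of the jet, up to the contribution of the tangential
velocity. -/
lemma dirDeriv_normalDisplacement :
    dirDeriv τ (fun z => (inner ℝ (x z - y z) (ν z) : ℝ)) z =
      jetSphereLaplacian ((p : Ambient n), j) + 2 * j.2.1 + flowTerm ((p : Ambient n), j) -
        inner ℝ (ν z) (jetHess ((p : Ambient n), j) (jetPullback ((p : Ambient n), j) j.1.1)
          (jetPullback ((p : Ambient n), j) (dirDeriv τ x z - x z))) := by
  rw [h.frame.dirDeriv_normal_displacement h.mem hflow h.sphere.smooth hτ,
    h.laplacian_normalDisplacement hn, h.normSq_eq hn, h.inner_base hn,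
    h.sum_inner_gradient_normal hn, h.sum_inner_displacement_normal hn, ← h.normalDisplacement,
    flowTerm]
  ring

lemma dirDeriv_normalDisplacement_of_flow
    (hx : dirDeriv τ x z = -(frameMeanCurvature e x ν z • ν z) + x z) :
    dirDeriv τ (fun z => (inner ℝ (x z - y z) (ν z) : ℝ)) z =
      jetSphereLaplacian ((p : Ambient n), j) + 2 * j.2.1 + flowTerm ((p : Ambient n), j) := by
  have h1 : jetPullback ((p : Ambient n), j) (dirDeriv τ x z - x z) = 0 := by
    rw [hx, add_sub_cancel_right, h.jetPullback_eq]
    refine Finset.sum_eq_zero fun i _ => ?_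
    rw [inner_frameDual]
    simp only [inner_neg_left, inner_smul_left, h.frame.normal z h.mem, mul_zero, neg_zero,
      Finset.sum_const_zero, zero_smul]
  rw [h.dirDeriv_normalDisplacement hn hflow hτ, h1, map_zero, inner_zero_right, sub_zero]

/-- For radial graphs the vector `∂ₜ x - x` is a multiple of `p`, and its normal component
determines it. -/
lemma dirDeriv_normalDisplacement_of_radial {c : ℝ}
    (hx : dirDeriv τ x z - x z = c • (p : Ambient n)) :
    dirDeriv τ (fun z => (inner ℝ (x z - y z) (ν z) : ℝ)) z =
      jetSphereLaplacian ((p : Ambient n), j) + 2 * j.2.1 + radialTerm ((p : Ambient n), j) := by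
  have hp : (inner ℝ (p : Ambient n) (ν z) : ℝ) ≠ 0 := by
    rw [real_inner_comm]; exact h.outward.ne'
  have h1 : c = inner ℝ (ν z) (jetTraceHess ((p : Ambient n), j)) /
      inner ℝ (p : Ambient n) (ν z) := by
    rw [eq_div_iff hp, ← neg_inj, ← h.meanCurvature_eq hn]
    have h2 := congrArg (fun a => (inner ℝ a (ν z) : ℝ)) hx
    simp only [inner_sub_left, inner_smul_left, RCLike.conj_to_real, hflow z h.mem] at h2
    linarith
  rw [h.dirDeriv_normalDisplacement hn hflow hτ, hx, map_smul, map_smul, inner_smul_right, h1,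
    radialTerm, jetRadial, h.jetNormal_eq]
  ring

end IsDisplacementJet

end JetEvolution

/-! ### Surfaces close to the sphere -/

section CovariantJet

variable {n : ℕ} {M : Type*} [TopologicalSpace M] [ChartedSpace (EuclideanSpace ℝ (Fin n)) M]
  [IsManifold (𝓡 n) ∞ M] {T : Type*} [NormedAddCommGroup T] [NormedSpace ℝ T]
  {V : Type*} [NormedAddCommGroup V] [NormedSpace ℝ V]

lemma HypersurfaceFrame.sum_metricInv_inner {Z : Type*} [NormedAddCommGroup Z] [NormedSpace ℝ Z]
    {U : Set Z} {e : Fin n → Z} {x ν : Z → Ambient n} {z : Z} (h : HypersurfaceFrame U e x ν)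
    (hz : z ∈ U) (i k : Fin n) : ∑ a, frameMetricInv e x z i a *
      inner ℝ (dirDeriv (e a) x z) (dirDeriv (e k) x z) = if i = k then (1 : ℝ) else 0 := by
  rw [← h.inner_frame_frameDual hz, real_inner_comm, inner_frameDual]
  simp only [real_inner_comm]

/-- Contraction of `H` with two vectors whose components, after raising the index, are those of
coordinate vectors. -/
lemma sum_smul_of_dual {g : Matrix (Fin n) (Fin n) ℝ} {c d : Fin n → ℝ} {k l : Fin n}
    (hc : ∀ i, ∑ a, g i a * c a = if i = k then 1 else 0)
    (hd : ∀ i, ∑ a, g i a * d a = if i = l then 1 else 0) (H : Fin n → Fin n → V) :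
    ∑ i, ∑ j, ∑ a, ∑ b, (g i a * g j b) • c a • d b • H i j = H k l := by
  have h1 : ∀ i j, ∑ a, ∑ b, (g i a * g j b) • c a • d b • H i j =
      ((if i = k then 1 else 0) * if j = l then 1 else 0 : ℝ) • H i j := by
    intro i j
    rw [← hc, ← hd, Finset.sum_mul_sum, Finset.sum_smul]
    refine Finset.sum_congr rfl fun a _ => ?_
    rw [Finset.sum_smul]
    refine Finset.sum_congr rfl fun b _ => ?_
    rw [smul_smul, smul_smul]
    congr 1
    ring
  simp [h1]

variable {x : T → M → Ambient n} {N : T × EuclideanSpace ℝ (Fin n) → Ambient n} {K : Set T}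
  (hK : IsOpen K)
  (hx : ContMDiffOn (𝓘(ℝ, T).prod (𝓡 n)) 𝓘(ℝ, EuclideanSpace ℝ (Fin (n + 1))) ∞
      (fun q : T × M => x q.1 q.2) (K ×ˢ (univ : Set M)))
  {θ : T} (hθ : θ ∈ K) (p : M)
  (hF : HypersurfaceFrame (K ×ˢ (extChartAt (𝓡 n) p).target) (coordDir T n)
    (familyInCoords x p) N)
  {φ : M → V} {Φ : T × EuclideanSpace ℝ (Fin n) → V}
  (hΦ : ContDiffOn ℝ ∞ Φ (K ×ˢ (extChartAt (𝓡 n) p).target))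
  (hφ : ∀ y ∈ (extChartAt (𝓡 n) p).target, Φ (θ, y) = inCoords φ p y)
include hK hx hθ hF hΦ hφ

/-- On a coordinate vector the covariant derivative is the partial derivative. -/
lemma covDeriv_apply_frame (k : Fin n) :
    covDeriv (x θ) φ p
      (dirDeriv (coordDir T n k) (familyInCoords x p) (θ, extChartAt (𝓡 n) p p)) =
    dirDeriv (coordDir T n k) Φ (θ, extChartAt (𝓡 n) p p) := by
  have hz : (θ, extChartAt (𝓡 n) p p) ∈ K ×ˢ (extChartAt (𝓡 n) p).target :=
    ⟨hθ, mem_extChartAt_target p⟩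
  have hX : ∀ i, partialAt (x θ) p i =
      dirDeriv (coordDir T n i) (familyInCoords x p) (θ, extChartAt (𝓡 n) p p) :=
    partialAt_eq hK hθ p (contDiffOn_familyInCoords hx p) (fun _ _ => rfl)
  simp only [covDeriv, FunLike.coe_sum, Finset.sum_apply, smul_apply,
    ContinuousLinearMap.smulRight_apply, innerSL_apply_apply, metricInvAt_eq hK hx hθ p, hX,
    partialAt_eq hK hθ p hΦ hφ, smul_smul]
  rw [Finset.sum_comm]
  simp only [← Finset.sum_smul]
  have h1 : ∀ i, ∑ a, frameMetricInv (coordDir T n) (familyInCoords x p)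
      (θ, extChartAt (𝓡 n) p p) a i * inner ℝ
        (dirDeriv (coordDir T n a) (familyInCoords x p) (θ, extChartAt (𝓡 n) p p))
        (dirDeriv (coordDir T n k) (familyInCoords x p) (θ, extChartAt (𝓡 n) p p)) =
      if i = k then (1 : ℝ) else 0 := fun i => by
    rw [← hF.sum_metricInv_inner hz]
    exact Finset.sum_congr rfl fun a _ => by rw [frameMetricInv_symm]
  simp only [h1, ite_smul, one_smul, zero_smul, Finset.sum_ite_eq', Finset.mem_univ, if_true]

/-- On coordinate vectors the second covariant derivative has the components `∇ᵢ∇ⱼ φ`. -/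
lemma covDeriv2_apply_frame (k l : Fin n) :
    covDeriv2 (x θ) φ p
      (dirDeriv (coordDir T n k) (familyInCoords x p) (θ, extChartAt (𝓡 n) p p))
      (dirDeriv (coordDir T n l) (familyInCoords x p) (θ, extChartAt (𝓡 n) p p)) =
    frameCovHess (coordDir T n) (familyInCoords x p) Φ (θ, extChartAt (𝓡 n) p p) k l := by
  have hz : (θ, extChartAt (𝓡 n) p p) ∈ K ×ˢ (extChartAt (𝓡 n) p).target :=
    ⟨hθ, mem_extChartAt_target p⟩
  have hX : ∀ i, partialAt (x θ) p i =
      dirDeriv (coordDir T n i) (familyInCoords x p) (θ, extChartAt (𝓡 n) p p) :=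
    partialAt_eq hK hθ p (contDiffOn_familyInCoords hx p) (fun _ _ => rfl)
  simp only [covDeriv2, FunLike.coe_sum, Finset.sum_apply, smul_apply,
    ContinuousLinearMap.smulRight_apply, innerSL_apply_apply, metricInvAt_eq hK hx hθ p, hX,
    covHessAt_eq hK hx hθ p hΦ hφ]
  exact sum_smul_of_dual (hF.sum_metricInv_inner hz · k) (hF.sum_metricInv_inner hz · l) _

end CovariantJet

section NearSphere

variable {n : ℕ} {I : Set ℝ} {x ν : ℝ → USphere n → Ambient n}

/-- The time direction. -/
noncomputable def timeDir (n : ℕ) : ℝ × EuclideanSpace ℝ (Fin n) := (1, 0)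

lemma hasDerivAt_timeCurve (t : ℝ) (y : EuclideanSpace ℝ (Fin n)) :
    HasDerivAt (fun s : ℝ => (s, y)) (timeDir n) t :=
  (hasDerivAt_id t).prodMk (hasDerivAt_const t y)

/-- In a chart around `p` the jet of the displacement at `p` is the one that the evolution equation
refers to. -/
lemma isDisplacementJet_displacementJet (hn : 1 ≤ n) (hI : IsOpen I)
    (h : IsSmoothHypersurfaceFamily I x ν) {t : ℝ} (ht : t ∈ I) (p : USphere n)
    (hG : IsUnit (jetMetric ((p : Ambient n), displacementJet x ν t p)))
    (hout : 0 < (inner ℝ (ν t p) (p : Ambient n) : ℝ)) :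
    IsDisplacementJet (I ×ˢ (extChartAt (𝓡 n) p).target) (coordDir ℝ n)
      (familyInCoords x p) (familyInCoords ν p) (familyInCoords (fun _ => sphereEmb n) p)
      (familyInCoords (fun _ (q : USphere n) => (q : Ambient n)) p)
      (t, extChartAt (𝓡 n) p p) p (displacementJet x ν t p) := by
  have hF := hypersurfaceFrame_familyInCoords hI h.smooth h.smooth_normal h.isUnitNormal p
  have hS := hypersurfaceFrame_sphere hn hI p
  have hSx := contMDiffOn_static (contMDiff_sphereEmb (n := n)) I
  have hu : ContDiffOn ℝ ∞ (fun z => familyInCoords x p z -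
      familyInCoords (fun _ => sphereEmb n) p z) (I ×ˢ (extChartAt (𝓡 n) p).target) :=
    hF.smooth.sub hS.smooth
  have hw : ContDiffOn ℝ ∞ (fun z => (inner ℝ (familyInCoords x p z -
      familyInCoords (fun _ => sphereEmb n) p z) (familyInCoords ν p z) : ℝ))
      (I ×ˢ (extChartAt (𝓡 n) p).target) := hu.inner ℝ hF.smooth_normal
  have hp : (extChartAt (𝓡 n) p).symm (extChartAt (𝓡 n) p p) = p := extChartAt_to_inv p
  refine ⟨hF, hS, ⟨ht, mem_extChartAt_target p⟩, fun _ _ => rfl, ?_, ?_, fun k => ?_,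
    fun k l => ?_, ?_, fun k => ?_, fun k l => ?_, hG, ?_⟩
  · simp only [familyInCoords, hp]
  · simp only [familyInCoords, hp]
    rfl
  · exact covDeriv_apply_frame (x := fun _ => sphereEmb n) hI hSx ht p hS hu (fun _ _ => rfl) k
  · exact covDeriv2_apply_frame (x := fun _ => sphereEmb n) hI hSx ht p hS hu (fun _ _ => rfl) k l
  · simp only [familyInCoords, hp]
    rfl
  · exact covDeriv_apply_frame (x := fun _ => sphereEmb n) hI hSx ht p hS hw (fun _ _ => rfl) k
  · exact covDeriv2_apply_frame (x := fun _ => sphereEmb n) hI hSx ht p hS hw (fun _ _ => rfl) k l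
  · simp only [familyInCoords, hp]
    exact hout

lemma IsSmoothHypersurfaceFamily.hasDerivAt (hI : IsOpen I)
    (h : IsSmoothHypersurfaceFamily I x ν) (p : USphere n) {t : ℝ} (ht : t ∈ I)
    {y : EuclideanSpace ℝ (Fin n)} (hy : y ∈ (extChartAt (𝓡 n) p).target) :
    HasDerivAt (fun s => x s ((extChartAt (𝓡 n) p).symm y))
      (dirDeriv (timeDir n) (familyInCoords x p) (t, y)) t :=
  ((hypersurfaceFrame_familyInCoords hI h.smooth h.smooth_normal h.isUnitNormal
    p).differentiableAt (z := (t, y)) ⟨ht, hy⟩).hasDerivAt_comp_curve (hasDerivAt_timeCurve t y)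

/-- The normal part of the flow in a chart. -/
lemma IsSmoothHypersurfaceFamily.normal_flow_inCoords (hI : IsOpen I)
    (h : IsSmoothHypersurfaceFamily I x ν) (hflow : IsNormalRescaledMCF I x ν) (p : USphere n) :
    ∀ z ∈ I ×ˢ (extChartAt (𝓡 n) p).target,
      inner ℝ (dirDeriv (timeDir n) (familyInCoords x p) z) (familyInCoords ν p z) =
      - frameMeanCurvature (coordDir ℝ n) (familyInCoords x p) (familyInCoords ν p) z +
        inner ℝ (familyInCoords x p z) (familyInCoords ν p z) := by
  rintro ⟨t, y⟩ ⟨ht, hy⟩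
  have h1 := hflow t ht ((extChartAt (𝓡 n) p).symm y)
  rwa [(h.hasDerivAt hI p ht hy).deriv,
    meanCurvature_eq hI h.smooth ht p (h.isUnitNormal t ht) hy] at h1

lemma dirDeriv_timeDir_sphere (hn : 1 ≤ n) (t : ℝ) (p : USphere n) :
    dirDeriv (timeDir n) (familyInCoords (fun _ => sphereEmb n) p)
      (t, extChartAt (𝓡 n) p p) = 0 := by
  have h1 := ((hypersurfaceFrame_sphere hn isOpen_univ p).differentiableAt
    (z := (t, extChartAt (𝓡 n) p p))
    ⟨mem_univ _, mem_extChartAt_target p⟩).hasDerivAt_comp_curve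
      (hasDerivAt_timeCurve t (extChartAt (𝓡 n) p p))
  exact h1.unique (hasDerivAt_const t
    (sphereEmb n ((extChartAt (𝓡 n) p).symm (extChartAt (𝓡 n) p p))))

/-- The equation of `⟨x - x_{Sⁿ}, ν⟩` follows from its form in a chart. -/
lemma satisfiesSphereEquation_of_inCoords (hn : 1 ≤ n) (hI : IsOpen I)
    (h : IsSmoothHypersurfaceFamily I x ν) {ε : ℝ} {f : Ambient n × PairJet n → ℝ}
    (hε : ∀ (p : USphere n) (j : PairJet n), ‖j‖ < ε → ((p : Ambient n), j) ∈ jetDomain n)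
    (hmain : ∀ t ∈ I, ∀ p : USphere n,
      IsDisplacementJet (I ×ˢ (extChartAt (𝓡 n) p).target) (coordDir ℝ n)
        (familyInCoords x p) (familyInCoords ν p) (familyInCoords (fun _ => sphereEmb n) p)
        (familyInCoords (fun _ (q : USphere n) => (q : Ambient n)) p)
        (t, extChartAt (𝓡 n) p p) p (displacementJet x ν t p) →
      dirDeriv (timeDir n) (fun z => (inner ℝ (familyInCoords x p z -
        familyInCoords (fun _ => sphereEmb n) p z) (familyInCoords ν p z) : ℝ))
        (t, extChartAt (𝓡 n) p p) =
      jetSphereLaplacian ((p : Ambient n), displacementJet x ν t p) +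
        2 * (displacementJet x ν t p).2.1 + f ((p : Ambient n), displacementJet x ν t p)) :
    SatisfiesSphereEquation ε (fun q => f ((q.1 : Ambient n), q.2)) I x ν := by
  intro t ht p hj hout
  have hJ := isDisplacementJet_displacementJet hn hI h ht p (hε p _ hj).1 hout
  have hw := (hJ.frame.smooth.sub hJ.sphere.smooth).inner ℝ hJ.frame.smooth_normal
  have h1 : laplaceBeltrami (sphereEmb n) (normalDisplacement x ν t) p =
      jetSphereLaplacian ((p : Ambient n), displacementJet x ν t p) := by
    rw [← hJ.sphereLaplacian_eq]
    exact laplaceBeltrami_eq (x := fun _ => sphereEmb n) hI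
      (contMDiffOn_static contMDiff_sphereEmb I) ht p hw fun _ _ => rfl
  have h2 := (hw.differentiableAt_of_isOpen hJ.frame.isOpen hJ.mem).hasDerivAt_comp_curve
    (hasDerivAt_timeCurve t (extChartAt (𝓡 n) p p))
  have h3 := hmain t ht p hJ
  rw [h1]
  have h4 := h2.congr_deriv h3
  have hp : (extChartAt (𝓡 n) p).symm (extChartAt (𝓡 n) p p) = p := extChartAt_to_inv p
  simp only [familyInCoords, hp] at h4
  exact h4

lemma IsRescaledMCF.isNormalRescaledMCF (h : IsSmoothHypersurfaceFamily I x ν)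
    (hflow : IsRescaledMCF I x ν) : IsNormalRescaledMCF I x ν := by
  intro t ht p
  rw [(hflow t ht p).deriv, inner_add_left, inner_neg_left, inner_smul_left,
    real_inner_self_eq_norm_sq, (h.isUnitNormal t ht).unit]
  simp

lemma satisfiesSphereEquation_of_isRescaledMCF (hn : 1 ≤ n) {ε : ℝ}
    (hε : ∀ (p : USphere n) (j : PairJet n), ‖j‖ < ε → ((p : Ambient n), j) ∈ jetDomain n)
    (hI : IsOpen I) (h : IsSmoothHypersurfaceFamily I x ν) (hflow : IsRescaledMCF I x ν) :
    SatisfiesSphereEquation ε (fun q => flowTerm ((q.1 : Ambient n), q.2)) I x ν := by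
  refine satisfiesSphereEquation_of_inCoords hn hI h hε fun t ht p hJ => ?_
  refine hJ.dirDeriv_normalDisplacement_of_flow hn
    (h.normal_flow_inCoords hI (hflow.isNormalRescaledMCF h) p)
    (dirDeriv_timeDir_sphere hn t p) ?_
  have hp := mem_extChartAt_target (I := 𝓡 n) p
  have h1 := hflow t ht ((extChartAt (𝓡 n) p).symm (extChartAt (𝓡 n) p p))
  rw [meanCurvature_eq hI h.smooth ht p (h.isUnitNormal t ht) hp] at h1
  exact (h.hasDerivAt hI p ht hp).unique h1

lemma satisfiesSphereEquation_of_isRadialGraph (hn : 1 ≤ n) {ε : ℝ}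
    (hε : ∀ (p : USphere n) (j : PairJet n), ‖j‖ < ε → ((p : Ambient n), j) ∈ jetDomain n)
    (hI : IsOpen I) (h : IsSmoothHypersurfaceFamily I x ν) (hflow : IsNormalRescaledMCF I x ν)
    (hrad : IsRadialGraph I x) :
    SatisfiesSphereEquation ε (fun q => radialTerm ((q.1 : Ambient n), q.2)) I x ν := by
  refine satisfiesSphereEquation_of_inCoords hn hI h hε fun t ht p hJ => ?_
  have hp := mem_extChartAt_target (I := 𝓡 n) p
  have hpp : (extChartAt (𝓡 n) p).symm (extChartAt (𝓡 n) p p) = p := extChartAt_to_inv p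
  have hd := h.hasDerivAt hI p ht hp
  rw [hpp] at hd
  set D := dirDeriv (timeDir n) (familyInCoords x p) (t, extChartAt (𝓡 n) p p)
  -- `x τ p` is its own projection to the line spanned by `p`, and so is its derivative
  have hproj : ∀ s ∈ I, (inner ℝ (x s p) (p : Ambient n) : ℝ) • (p : Ambient n) = x s p := by
    intro s hs
    obtain ⟨c, -, hc⟩ := hrad s hs p
    rw [hc, inner_smul_left, inner_self_usphere, mul_one]
    rfl
  have hD : D = (inner ℝ D (p : Ambient n) : ℝ) • (p : Ambient n) := by
    have h1 : HasDerivAt (fun s => (inner ℝ (x s p) (p : Ambient n) : ℝ) • (p : Ambient n))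
        ((inner ℝ D (p : Ambient n) : ℝ) • (p : Ambient n)) t := by
      have h2 := (hd.inner ℝ (hasDerivAt_const t (p : Ambient n))).smul_const (p : Ambient n)
      simpa using h2
    refine hd.unique (h1.congr_of_eventuallyEq ?_)
    filter_upwards [hI.mem_nhds ht] with s hs
    exact (hproj s hs).symm
  refine hJ.dirDeriv_normalDisplacement_of_radial hn (h.normal_flow_inCoords hI hflow p)
    (dirDeriv_timeDir_sphere hn t p)
    (c := inner ℝ D (p : Ambient n) - inner ℝ (x t p) (p : Ambient n)) ?_
  have hxt : familyInCoords x p (t, extChartAt (𝓡 n) p p) = x t p := by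
    simp only [familyInCoords, hpp]
  rw [hxt, sub_smul, hproj t ht, ← hD]

end NearSphere

theorem mainTheorem6 (n : ℕ) (hn : 1 ≤ n) :
    -- the linearized equation along an arbitrary solution
    (∀ (M : Type*) [TopologicalSpace M] [ChartedSpace (EuclideanSpace ℝ (Fin n)) M]
      [IsManifold (𝓡 n) ∞ M] (J I : Set ℝ)
      (x ν : ℝ → ℝ → M → EuclideanSpace ℝ (Fin (n + 1))),
      IsOpen J → (0 : ℝ) ∈ J → IsOpen I → IsRescaledMCFVariation J I x ν →
      ∀ t ∈ I, ∀ p : M,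
        HasDerivAt (fun τ => normalVariation x ν τ p)
          (laplaceBeltrami (x 0 t) (normalVariation x ν t) p
            + normSqSecondFF (x 0 t) (ν 0 t) p * normalVariation x ν t p
            + normalVariation x ν t p) t) ∧
    -- the sphere of radius `√n` is a stationary solution
    (IsUnitNormal (sphereEmb n) (fun p => (p : EuclideanSpace ℝ (Fin (n + 1)))) ∧
      IsRescaledMCF univ (fun _ => sphereEmb n)
        (fun _ p => (p : EuclideanSpace ℝ (Fin (n + 1))))) ∧
    -- the linearized equation along it
    (∀ (J I : Set ℝ) (x ν : ℝ → ℝ → USphere n → EuclideanSpace ℝ (Fin (n + 1))),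
      IsOpen J → (0 : ℝ) ∈ J → IsOpen I → IsRescaledMCFVariation J I x ν →
      (∀ t ∈ I, x 0 t = sphereEmb n) →
      ∀ t ∈ I, ∀ p : USphere n,
        HasDerivAt (fun τ => normalVariation x ν τ p)
          (laplaceBeltrami (sphereEmb n) (normalVariation x ν t) p
            + 2 * normalVariation x ν t p) t) ∧
    -- the nonlinear equation near the sphere, for solutions of the rescaled flow
    (∃ (ε : ℝ) (Q : USphere n × PairJet n → ℝ), 0 < ε ∧ IsQuadraticTerm ε Q ∧
      ∀ (I : Set ℝ) (x ν : ℝ → USphere n → EuclideanSpace ℝ (Fin (n + 1))),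
        IsOpen I → IsSmoothHypersurfaceFamily I x ν → IsRescaledMCF I x ν →
        SatisfiesSphereEquation ε Q I x ν) ∧
    -- the same for radial graphs over the sphere that move by the rescaled flow
    (∃ (ε : ℝ) (Q : USphere n × PairJet n → ℝ), 0 < ε ∧ IsQuadraticTerm ε Q ∧
      ∀ (I : Set ℝ) (x ν : ℝ → USphere n → EuclideanSpace ℝ (Fin (n + 1))),
        IsOpen I → IsSmoothHypersurfaceFamily I x ν → IsNormalRescaledMCF I x ν →
        IsRadialGraph I x → SatisfiesSphereEquation ε Q I x ν) := by
  refine ⟨fun M _ _ _ J I x ν hJ h0 hI h t ht p => h.hasDerivAt_normalVariation hJ h0 hI ht p,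
    ⟨isUnitNormal_sphereEmb hn, isRescaledMCF_sphereEmb hn⟩, ?_, ?_, ?_⟩
  · intro J I x ν hJ h0 hI h hx t ht p
    have h1 := h.hasDerivAt_normalVariation hJ h0 hI ht p
    have hν := h.isUnitNormal 0 h0 t ht
    rw [hx t ht] at h1 hν
    rw [normSqSecondFF_sphereEmb hn hν] at h1
    exact h1.congr_deriv (by ring)
  · obtain ⟨ε, hε, hQ, hdom⟩ := exists_isQuadraticTerm
      (fun q hq => contDiffAt_flowTerm hq.1 hq.2.1) (isBigO_flowTerm hn)
    exact ⟨ε, _, hε, hQ, fun I x ν hI h hflow =>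
      satisfiesSphereEquation_of_isRescaledMCF hn hdom hI h hflow⟩
  · obtain ⟨ε, hε, hQ, hdom⟩ := exists_isQuadraticTerm
      (fun q hq => contDiffAt_radialTerm hq.1 hq.2.1 hq.2.2) (isBigO_radialTerm hn)
    exact ⟨ε, _, hε, hQ, fun I x ν hI h hflow hrad =>
      satisfiesSphereEquation_of_isRadialGraph hn hdom hI h hflow hrad⟩
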